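/- **Setting.** An integrable system (with two degrees of freedom) is a triple $(M,\omega,F=(f_1,f_2))$, where $(M,\omega)$ is a smooth $4$-dimensional symplectic manifold (Hausdorff, second countable) and $F:M\to\mathbb{R}^2$ is smooth with $\{f_1,f_2\}=0$ and $\mathrm{d}F$ onto almost everywhere; $X_f$ is defined by $\omega(X_f,\cdot)=-\mathrm{d}f$ and $\{f,g\}=\omega(X_f,X_g)$. For $U\subset M$ open, the commutant $\mathcal{C}_F(U)$ is the set of $g\in C^\infty(U)$ with $\{f_1,g\}=\{f_2,g\}=0$ on $U$. A *neighborhood of a focus-focus fiber of multiplicity one* is such a system with compact connected fibers, all of whose singular points are non-degenerate without hyperbolic blocks, and which has only one singular fiber $F^{-1}(c_0)$, containing exactly one focus-focus point $p_0$. Two of them, $(M_1,\omega_1,F_1)$ and $(M_2,\omega_2,F_2)$, are *isomorphic* if there are open neighborhoods $W_i$ of their focus-focus values and a symplectomorphism $\varphi:F_1^{-1}(W_1)\to F_2^{-1}(W_2)$ such that $\mathcal{C}_{F_1}(F_1^{-1}(W_1))=\mathcal{C}_{F_2\circ\varphi}(F_1^{-1}(W_1))$; $[(M,\omega,F)]$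 denotes the isomorphism class (of the germ at the focus-focus fiber). **Normalized neighborhoods.** Let $\mathbb{R}^4$ carry $\mathrm{d}x_1\wedge\mathrm{d}y_1+\mathrm{d}x_2\wedge\mathrm{d}y_2$ and $q=(x_1y_2-x_2y_1,\;x_1y_1+x_2y_2)$. An *Eliasson isomorphism* of $(M,\omega,F)$ is a pair $(\varphi,g)$ of a symplectomorphism $\varphi:U\to V$ between open neighborhoods of $p_0\in M$ and $0\in\mathbb{R}^4$ and a diffeomorphism $g:F(U)\to q(V)$ with $g(c_0)=0$ and $g\circ F=q\circ\varphi$ on $U$. It yields the normalized neighborhood $(M',\omega,F')$ with $M'=F^{-1}(F(U))$ and $F'=g\circ F$. For $w\neq0$ near $0$ let $\Sigma_w$ be the period lattice: the set of covectors $\tau_1\mathrm{d}a+\tau_2\mathrm{d}b$ at $w$ such that the flow of $X_{\tau_1f_1'+\tau_2f_2'}$ at time $2\pi$ fixes a point of $F'^{-1}(w)$. The *regularized action* of the normalized neighborhood (after shrinking it to the part over a neighborhood of $0$) is the smooth function $\mathsf{h}$ near $0\in\mathbb{R}^2$ with, for $w=a+ib\neq0$ near $0$, $$\Sigma_w=\mathbb{Z}\Big\langle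 \mathrm{d}a,\ \tfrac1{2\pi}\,\mathrm{Im}\,\mathrm{d}(w\log w-w)+\mathrm{d}\mathsf{h}\Big\rangle ,\qquad \mathsf{h}(0)=0,\quad \tfrac{\partial\mathsf{h}}{\partial a}(0)\in[0,1).$$ **Taylor series orbit.** Let $K_4=\mathbb{Z}/2\times\mathbb{Z}/2$ act on the right on $\mathbb{R}[[a,b]]_{\mathrm{ff}}:=\mathbb{R}[[a,b]]/(\mathbb{R}\oplus\mathbb{Z}a)$ by $$T\star(j_1,j_2)=\epsilon_2\,T(\epsilon_1a,\epsilon_2b)+\tfrac{j_1a}{2},\qquad \epsilon_i=(-1)^{j_i},$$ and write $\mathcal{O}(T)$ for the orbit of $T$ and $[\mathsf{h}]^\infty$ for the class of the Taylor series of $\mathsf{h}$ at $0$. The Taylor series orbit $\mathcal{O}(M,\omega,F)\subset\mathbb{R}[[a,b]]_{\mathrm{ff}}$ is $\mathcal{O}([\mathsf{h}]^\infty)$, where $\mathsf{h}$ is the regularized action of any normalized neighborhood obtained from $(M,\omega,F)$ by an Eliasson isomorphism. **Proposition.** Let $(M_1,\omega_1,F_1)$ and $(M_2,\omega_2,F_2)$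 belong to the same isomorphism class $[(M,\omega,F)]$. Then $$\mathcal{O}(M_1,\omega_1,F_1)=\mathcal{O}(M_2,\omega_2,F_2),$$ and this set is $\mathcal{O}([\mathsf{h}]^\infty)$ for the regularized action $\mathsf{h}$ of every normalized neighborhood obtained from $(M_1,\omega_1,F_1)$ or from $(M_2,\omega_2,F_2)$. Hence the Taylor series orbit is an invariant of the isomorphism class. -/

import Mathlib

open scoped Manifold ContDiff

noncomputable section

namespace FocusFocus

/-- The model space of four-dimensional manifolds. -/
abbrev E4 : Type := EuclideanSpace ℝ (Fin 4)

/-- `ℝ^{2m}` with coordinates `(x_1, y_1, …, x_m, y_m)`: the `i`-th entry is `(x_i, y_i)`. -/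
abbrev V (m : ℕ) : Type := Fin m → ℝ × ℝ

/-- The canonical symplectic form `∑ dx_i ∧ dy_i` on `ℝ^{2m}`. -/
def omegaCan {m : ℕ} (u v : V m) : ℝ := ∑ i, ((u i).1 * (v i).2 - (u i).2 * (v i).1)

/-- First component `x_1 y_2 - x_2 y_1` of the focus-focus model. -/
def q₁ (z : V 2) : ℝ := (z 0).1 * (z 1).2 - (z 1).1 * (z 0).2

/-- Second component `x_1 y_1 + x_2 y_2` of the focus-focus model. -/
def q₂ (z : V 2) : ℝ := (z 0).1 * (z 0).2 + (z 1).1 * (z 1).2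

/-- The focus-focus model `q = (q_1, q_2)`. -/
def q (z : V 2) : ℝ × ℝ := (q₁ z, q₂ z)

/-- The elliptic quadratic form `(x_i ^ 2 + y_i ^ 2) / 2`. -/
def ell {m : ℕ} (i : Fin m) (z : V m) : ℝ := ((z i).1 ^ 2 + (z i).2 ^ 2) / 2

/-! ### Symplectic manifolds and integrable systems with two degrees of freedom -/

section Manifold

variable {M : Type*} [TopologicalSpace M] [ChartedSpace E4 M]

/-- The 2-form `Ω` written in the preferred chart at `x₀`, i.e. its pull-back by the inverse chart. -/
def formInChart (Ω : (p : M) → (TangentSpace (𝓡 4) p) [⋀^Fin 2]→L[ℝ] ℝ) (x₀ : M) (y : E4) :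
    E4 [⋀^Fin 2]→L[ℝ] ℝ :=
  (Ω ((chartAt E4 x₀).symm y)).compContinuousLinearMap
    (mfderiv 𝓘(ℝ, E4) (𝓡 4) (chartAt E4 x₀).symm y)

/-- The differential `d_pf`. -/
def differential (f : M → ℝ) (p : M) : TangentSpace (𝓡 4) p →L[ℝ] ℝ :=
  mfderiv (𝓡 4) 𝓘(ℝ, ℝ) f p

variable (M) in
/-- A symplectic form on `M`: a smooth closed non-degenerate differential 2-form. -/
structure SymplecticForm where
  form : (p : M) → (TangentSpace (𝓡 4) p) [⋀^Fin 2]→L[ℝ] ℝ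
  smooth : ∀ x₀ : M, ContDiffOn ℝ ∞ (formInChart form x₀) (chartAt E4 x₀).target
  closed : ∀ x₀ : M, ∀ y ∈ (chartAt E4 x₀).target, extDeriv (formInChart form x₀) y = 0
  nondegenerate : ∀ (p : M) (u : TangentSpace (𝓡 4) p), (∀ v, form p ![u, v] = 0) → u = 0

namespace SymplecticForm

theorem update_fst {T : Type*} (u v x : T) : Function.update ![u, v] 0 x = ![x, v] := by
  funext i; fin_cases i <;> rfl

theorem update_snd {T : Type*} (u v x : T) : Function.update ![u, v] 1 x = ![u, x] := by
  funext i; fin_cases i <;> rfl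

/-- The linear map `u ↦ Ω_p(u, ·)`. -/
def flat (Ω : SymplecticForm M) (p : M) :
    TangentSpace (𝓡 4) p →ₗ[ℝ] Module.Dual ℝ (TangentSpace (𝓡 4) p) :=
  LinearMap.mk₂ ℝ (fun u v => Ω.form p ![u, v])
    (fun u u' v => by
      have h := (Ω.form p).toMultilinearMap.map_update_add ![u, v] 0 u u'
      simp only [update_fst] at h
      exact h)
    (fun c u v => by
      have h := (Ω.form p).toMultilinearMap.map_update_smul ![u, v] 0 c u
      simp only [update_fst] at h
      exact h)
    (fun u v v' => by
      have h := (Ω.form p).toMultilinearMap.map_update_add ![u, v] 1 v v'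
      simp only [update_snd] at h
      exact h)
    (fun c u v => by
      have h := (Ω.form p).toMultilinearMap.map_update_smul ![u, v] 1 c v
      simp only [update_snd] at h
      exact h)

theorem flat_bijective (Ω : SymplecticForm M) (p : M) : Function.Bijective (Ω.flat p) := by
  have hfd : FiniteDimensional ℝ (TangentSpace (𝓡 4) p) :=
    inferInstanceAs (FiniteDimensional ℝ E4)
  have hinj : Function.Injective (Ω.flat p) := by
    rw [injective_iff_map_eq_zero]
    intro u hu
    exact Ω.nondegenerate p u fun v => by simpa [flat] using LinearMap.congr_fun hu v
  exact ⟨hinj, (LinearMap.injective_iff_surjective_of_finrank_eq_finrank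
    (Subspace.dual_finrank_eq (K := ℝ) (V := TangentSpace (𝓡 4) p)).symm).1 hinj⟩

/-- The Hamiltonian vector field `X_f`, defined by `Ω(X_f, ·) = -df`. -/
def hamVec (Ω : SymplecticForm M) (f : M → ℝ) (p : M) : TangentSpace (𝓡 4) p :=
  (LinearEquiv.ofBijective (Ω.flat p) (Ω.flat_bijective p)).symm
    (-(differential f p).toLinearMap)

theorem form_hamVec (Ω : SymplecticForm M) (f : M → ℝ) (p : M) (v : TangentSpace (𝓡 4) p) :
    Ω.form p ![Ω.hamVec f p, v] = -differential f p v := by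
  have h := LinearEquiv.apply_symm_apply
    (LinearEquiv.ofBijective (Ω.flat p) (Ω.flat_bijective p))
    (-(differential f p).toLinearMap)
  exact LinearMap.congr_fun h v

/-- The Poisson bracket `{f, g} = Ω(X_f, X_g)`. -/
def bracket (Ω : SymplecticForm M) (f g : M → ℝ) (p : M) : ℝ :=
  Ω.form p ![Ω.hamVec f p, Ω.hamVec g p]

/-- The commutant of `F = (f_1, f_2)` in the open set `U`: the smooth functions on `U` which
Poisson commute with `f_1` and `f_2` on `U` (values outside `U` are irrelevant). -/
def commutant (Ω : SymplecticForm M) (F : M → ℝ × ℝ) (U : Set M) : Set (M → ℝ) :=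
  {f | ContMDiffOn (𝓡 4) 𝓘(ℝ, ℝ) ∞ f U ∧
    ∀ p ∈ U, Ω.bracket (fun x => (F x).1) f p = 0 ∧ Ω.bracket (fun x => (F x).2) f p = 0}

end SymplecticForm

/-- A point is singular for `F` if `d_pF` is not onto. -/
def IsSingular (F : M → ℝ × ℝ) (p : M) : Prop :=
  ¬ Function.Surjective (mfderiv (𝓡 4) 𝓘(ℝ, ℝ × ℝ) F p)

variable (M) in
/-- An integrable system with two degrees of freedom on `M`; the independence almost everywhere is
with respect to the Lebesgue measure class in charts. -/
structure IntegrableSystem where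
  Ω : SymplecticForm M
  F : M → ℝ × ℝ
  smooth : ContMDiff (𝓡 4) 𝓘(ℝ, ℝ × ℝ) ∞ F
  involution : ∀ p, Ω.bracket (fun x => (F x).1) (fun x => (F x).2) p = 0
  independent : ∀ x₀ : M, MeasureTheory.volume
    (chartAt E4 x₀ '' {p | p ∈ (chartAt E4 x₀).source ∧ IsSingular F p}) = 0

/-- The function `τ_1 f_1 + τ_2 f_2` for `F = (f_1, f_2)`. -/
def comb (τ : ℝ × ℝ) (F : M → ℝ × ℝ) (p : M) : ℝ := τ.1 * (F p).1 + τ.2 * (F p).2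

/-- The Hessian of `f` at `p`, as a bilinear form on `T_pM` (meaningful at critical points of `f`).
In Mathlib `T_pM` is identified with `ℝ⁴` by the preferred chart at `p`. -/
def hessian (f : M → ℝ) (p : M) (u v : TangentSpace (𝓡 4) p) : ℝ :=
  fderiv ℝ (fderiv ℝ (f ∘ (chartAt E4 p).symm)) (chartAt E4 p p) (u : E4) (v : E4)

end Manifold

/-! ### Non-degenerate singular points -/

section Linear

variable {m : ℕ}

/-- Membership in `𝔰𝔭(2m, ℝ)`. -/
def InSp (A : Module.End ℝ (V m)) : Prop :=
  ∀ u v, omegaCan (A u) v + omegaCan u (A v) = 0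

/-- Cartan subalgebras of `𝔰𝔭(2m, ℝ)`: abelian, of dimension `m`, and self-normalising. -/
structure IsCartan (𝔥 : Submodule ℝ (Module.End ℝ (V m))) : Prop where
  inSp : ∀ A ∈ 𝔥, InSp A
  abelian : ∀ A ∈ 𝔥, ∀ B ∈ 𝔥, ⁅A, B⁆ = 0
  finrank_eq : Module.finrank ℝ 𝔥 = m
  selfNormalising : ∀ A, InSp A → (∀ B ∈ 𝔥, ⁅A, B⁆ ∈ 𝔥) → A ∈ 𝔥

/-- The quadratic form `z ↦ -Ω(Az, z) / 2`, i.e. the quadratic Hamiltonian of the linear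
vector field `A ∈ 𝔰𝔭(2m, ℝ)`. -/
def quadForm : Module.End ℝ (V m) →ₗ[ℝ] (V m → ℝ) where
  toFun A z := -(omegaCan (A z) z) / 2
  map_add' A B := by
    funext z
    simp only [omegaCan, LinearMap.add_apply, Pi.add_apply, Prod.fst_add, Prod.snd_add]
    rw [← add_div, ← neg_add, ← Finset.sum_add_distrib]
    congr 2
    exact Finset.sum_congr rfl fun i _ => by ring
  map_smul' c A := by
    funext z
    simp only [omegaCan, LinearMap.smul_apply, Pi.smul_apply, Prod.smul_fst, Prod.smul_snd,
      smul_eq_mul, RingHom.id_apply]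
    rw [← mul_div_assoc, mul_neg, Finset.mul_sum]
    congr 2
    exact Finset.sum_congr rfl fun i _ => by ring

end Linear

section Singular

variable {M : Type*} [TopologicalSpace M] [ChartedSpace E4 M]

namespace IntegrableSystem

/-- Canonical linear coordinates on the reduced symplectic space `(T_pO)^Ω / T_pO`, where `O` is
the orbit of the infinitesimal action through `p`. Since `Ω(X_f, ·) = -df`, the symplectic
orthogonal `(T_pO)^Ω` is `ker d_pF`. The coordinates are given as a linear map on `(T_pO)^Ω` that
is onto `ℝ^{2m}` and pulls the canonical form back to `Ω`; its kernel is then `T_pO`, and `m` is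
two minus the rank of `p`. -/
structure ReducedCoordinates (S : IntegrableSystem M) (p : M) (m : ℕ) where
  toFun : LinearMap.ker (mfderiv (𝓡 4) 𝓘(ℝ, ℝ × ℝ) S.F p).toLinearMap →ₗ[ℝ] V m
  surjective : Function.Surjective toFun
  symplectic : ∀ u v, omegaCan (toFun u) (toFun v) =
    S.Ω.form p ![(u : TangentSpace (𝓡 4) p), (v : TangentSpace (𝓡 4) p)]

/-- The space `𝔥_p` of the linearisations at `p` of the Hamiltonian vector fields of those
`f = τ_1 f_1 + τ_2 f_2` that are critical at `p`, acting on the reduced space and written in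
canonical coordinates. The linearisation `A` of `X_f` is given by `Ω(Au, v) = -Hess f(u, v)`. -/
def linearised (S : IntegrableSystem M) {p : M} {m : ℕ} (π : S.ReducedCoordinates p m) :
    Submodule ℝ (Module.End ℝ (V m)) :=
  Submodule.span ℝ {A | ∃ τ : ℝ × ℝ, differential (comb τ S.F) p = 0 ∧
    ∀ u v, omegaCan (A (π.toFun u)) (π.toFun v) = -hessian (comb τ S.F) p u v}

/-- The point `p` is non-degenerate, of rank `2 - m`, and in suitable canonical coordinates the
Cartan subalgebra `𝔥_p`, seen as a space of quadratic forms, has the basis `b`. -/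
def IsNondegenerateOfType (S : IntegrableSystem M) (p : M) (m : ℕ) (b : Set (V m → ℝ)) : Prop :=
  ∃ π : S.ReducedCoordinates p m, IsCartan (S.linearised π) ∧
    (S.linearised π).map quadForm = Submodule.span ℝ b

/-- Williamson type `(0, 2, 0, 0)`. -/
def IsEllipticElliptic (S : IntegrableSystem M) (p : M) : Prop :=
  S.IsNondegenerateOfType p 2 {ell 0, ell 1}

/-- Williamson type `(1, 1, 0, 0)`. -/
def IsEllipticRegular (S : IntegrableSystem M) (p : M) : Prop :=
  S.IsNondegenerateOfType p 1 {ell 0}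

/-- Williamson type `(0, 0, 0, 1)`. -/
def IsFocusFocus (S : IntegrableSystem M) (p : M) : Prop :=
  S.IsNondegenerateOfType p 2 {q₁, q₂}

/-- Almost-toric systems: compact fibers, and all singular points are non-degenerate without
hyperbolic blocks. With two degrees of freedom the Williamson types without hyperbolic block are
the three listed ones. -/
structure IsAlmostToric (S : IntegrableSystem M) : Prop where
  compact_fibers : ∀ c, IsCompact (S.F ⁻¹' {c})
  nonhyperbolic : ∀ p, IsSingular S.F p →
    S.IsEllipticElliptic p ∨ S.IsEllipticRegular p ∨ S.IsFocusFocus p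

end IntegrableSystem

/-! ### Neighborhoods of focus-focus fibers -/

variable (M) in
/-- A neighborhood of a focus-focus fiber of multiplicity one: an almost-toric system with connected
fibers and only one singular fiber `F⁻¹(c₀)`, which contains exactly one focus-focus point `p₀`. -/
structure FFNeighborhood extends IntegrableSystem M where
  almostToric : toIntegrableSystem.IsAlmostToric
  connected_fibers : ∀ c, IsPreconnected (F ⁻¹' {c})
  c₀ : ℝ × ℝ
  p₀ : M
  F_p₀ : F p₀ = c₀
  focusFocus : toIntegrableSystem.IsFocusFocus p₀
  multiplicity_one : ∀ p, F p = c₀ → toIntegrableSystem.IsFocusFocus p → p = p₀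
  singular_fiber : ∀ p, IsSingular F p → F p = c₀

namespace FFNeighborhood

/-- Two neighborhoods of focus-focus fibers of multiplicity one are isomorphic if there are
saturated open neighborhoods `F_i⁻¹(W_i)` of the focus-focus fibers and a symplectomorphism `φ`
from the first onto the second such that `F_1` and `F_2 ∘ φ` have the same commutant. -/
def Isomorphic {M₁ M₂ : Type*} [TopologicalSpace M₁] [ChartedSpace E4 M₁]
    [TopologicalSpace M₂] [ChartedSpace E4 M₂]
    (S₁ : FFNeighborhood M₁) (S₂ : FFNeighborhood M₂) : Prop :=
  ∃ (W₁ W₂ : Set (ℝ × ℝ)) (φ : OpenPartialHomeomorph M₁ M₂),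
    IsOpen W₁ ∧ S₁.c₀ ∈ W₁ ∧ IsOpen W₂ ∧ S₂.c₀ ∈ W₂ ∧
    φ.source = S₁.F ⁻¹' W₁ ∧ φ.target = S₂.F ⁻¹' W₂ ∧
    ContMDiffOn (𝓡 4) (𝓡 4) ∞ φ φ.source ∧ ContMDiffOn (𝓡 4) (𝓡 4) ∞ φ.symm φ.target ∧
    (∀ p ∈ φ.source, ∀ u v : TangentSpace (𝓡 4) p,
      S₂.Ω.form (φ p) ![mfderiv (𝓡 4) (𝓡 4) φ p u, mfderiv (𝓡 4) (𝓡 4) φ p v] =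
        S₁.Ω.form p ![u, v]) ∧
    S₁.Ω.commutant S₁.F φ.source = S₁.Ω.commutant (S₂.F ∘ φ) φ.source

/-- An Eliasson isomorphism `(φ, g)`: a symplectomorphism `φ` from an open neighborhood `U` of the
focus-focus point onto an open neighborhood `V` of the origin of `ℝ⁴`, and a diffeomorphism
`g : F(U) → q(V)` with `g(c₀) = 0` and `g ∘ F = q ∘ φ` on `U`. -/
structure EliassonIsomorphism (S : FFNeighborhood M) where
  φ : OpenPartialHomeomorph M (V 2)
  g : OpenPartialHomeomorph (ℝ × ℝ) (ℝ × ℝ)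
  p₀_mem : S.p₀ ∈ φ.source
  zero_mem : (0 : V 2) ∈ φ.target
  φ_smooth : ContMDiffOn (𝓡 4) 𝓘(ℝ, V 2) ∞ φ φ.source
  φ_symm_smooth : ContMDiffOn 𝓘(ℝ, V 2) (𝓡 4) ∞ φ.symm φ.target
  φ_symplectic : ∀ p ∈ φ.source, ∀ u v : TangentSpace (𝓡 4) p,
    omegaCan (mfderiv (𝓡 4) 𝓘(ℝ, V 2) φ p u : V 2) (mfderiv (𝓡 4) 𝓘(ℝ, V 2) φ p v : V 2) =
      S.Ω.form p ![u, v]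
  g_source : g.source = S.F '' φ.source
  g_target : g.target = q '' φ.target
  g_smooth : ContDiffOn ℝ ∞ g g.source
  g_symm_smooth : ContDiffOn ℝ ∞ g.symm g.target
  g_c₀ : g S.c₀ = 0
  commutes : ∀ p ∈ φ.source, g (S.F p) = q (φ p)

namespace EliassonIsomorphism

variable {S : FFNeighborhood M}

/-- The domain `M' = F⁻¹(F(U))` of the normalized neighborhood `((M', Ω, g ∘ F), φ)` obtained from
the Eliasson isomorphism `(φ, g)`. -/
def domain (N : S.EliassonIsomorphism) : Set M := S.F ⁻¹' (S.F '' N.φ.source)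

/-- The moment map `g ∘ F` (on `N.domain`) of the normalized neighborhood. -/
def moment (N : S.EliassonIsomorphism) : M → ℝ × ℝ := N.g ∘ S.F

/-- The fiber at `w` of the bundle of periods of the normalized neighborhood: the covectors
`τ_1 da + τ_2 db` for which the Hamiltonian flow of `τ_1 f_1 + τ_2 f_2`, with `(f_1, f_2)` the
normalized moment map, fixes a point of the fiber over `w` at time `2π`. -/
def periods (N : S.EliassonIsomorphism) (w : ℝ × ℝ) : Set (ℝ × ℝ) :=
  {τ | ∃ γ : ℝ → M, IsMIntegralCurve (I := 𝓡 4) γ (S.Ω.hamVec (comb τ N.moment)) ∧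
    (∀ t, γ t ∈ N.domain) ∧ N.moment (γ 0) = w ∧ γ (2 * Real.pi) = γ 0}

/-- The covector at `w = a + ib ≠ 0` of `(1 / 2π) Im d(w log w - w) + dh`, that is, of
`(1 / 2π) (arg w da + log |w| db) + dh`, in the basis `da, db`. (Another determination of `log`
changes it by an integer multiple of `da`.) -/
def singularPeriod (h : ℝ × ℝ → ℝ) (w : ℝ × ℝ) : ℝ × ℝ :=
  ((Complex.log ⟨w.1, w.2⟩).im / (2 * Real.pi) + fderiv ℝ h w (1, 0),
    (Complex.log ⟨w.1, w.2⟩).re / (2 * Real.pi) + fderiv ℝ h w (0, 1))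

/-- `h` is the regularized action of the normalized neighborhood, possibly after shrinking it to
the part over an open neighborhood `W` of the focus-focus value `0`: `h` is smooth on `W`, the
bundle of periods over `W` minus the origin is spanned over `ℤ` by `da` and
`(1 / 2π) Im d(w log w - w) + dh`, and `h(0) = 0`, `∂h/∂a(0) ∈ [0, 1)`. -/
def IsRegularizedAction (N : S.EliassonIsomorphism) (h : ℝ × ℝ → ℝ) : Prop :=
  (∃ W : Set (ℝ × ℝ), IsOpen W ∧ (0 : ℝ × ℝ) ∈ W ∧ W ⊆ N.moment '' N.domain ∧
    ContDiffOn ℝ ∞ h W ∧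
    ∀ w ∈ W, w ≠ 0 →
      N.periods w = (AddSubgroup.closure {(1, 0), singularPeriod h w} : Set (ℝ × ℝ))) ∧
  h 0 = 0 ∧ fderiv ℝ h 0 (1, 0) ∈ Set.Ico (0 : ℝ) 1

end EliassonIsomorphism

end FFNeighborhood

end Singular

/-! ### Taylor series and the action of the Klein group -/

/-- The Taylor series at the origin of a function of `(a, b)`; the variables `a`, `b` of the power
series are `X 0`, `X 1`. -/
def taylor (h : ℝ × ℝ → ℝ) : MvPowerSeries (Fin 2) ℝ := fun n =>
  iteratedFDeriv ℝ (n 0 + n 1) h 0 (fun k => if (k : ℕ) < n 0 then (1, 0) else (0, 1)) /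
    ((Nat.factorial (n 0) : ℝ) * (Nat.factorial (n 1) : ℝ))

/-- The additive subgroup `ℝ ⊕ ℤ a` of `ℝ⟦a, b⟧`. -/
def ffSubgroup : AddSubgroup (MvPowerSeries (Fin 2) ℝ) :=
  (MvPowerSeries.C (σ := Fin 2) (R := ℝ)).toAddMonoidHom.range ⊔
    AddSubgroup.zmultiples (MvPowerSeries.X 0)

/-- The quotient `ℝ⟦a, b⟧ / (ℝ ⊕ ℤ a)`. -/
abbrev FFSeries : Type := MvPowerSeries (Fin 2) ℝ ⧸ ffSubgroup

/-- The Klein group. -/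
abbrev K4 : Type := ZMod 2 × ZMod 2

/-- The isomorphism from `ℤ/2` to `{1, -1}`. -/
def sgn (j : ZMod 2) : ℤ := if j = 0 then 1 else -1

/-- The additive map `T(a, b) ↦ ε_2 T(ε_1 a, ε_2 b)`, with `ε_i` the sign of `j_i`. -/
def signChange (j : K4) : MvPowerSeries (Fin 2) ℝ →+ MvPowerSeries (Fin 2) ℝ where
  toFun T := sgn j.2 • MvPowerSeries.rescale ![(sgn j.1 : ℝ), (sgn j.2 : ℝ)] T
  map_zero' := by simp
  map_add' T T' := by simp

theorem signChange_mem (j : K4) : ffSubgroup ≤ ffSubgroup.comap (signChange j) := by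
  rw [ffSubgroup, sup_le_iff]
  constructor
  · rintro _ ⟨c, rfl⟩
    refine AddSubgroup.mem_comap.2 (AddSubgroup.zsmul_mem _ (AddSubgroup.mem_sup_left ?_) _)
    refine AddMonoidHom.mem_range.2 ⟨c, ?_⟩
    ext n
    simp only [MvPowerSeries.coeff_rescale]
    by_cases hn : n = 0
    · subst hn; simp
    · simp [MvPowerSeries.coeff_C, hn]
  · rw [AddSubgroup.zmultiples_le]
    refine AddSubgroup.mem_comap.2 (AddSubgroup.zsmul_mem _ (AddSubgroup.mem_sup_right
      (AddSubgroup.mem_zmultiples_iff.2 ⟨sgn j.1, ?_⟩)) _)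
    ext n
    rw [MvPowerSeries.coeff_rescale, MvPowerSeries.coeff_X, map_zsmul, MvPowerSeries.coeff_X]
    by_cases hn : n = Finsupp.single 0 1
    · subst hn; simp
    · simp [hn]

/-- The right action of the Klein group on `ℝ⟦a, b⟧ / (ℝ ⊕ ℤ a)`:
`T ⋆ (j_1, j_2) = ε_2 T(ε_1 a, ε_2 b) + j_1 a / 2`. -/
def kleinAct (T : FFSeries) (j : K4) : FFSeries :=
  QuotientAddGroup.map ffSubgroup ffSubgroup (signChange j) (signChange_mem j) T +
    QuotientAddGroup.mk (((j.1.val : ℝ) / 2) • MvPowerSeries.X 0)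

/-- The orbit of `T` under the Klein group. -/
def orbit (T : FFSeries) : Set FFSeries := Set.range (kleinAct T)

/-- The orbit of the class of the Taylor series of `h` in `ℝ⟦a, b⟧ / (ℝ ⊕ ℤ a)`. -/
def taylorOrbit (h : ℝ × ℝ → ℝ) : Set FFSeries := orbit (QuotientAddGroup.mk (taylor h))

/-- The Taylor series orbit of a neighborhood of a focus-focus fiber of multiplicity one: the orbit
of the Taylor series of the regularized action of any normalized neighborhood obtained from it by
an Eliasson isomorphism. Since the orbit turns out not to depend on the choices, the union over all
choices is the orbit given by any single one. -/
def FFNeighborhood.taylorSeriesOrbit {M : Type*} [TopologicalSpace M] [ChartedSpace E4 M]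
    (S : FFNeighborhood M) : Set FFSeries :=
  {T | ∃ (N : S.EliassonIsomorphism) (h : ℝ × ℝ → ℝ), N.IsRegularizedAction h ∧ T ∈ taylorOrbit h}

end FocusFocus

end

open FocusFocus

noncomputable section

open Filter Topology Asymptotics

namespace FocusFocus

/-! Two facts are needed: the orbit does not depend on the Eliasson isomorphism, and a normalized
neighborhood can be carried along an isomorphism of systems without changing its regularized action.

Independence of choices. Two normalizations of one system differ by a local diffeomorphism `G` of
the plane fixing `0`, and pull-back by `dG` matches the two period lattices. Restrict to a ray `t
(1, s)` with `t → 0⁺`. Each lattice is spanned by `da` and a covector whose `da`-component is smooth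
in `t` and whose `db`-component is `(log t + smooth) / 2π`. The logarithm makes this rigid
(`lattice_comparison`). Convergent integers are eventually constant, so `da` pulls back to `κ da`
and the second generator has coefficient `ν`, with signs `κ` and `ν`. What remains are equations `u
log t = v` with `u`, `v` smooth, which force both to vanish to infinite order
(`rightFlat_of_mul_log_eq`). Hence `G` agrees with `(κ a, ν b)` to infinite order along the ray, and
`h' (κ a, ν b) = ν h (a, b) + c a + d` up to a flat error (`period_comparison_on_ray`). Comparing
the arguments of `1 + i s` and `κ + i ν s` shows that `c` is an integer if `κ = 1` and half an odd
integer if `κ = -1`; this is the source of the term `j₁ a / 2`. A smooth function that is flat on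
almost all rays has zero Taylor series (`mixedDeriv_eq_zero_of_rightFlat`), so the two Taylor
classes differ by the Klein group.

Invariance. The components of `F₂ ∘ Φ` lie in their own commutant, hence they commute with `F₁`. At
regular points the Hamiltonian fields of `F₁` span the tangent space of the fiber, so `F₂ ∘ Φ` is
locally a smooth function `G` of `F₁`; connected fibers and density extend this to whole fibers
(`FiberIsomorphism.exists_factorization`). At the preimage `p` of the second focus-focus point,
every nonzero combination of the components of `F₂` has a non-degenerate Hessian, while a degenerate
`dG` would give one whose Hessian kills the image of the kernel of `d_pF₁`. So `G` is a local
diffeomorphism, `p` is itself focus-focus, and it is the first focus-focus point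
(`nonempty_baseMap`). Composing an Eliasson isomorphism with the inverses of `Φ` and `G` gives one
of the second system with the same periods, hence the same `h` (`isRegularizedAction_transport`). -/

/-! ### Smooth functions of one variable at the origin -/

/-- A function is flat at `0⁺` if it decays faster than every power of `t` as `t → 0⁺`. -/
def RightFlat {E : Type*} [NormedAddCommGroup E] (f : ℝ → E) : Prop :=
  ∀ n : ℕ, f =O[𝓝[>] 0] fun t : ℝ => t ^ n

/-- Taylor's formula with only the leading term left. It allows derivatives at `0` to be read off
from one-sided limits, which is all that the logarithm permits. -/
theorem tendsto_div_pow_of_iteratedDeriv_eq_zero {f : ℝ → ℝ} (hf : ContDiff ℝ ∞ f) {n : ℕ}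
    (h0 : ∀ i < n, iteratedDeriv i f 0 = 0) :
    Tendsto (fun t => f t / t ^ n) (𝓝[>] 0) (𝓝 (iteratedDeriv n f 0 / n.factorial)) := by
  have h := Real.taylor_tendsto (n := n) convex_univ (Set.mem_univ (0 : ℝ))
    (hf.of_le (by exact_mod_cast le_top)).contDiffOn
  rw [nhdsWithin_univ] at h
  have h' := (h.mono_left (nhdsWithin_le_nhds (s := Set.Ioi 0))).add_const
    (iteratedDeriv n f 0 / n.factorial)
  rw [zero_add] at h'
  refine h'.congr' ?_
  filter_upwards [self_mem_nhdsWithin] with t ht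
  have ht' : t ^ n ≠ 0 := pow_ne_zero _ (ne_of_gt ht)
  rw [taylor_within_apply, Finset.sum_range_succ, Finset.sum_eq_zero]
  · simp only [sub_zero, zero_add, smul_eq_mul, iteratedDerivWithin_univ]
    field_simp
    ring
  · intro i hi
    rw [iteratedDerivWithin_univ, h0 i (Finset.mem_range.1 hi), smul_zero]

theorem isBigO_pow_of_iteratedDeriv_eq_zero {f : ℝ → ℝ} (hf : ContDiff ℝ ∞ f) {n : ℕ}
    (h0 : ∀ i < n, iteratedDeriv i f 0 = 0) : f =O[𝓝[>] 0] fun t : ℝ => t ^ n := by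
  refine isBigO_of_div_tendsto_nhds ?_ _ (tendsto_div_pow_of_iteratedDeriv_eq_zero hf h0)
  filter_upwards [self_mem_nhdsWithin] with t ht h
  exact absurd h (pow_ne_zero _ (ne_of_gt ht))

theorem tendsto_id_nhdsGT : Tendsto (fun t : ℝ => t) (𝓝[>] 0) (𝓝 0) :=
  tendsto_id.mono_left nhdsWithin_le_nhds

theorem pow_succ_isLittleO (n : ℕ) :
    (fun t : ℝ => t ^ (n + 1)) =o[𝓝[>] 0] fun t : ℝ => t ^ n :=
  (isLittleO_pow_pow (𝕜 := ℝ) (Nat.lt_succ_self n)).mono nhdsWithin_le_nhds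

/-- Strong induction: once the lower derivatives vanish, `f t / t ^ n` tends both to the next Taylor
coefficient and to `0`. -/
theorem RightFlat.iteratedDeriv_eq_zero {f : ℝ → ℝ} (hf : ContDiff ℝ ∞ f) (h : RightFlat f)
    (n : ℕ) : iteratedDeriv n f 0 = 0 := by
  induction n using Nat.strong_induction_on with
  | _ n ih =>
    have h1 := tendsto_div_pow_of_iteratedDeriv_eq_zero hf ih
    have h2 := ((h (n + 1)).trans_isLittleO (pow_succ_isLittleO n)).tendsto_div_nhds_zero
    have := tendsto_nhds_unique h1 h2
    have h3 : (n.factorial : ℝ) ≠ 0 := by positivity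
    simpa [h3] using this

/-- If `u log t = v` for small `t > 0`, with `u` and `v` smooth at `0`, then both are flat. -/
theorem rightFlat_of_mul_log_eq {u v : ℝ → ℝ} (hu : ContDiff ℝ ∞ u) (hv : ContDiff ℝ ∞ v)
    (h : ∀ᶠ t in 𝓝[>] 0, u t * Real.log t = v t) : RightFlat u ∧ RightFlat v := by
  have key : ∀ n, iteratedDeriv n u 0 = 0 ∧ iteratedDeriv n v 0 = 0 := by
    intro n
    induction n using Nat.strong_induction_on with
    | _ n ih =>
      have hfac : (n.factorial : ℝ) ≠ 0 := by positivity
      have hu1 := tendsto_div_pow_of_iteratedDeriv_eq_zero hu fun i hi => (ih i hi).1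
      have hv1 := tendsto_div_pow_of_iteratedDeriv_eq_zero hv fun i hi => (ih i hi).2
      have hlog : Tendsto (fun t => (Real.log t)⁻¹) (𝓝[>] 0) (𝓝 0) :=
        tendsto_inv_atBot_zero.comp Real.tendsto_log_nhdsGT_zero
      -- Here `u / t ^ n = (v / t ^ n) (log t)⁻¹`, where `v / t ^ n` has a finite limit and `(log
      -- t)⁻¹ → 0`.
      have hu0 : iteratedDeriv n u 0 = 0 := by
        have h1 := hv1.mul hlog
        rw [mul_zero] at h1
        have h2 := tendsto_nhds_unique (hu1.congr' ?_) h1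
        · simpa [hfac] using h2
        · have hlt : ∀ᶠ t : ℝ in 𝓝[>] 0, t < 1 :=
            nhdsWithin_le_nhds (Iio_mem_nhds one_pos)
          filter_upwards [h, self_mem_nhdsWithin, hlt] with t ht h0 h1
          have hl : Real.log t ≠ 0 := (Real.log_neg h0 h1).ne
          rw [← ht]
          field_simp
      refine ⟨hu0, ?_⟩
      have hu2 : u =O[𝓝[>] 0] fun t : ℝ => t ^ (n + 1) := by
        refine isBigO_pow_of_iteratedDeriv_eq_zero hu fun i hi => ?_
        rcases Nat.lt_succ_iff_lt_or_eq.1 hi with hi | rfl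
        · exact (ih i hi).1
        · exact hu0
      -- The extra order just gained for `u` absorbs the logarithm: `v = u log t = O(t ^ n · t log
      -- t)` and `t log t → 0`.
      have hv2 : v =o[𝓝[>] 0] fun t : ℝ => t ^ n := by
        have h1 : (fun t : ℝ => t * Real.log t) =o[𝓝[>] 0] fun _ => (1 : ℝ) := by
          rw [isLittleO_one_iff]
          have := tendsto_log_mul_rpow_nhdsGT_zero (r := 1) one_pos
          refine this.congr fun t => ?_
          rw [Real.rpow_one, mul_comm]
        have h2 : (fun t : ℝ => t ^ n * (t * Real.log t)) =o[𝓝[>] 0] fun t => t ^ n * (1 : ℝ) :=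
          (isBigO_refl _ _).mul_isLittleO h1
        have h3 : (fun t => u t * Real.log t) =O[𝓝[>] 0]
            fun t : ℝ => t ^ (n + 1) * Real.log t := hu2.mul (isBigO_refl _ _)
        refine IsBigO.trans_isLittleO (g := fun t : ℝ => t ^ n * (t * Real.log t)) ?_
          (h2.congr_right fun t => mul_one _)
        refine (h3.congr' h ?_)
        filter_upwards with t
        ring
      have h2 := tendsto_nhds_unique hv1 hv2.tendsto_div_nhds_zero
      simpa [hfac] using h2
  exact ⟨fun n => isBigO_pow_of_iteratedDeriv_eq_zero hu fun i _ => (key i).1,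
    fun n => isBigO_pow_of_iteratedDeriv_eq_zero hv fun i _ => (key i).2⟩

namespace RightFlat

variable {E : Type*} [NormedAddCommGroup E]

theorem add {f g : ℝ → E} (hf : RightFlat f) (hg : RightFlat g) :
    RightFlat fun t => f t + g t := fun n => (hf n).add (hg n)

theorem sub {f g : ℝ → E} (hf : RightFlat f) (hg : RightFlat g) :
    RightFlat fun t => f t - g t := fun n => (hf n).sub (hg n)

theorem congr' {f g : ℝ → E} (hf : RightFlat f) (h : f =ᶠ[𝓝[>] 0] g) : RightFlat g :=
  fun n => (hf n).congr' h (EventuallyEq.refl _ _)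

theorem trans_isBigO {F : Type*} [NormedAddCommGroup F] {f : ℝ → E} {g : ℝ → F}
    (hf : RightFlat f) (h : g =O[𝓝[>] 0] f) : RightFlat g := fun n => h.trans (hf n)

theorem mul_continuous {f g : ℝ → ℝ} (hf : RightFlat f) (hg : ContinuousAt g 0) :
    RightFlat fun t => f t * g t := fun n => by
  have h : g =O[𝓝[>] 0] fun _ => (1 : ℝ) :=
    (hg.tendsto.mono_left nhdsWithin_le_nhds).isBigO_one ℝ
  simpa using (hf n).mul h

theorem const_mul {f : ℝ → ℝ} (hf : RightFlat f) (c : ℝ) : RightFlat fun t => c * f t :=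
  fun n => (hf n).const_mul_left c

theorem tendsto {f : ℝ → E} (hf : RightFlat f) : Tendsto f (𝓝[>] 0) (𝓝 0) := by
  have h := ((hf 1).congr_right fun t => pow_one t).trans_tendsto tendsto_id_nhdsGT
  exact h

theorem div_id {f : ℝ → ℝ} (hf : RightFlat f) : RightFlat fun t => f t / t := fun n => by
  have h := (hf (n + 1)).mul (isBigO_refl (fun t : ℝ => t⁻¹) (𝓝[>] 0))
  refine h.congr' ?_ ?_
  · filter_upwards with t
    rw [div_eq_mul_inv]
  · filter_upwards [self_mem_nhdsWithin] with t ht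
    have : t ≠ 0 := ne_of_gt ht
    field_simp
    ring

/-- Mean value theorem: `f t = f' ξ · t` with `0 < ξ < t`, and `ξ ^ n ≤ t ^ n` transfers the bound.
-/
theorem of_deriv {f f' : ℝ → ℝ} (hf : ∀ t, HasDerivAt f (f' t) t) (h : RightFlat f')
    (h0 : f 0 = 0) : RightFlat f := by
  intro n
  obtain ⟨C, hC⟩ := (h n).bound
  obtain ⟨δ, hδ, hball⟩ := mem_nhdsGT_iff_exists_Ioo_subset.1 hC
  rw [Set.mem_Ioi] at hδ
  refine IsBigO.of_bound C ?_
  have : ∀ᶠ t : ℝ in 𝓝[>] 0, t < min δ 1 :=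
    nhdsWithin_le_nhds (Iio_mem_nhds (lt_min hδ one_pos))
  filter_upwards [this, self_mem_nhdsWithin] with t ht ht0
  rw [Set.mem_Ioi] at ht0
  have ht1 := lt_of_lt_of_le ht (min_le_left _ _)
  have ht2 := lt_of_lt_of_le ht (min_le_right _ _)
  obtain ⟨ξ, hξ, he⟩ := exists_hasDerivAt_eq_slope f f' ht0
    (fun x _ => (hf x).continuousAt.continuousWithinAt) (fun x _ => hf x)
  have h1 : ‖f' ξ‖ ≤ C * ‖ξ ^ n‖ := hball ⟨hξ.1, hξ.2.trans ht1⟩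
  have h2 : f t = f' ξ * t := by
    rw [he, h0]; field_simp; ring
  have hC0 : 0 ≤ C := by
    have : 0 < ‖ξ ^ n‖ := norm_pos_iff.2 (pow_ne_zero _ hξ.1.ne')
    by_contra hneg
    have := mul_neg_of_neg_of_pos (not_le.1 hneg) this
    linarith [norm_nonneg (f' ξ)]
  rw [h2, norm_mul]
  have h3 : ‖ξ ^ n‖ ≤ ‖t ^ n‖ := by
    rw [norm_pow, norm_pow, Real.norm_of_nonneg hξ.1.le, Real.norm_of_nonneg ht0.le]
    exact pow_le_pow_left₀ hξ.1.le hξ.2.le n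
  calc ‖f' ξ‖ * ‖t‖ ≤ ‖f' ξ‖ * 1 := by
        gcongr
        rw [Real.norm_of_nonneg ht0.le]; exact ht2.le
    _ ≤ C * ‖t ^ n‖ := by
        rw [mul_one]; exact h1.trans (by gcongr)

end RightFlat

/-- A function tending to a limit and taking integer values is eventually equal to its limit. -/
theorem eventually_eq_of_tendsto_of_int {α : Type*} {l : Filter α} [NeBot l] {f : α → ℝ} {c : ℝ}
    (hf : Tendsto f l (𝓝 c)) (hi : ∀ᶠ x in l, ∃ k : ℤ, f x = k) :
    (∀ᶠ x in l, f x = c) ∧ ∃ k : ℤ, c = k := by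
  have hc : c ∈ Set.range ((↑) : ℤ → ℝ) := by
    refine Int.isClosedEmbedding_coe_real.isClosed_range.mem_of_tendsto hf ?_
    filter_upwards [hi] with x ⟨k, hk⟩
    exact ⟨k, hk.symm⟩
  obtain ⟨k, rfl⟩ := hc
  refine ⟨?_, k, rfl⟩
  filter_upwards [hi, hf (Metric.ball_mem_nhds _ one_pos)] with x ⟨j, hj⟩ hx
  have hx' : dist (f x) k < 1 := hx
  rw [hj, Int.dist_cast_real, Int.dist_eq] at hx'
  have : |j - k| < 1 := by exact_mod_cast hx'
  rw [hj, sub_eq_zero.1 (Int.abs_lt_one_iff.1 this)]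

/-- A smooth function near a point agrees there with a globally smooth function. -/
theorem exists_contDiff_eventuallyEq {E F : Type*} [NormedAddCommGroup E] [NormedSpace ℝ E]
    [FiniteDimensional ℝ E] [NormedAddCommGroup F] [NormedSpace ℝ F] {f : E → F} {U : Set E}
    {x : E} (hU : U ∈ 𝓝 x) (hf : ContDiffOn ℝ ∞ f U) :
    ∃ g : E → F, ContDiff ℝ ∞ g ∧ g =ᶠ[𝓝 x] f := by
  obtain ⟨V, hVU, hVo, hxV⟩ := mem_nhds_iff.1 hU
  obtain ⟨δ, hδ, hball⟩ := Metric.isOpen_iff.1 hVo x hxV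
  -- Since the outer radius is `δ / 2 < δ`, the ball of radius `δ` and the complement of the closed
  -- `δ / 2`-ball form an open cover, and smoothness is checked on each.
  let b : ContDiffBump x := ⟨δ / 4, δ / 2, by positivity, by linarith⟩
  refine ⟨fun y => b y • f y, contDiff_iff_contDiffAt.2 fun y => ?_, ?_⟩
  · by_cases hy : y ∈ Metric.ball x δ
    · exact b.contDiff.contDiffAt.smul
        ((hf.mono hVU).contDiffAt (hVo.mem_nhds (hball hy)))
    · have hy' : y ∈ (Metric.closedBall x (δ / 2))ᶜ := by
        simp only [Metric.mem_ball, not_lt, Set.mem_compl_iff, Metric.mem_closedBall, not_le] at hy ⊢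
        linarith
      have : (fun y => b y • f y) =ᶠ[𝓝 y] fun _ => 0 := by
        filter_upwards [Metric.isClosed_closedBall.isOpen_compl.mem_nhds hy'] with z hz
        have : b z = 0 := b.zero_of_le_dist (by
          simp only [Set.mem_compl_iff, Metric.mem_closedBall, not_le] at hz
          exact hz.le)
        simp [this]
      exact contDiffAt_const.congr_of_eventuallyEq this
  · filter_upwards [b.eventuallyEq_one] with y hy
    simp [hy]

/-! ### Hadamard's lemma -/

section Hadamard

variable {E : Type*} [NormedAddCommGroup E] [NormedSpace ℝ E]

/-- Differentiation under the integral. The weight `s ^ j` is included so that the derivative has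
the same shape, with `j + 1` and `deriv g`, and the next lemma can iterate. -/
theorem hasDerivAt_integral_pow_smul {g : ℝ → E} (hg : ContDiff ℝ ∞ g) (j : ℕ) (t : ℝ) :
    HasDerivAt (fun t => ∫ s in (0 : ℝ)..1, s ^ j • g (s * t))
      (∫ s in (0 : ℝ)..1, s ^ (j + 1) • deriv g (s * t)) t := by
  have hg' : Continuous (deriv g) := hg.continuous_deriv (by simp)
  have hgc : Continuous g := hg.continuous
  obtain ⟨C, hC⟩ := (isCompact_Icc (a := -(|t| + 1)) (b := |t| + 1)).exists_bound_of_continuousOn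
    hg'.continuousOn
  refine (intervalIntegral.hasDerivAt_integral_of_dominated_loc_of_deriv_le
    (F := fun t s => s ^ j • g (s * t)) (F' := fun t s => s ^ (j + 1) • deriv g (s * t))
    (bound := fun _ => C) (Metric.ball_mem_nhds t one_pos) ?_ ?_ ?_ ?_ ?_ ?_).2
  · filter_upwards with x
    exact Continuous.aestronglyMeasurable (by fun_prop)
  · exact Continuous.intervalIntegrable (by fun_prop) _ _
  · exact Continuous.aestronglyMeasurable (by fun_prop)
  · filter_upwards with s hs x hx
    rw [Set.uIoc_of_le zero_le_one] at hs
    have hx' : |x| < |t| + 1 := by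
      have : |x - t| < 1 := hx
      have := abs_sub_abs_le_abs_sub x t
      linarith
    have hsx : |s * x| ≤ |t| + 1 := by
      rw [abs_mul, abs_of_pos hs.1]
      nlinarith [abs_nonneg x, hs.1, hs.2]
    have h1 := hC (s * x) (abs_le.1 hsx)
    rw [norm_smul, norm_pow, Real.norm_of_nonneg hs.1.le]
    have h2 : s ^ (j + 1) ≤ 1 := pow_le_one₀ hs.1.le hs.2
    have h3 : 0 ≤ s ^ (j + 1) := pow_nonneg hs.1.le _
    nlinarith [norm_nonneg (deriv g (s * x))]
  · exact intervalIntegrable_const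
  · filter_upwards with s hs x hx
    have h1 : HasDerivAt g (deriv g (s * x)) (s * x) :=
      (hg.differentiable (by simp) _).hasDerivAt
    have h2 : HasDerivAt (fun x : ℝ => s * x) s x := by
      simpa using (hasDerivAt_id x).const_mul s
    have h3 := (h1.scomp x h2).const_smul (s ^ j)
    rw [smul_smul, ← pow_succ] at h3
    exact h3

theorem contDiff_integral_pow_smul {g : ℝ → E} (hg : ContDiff ℝ ∞ g) (j : ℕ) :
    ContDiff ℝ ∞ fun t => ∫ s in (0 : ℝ)..1, s ^ j • g (s * t) := by
  rw [contDiff_infty]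
  intro n
  induction n generalizing g j with
  | zero =>
    exact contDiff_zero.2 (continuous_iff_continuousAt.2 fun t =>
      (hasDerivAt_integral_pow_smul hg j t).continuousAt)
  | succ n ih =>
    rw [Nat.cast_add, Nat.cast_one, contDiff_succ_iff_deriv]
    refine ⟨fun t => (hasDerivAt_integral_pow_smul hg j t).differentiableAt, by simp, ?_⟩
    have : deriv (fun t => ∫ s in (0 : ℝ)..1, s ^ j • g (s * t)) =
        fun t => ∫ s in (0 : ℝ)..1, s ^ (j + 1) • deriv g (s * t) :=
      funext fun t => (hasDerivAt_integral_pow_smul hg j t).deriv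
    rw [this]
    exact ih ((contDiff_infty_iff_deriv.1 hg).2) (j + 1)

/-- **Hadamard's lemma** in one variable. -/
theorem exists_contDiff_eq_smul [CompleteSpace E] {f : ℝ → E} (hf : ContDiff ℝ ∞ f) (h0 : f 0 = 0) :
    ∃ k : ℝ → E, ContDiff ℝ ∞ k ∧ (∀ t, f t = t • k t) ∧ k 0 = deriv f 0 := by
  -- The quotient is the mean of `deriv f` over `[0, t]`; the trivial factor `s ^ 0` matches the
  -- shape of `contDiff_integral_pow_smul`.
  refine ⟨fun t => ∫ s in (0 : ℝ)..1, s ^ 0 • deriv f (s * t),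
    contDiff_integral_pow_smul ((contDiff_infty_iff_deriv.1 hf).2) 0, fun t => ?_, by simp⟩
  have hc : Continuous (deriv f) := hf.continuous_deriv (by simp)
  have h1 : ∀ s ∈ Set.uIcc (0 : ℝ) 1, HasDerivAt (fun s => f (s * t)) (t • deriv f (s * t)) s := by
    intro s _
    have h1 : HasDerivAt f (deriv f (s * t)) (s * t) :=
      (hf.differentiable (by simp) _).hasDerivAt
    have h2 : HasDerivAt (fun s : ℝ => s * t) t s := by
      simpa using (hasDerivAt_id s).mul_const t
    exact h1.scomp s h2
  have h2 := intervalIntegral.integral_eq_sub_of_hasDerivAt h1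
    (Continuous.intervalIntegrable (by fun_prop) _ _)
  simp only [one_mul, zero_mul, h0, sub_zero] at h2
  rw [← h2, intervalIntegral.integral_smul]
  simp

end Hadamard

/-! ### Taylor series of functions of two variables -/

/-- The space of smooth functions on the plane. -/
def smoothFunctions : Submodule ℝ (ℝ × ℝ → ℝ) where
  carrier := {f | ContDiff ℝ ∞ f}
  add_mem' hf hg := (Set.mem_ofPred.1 hf).add (Set.mem_ofPred.1 hg)
  zero_mem' := Set.mem_ofPred.2 contDiff_const
  smul_mem' _ _ hf := Set.mem_ofPred.2 (contDiff_const.smul (Set.mem_ofPred.1 hf))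

theorem mem_smoothFunctions {f : ℝ × ℝ → ℝ} : f ∈ smoothFunctions ↔ ContDiff ℝ ∞ f :=
  Set.mem_ofPred

theorem contDiff_coe (f : smoothFunctions) : ContDiff ℝ ∞ (f : ℝ × ℝ → ℝ) :=
  mem_smoothFunctions.1 f.2

theorem differentiable_coe (f : smoothFunctions) : Differentiable ℝ (f : ℝ × ℝ → ℝ) :=
  (contDiff_coe f).differentiable (by simp)

/-- The derivative in the direction `v`, as an operator on smooth functions. -/
def dirDeriv (v : ℝ × ℝ) : Module.End ℝ smoothFunctions where
  toFun f := ⟨fun x => fderiv ℝ f x v, mem_smoothFunctions.2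
    (((contDiff_infty_iff_fderiv.1 (contDiff_coe f)).2).clm_apply contDiff_const)⟩
  map_add' f g := by
    ext x
    have := fderiv_add (differentiable_coe f x) (differentiable_coe g x)
    simp [this]
  map_smul' c f := by
    ext x
    have := fderiv_const_smul (differentiable_coe f x) c
    simp [this]

theorem dirDeriv_apply (v : ℝ × ℝ) (f : smoothFunctions) (x : ℝ × ℝ) :
    (dirDeriv v f : ℝ × ℝ → ℝ) x = fderiv ℝ f x v := rfl

/-- The derivative along the ray of slope `s`, written as a sum of commuting operators so that its
powers expand by the binomial theorem. -/
theorem dirDeriv_add_smul (u v : ℝ × ℝ) (s : ℝ) :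
    dirDeriv (u + s • v) = s • dirDeriv v + dirDeriv u := by
  ext f x
  simp [dirDeriv_apply, add_comm]

theorem dirDeriv_commute (u v : ℝ × ℝ) : Commute (dirDeriv u) (dirDeriv v) := by
  ext f x
  have h : ∀ u v : ℝ × ℝ, (dirDeriv u (dirDeriv v f) : ℝ × ℝ → ℝ) x =
      fderiv ℝ (fderiv ℝ f) x u v := by
    intro u v
    have hd : DifferentiableAt ℝ (fderiv ℝ f.1) x :=
      ((contDiff_infty_iff_fderiv.1 (contDiff_coe f)).2).differentiable (by simp) x
    have := (hd.hasFDerivAt.clm_apply (hasFDerivAt_const v x)).fderiv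
    change fderiv ℝ (fun y => fderiv ℝ f.1 y v) x u = _
    rw [this]
    simp
  have hs : IsSymmSndFDerivAt ℝ (f : ℝ × ℝ → ℝ) x :=
    ((contDiff_coe f).contDiffAt).isSymmSndFDerivAt
      (by simpa using WithTop.coe_le_coe.2 (le_top : (2 : ℕ∞) ≤ ⊤))
  change (dirDeriv u (dirDeriv v f) : ℝ × ℝ → ℝ) x = (dirDeriv v (dirDeriv u f) : ℝ × ℝ → ℝ) x
  rw [h, h]
  exact hs u v

/-- Turns the multilinear derivative in the definition of `taylor` into an operator product. The
induction peels off slot `0`, which holds `u` unless `p = 0`; quantifying over `x` is needed because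
the remaining slots are differentiated in the base point. -/
theorem iteratedFDeriv_eq_dirDeriv_pow (u v : ℝ × ℝ) (f : smoothFunctions) (N : ℕ) :
    ∀ p ≤ N, ∀ x, iteratedFDeriv ℝ N (f : ℝ × ℝ → ℝ) x (fun k => if (k : ℕ) < p then u else v) =
      (((dirDeriv u) ^ p * (dirDeriv v) ^ (N - p)) f : smoothFunctions).1 x := by
  induction N with
  | zero =>
    intro p hp x
    obtain rfl := Nat.le_zero.1 hp
    simp
  | succ N ih =>
    have step : ∀ (x : ℝ × ℝ) (m : Fin (N + 1) → ℝ × ℝ) (g : smoothFunctions),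
        (∀ y, iteratedFDeriv ℝ N (f : ℝ × ℝ → ℝ) y (Fin.tail m) = g.1 y) →
        iteratedFDeriv ℝ (N + 1) (f : ℝ × ℝ → ℝ) x m = (dirDeriv (m 0) g).1 x := by
      intro x m g hg
      rw [iteratedFDeriv_succ_apply_left]
      have hd : DifferentiableAt ℝ (iteratedFDeriv ℝ N (f : ℝ × ℝ → ℝ)) x :=
        (contDiff_coe f).differentiable_iteratedFDeriv (by exact_mod_cast WithTop.coe_lt_top _) x
      have h1 := ((ContinuousMultilinearMap.apply ℝ (fun _ : Fin N => ℝ × ℝ) ℝ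
        (Fin.tail m)).hasFDerivAt.comp x hd.hasFDerivAt).fderiv
      have h2 : (fun y => (iteratedFDeriv ℝ N (f : ℝ × ℝ → ℝ) y) (Fin.tail m)) = g.1 := funext hg
      change _ = fderiv ℝ g.1 x (m 0)
      rw [← h2]
      change fderiv ℝ (fun y => (iteratedFDeriv ℝ N (f : ℝ × ℝ → ℝ) y) (Fin.tail m)) x = _ at h1
      rw [h1]
      rfl
    intro p hp x
    rcases p with _ | p
    · rw [step x _ _ (fun y => ?_), pow_zero, one_mul, Nat.sub_zero, pow_succ']
      rotate_left
      · exact (((dirDeriv u) ^ 0 * (dirDeriv v) ^ (N - 0)) f)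
      · exact ih 0 (Nat.zero_le _) y
      · simp
    · rw [step x _ _ (fun y => ?_), pow_succ', Nat.add_sub_add_right]
      rotate_left
      · exact (((dirDeriv u) ^ p * (dirDeriv v) ^ (N - p)) f)
      · rw [← ih p (Nat.le_of_succ_le_succ hp) y]
        congr 1
        funext k
        simp [Fin.tail]
      · simp

/-- The mixed partial derivatives at the origin. -/
def mixedDeriv (p r : ℕ) : smoothFunctions →ₗ[ℝ] ℝ where
  toFun f := (((dirDeriv (1, 0)) ^ p * (dirDeriv (0, 1)) ^ r) f).1 0
  map_add' f g := by simp
  map_smul' c f := by simp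

theorem mixedDeriv_apply (p r : ℕ) (f : smoothFunctions) :
    mixedDeriv p r f = (((dirDeriv (1, 0)) ^ p * (dirDeriv (0, 1)) ^ r) f).1 0 := rfl

theorem coeff_taylor (f : smoothFunctions) (n : Fin 2 →₀ ℕ) :
    MvPowerSeries.coeff n (taylor f) =
      mixedDeriv (n 0) (n 1) f / ((n 0).factorial * (n 1).factorial) := by
  have h := iteratedFDeriv_eq_dirDeriv_pow (1, 0) (0, 1) f (n 0 + n 1) (n 0)
    (Nat.le_add_right _ _) 0
  rw [Nat.add_sub_cancel_left] at h
  rw [mixedDeriv_apply, ← h]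
  rfl

theorem taylor_congr {f g : ℝ × ℝ → ℝ} (h : f =ᶠ[𝓝 0] g) : taylor f = taylor g := by
  funext n
  simp only [taylor, (h.iteratedFDeriv ℝ _).eq_of_nhds]

theorem iteratedDeriv_comp_line (f : smoothFunctions) (v : ℝ × ℝ) (n : ℕ) :
    iteratedDeriv n (fun t : ℝ => f.1 (t • v)) = fun t => ((dirDeriv v ^ n) f).1 (t • v) := by
  induction n with
  | zero => simp
  | succ n ih =>
    rw [iteratedDeriv_succ, ih, pow_succ']
    funext t
    have h1 : HasDerivAt (fun t : ℝ => t • v) v t := by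
      simpa using (hasDerivAt_id t).smul_const v
    exact ((differentiable_coe ((dirDeriv v ^ n) f) (t • v)).hasFDerivAt.comp_hasDerivAt t h1).deriv

/-- A smooth function which is flat along almost all rays `t (1, s)` has zero Taylor series. -/
theorem mixedDeriv_eq_zero_of_rightFlat (f : smoothFunctions)
    (h : ∀ᶠ s : ℝ in cofinite, RightFlat fun t : ℝ => f.1 (t, t * s)) (p r : ℕ) :
    mixedDeriv p r f = 0 := by
  set n := p + r with hn
  -- By the binomial theorem, the `n`-th derivative at `0` along `(1, s)` is the value of this
  -- polynomial at `s`. Flatness makes almost every `s` a root, so all coefficients vanish.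
  let P : Polynomial ℝ := ∑ m ∈ Finset.range (n + 1),
    Polynomial.monomial m (mixedDeriv (n - m) m f * n.choose m)
  have hP : P = 0 := by
    refine Polynomial.eq_zero_of_infinite_isRoot P ?_
    have hinf : {s : ℝ | RightFlat fun t : ℝ => f.1 (t, t * s)}.Infinite := fun hfin =>
      Set.infinite_univ ((hfin.union h).subset fun s _ => by
        by_cases hs : RightFlat fun t : ℝ => f.1 (t, t * s)
        · exact Or.inl hs
        · exact Or.inr hs)
    refine hinf.mono fun s hs => ?_
    have hline : ∀ t : ℝ, (t, t * s) = t • (((1, 0) : ℝ × ℝ) + s • ((0, 1) : ℝ × ℝ)) := by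
      intro t; simp
    simp only [Set.mem_ofPred_eq, hline] at hs
    have hsm : ContDiff ℝ ∞ fun t : ℝ => f.1 (t • (((1, 0) : ℝ × ℝ) + s • ((0, 1) : ℝ × ℝ))) :=
      (contDiff_coe f).comp (contDiff_id.smul contDiff_const)
    have h0 := hs.iteratedDeriv_eq_zero hsm n
    rw [iteratedDeriv_comp_line] at h0
    beta_reduce at h0
    rw [zero_smul, dirDeriv_add_smul,
      (Commute.smul_left (dirDeriv_commute _ _) s).add_pow] at h0
    refine Set.mem_ofPred.2 ?_
    rw [Polynomial.IsRoot.def]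
    rw [Polynomial.eval_finsetSum, ← h0]
    have hcomm : ∀ a b : ℕ, dirDeriv (0, 1) ^ a * dirDeriv (1, 0) ^ b =
        dirDeriv (1, 0) ^ b * dirDeriv (0, 1) ^ a :=
      fun a b => ((dirDeriv_commute _ _).pow_pow a b).eq
    simp only [LinearMap.sum_apply, Submodule.coe_sum, Finset.sum_apply, smul_pow,
      smul_mul_assoc, hcomm]
    refine Finset.sum_congr rfl fun m _ => ?_
    rw [Polynomial.eval_monomial, mixedDeriv_apply]
    have : ((n.choose m : ℕ) : Module.End ℝ smoothFunctions) = (n.choose m : ℝ) • 1 := by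
      rw [Nat.cast_smul_eq_nsmul, nsmul_one]
    rw [this]
    simp only [LinearMap.smul_apply, Module.End.mul_apply, Module.End.one_apply, map_smul,
      SetLike.val_smul, Pi.smul_apply, smul_eq_mul]
    ring
  have hc : P.coeff r = mixedDeriv (n - r) r f * n.choose r := by
    simp only [P, Polynomial.finsetSum_coeff, Polynomial.coeff_monomial]
    rw [Finset.sum_ite_eq' (Finset.range (n + 1)) r, if_pos (Finset.mem_range.2 (by omega))]
  rw [hP, Polynomial.coeff_zero] at hc
  have hch : (n.choose r : ℝ) ≠ 0 := by
    exact_mod_cast (Nat.choose_pos (by omega : r ≤ n)).ne'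
  have := (mul_eq_zero.1 hc.symm).resolve_right hch
  rwa [show n - r = p by omega] at this

/-- The operator `f ↦ f(κ a, ν b)`. -/
def rescaleFun (κ ν : ℝ) : Module.End ℝ smoothFunctions where
  toFun f := ⟨fun x => f.1 (κ * x.1, ν * x.2), mem_smoothFunctions.2 ((contDiff_coe f).comp
    ((contDiff_const.mul contDiff_fst).prodMk (contDiff_const.mul contDiff_snd)))⟩
  map_add' _ _ := rfl
  map_smul' _ _ := rfl

theorem dirDeriv_rescaleFun (κ ν : ℝ) (v : ℝ × ℝ) (f : smoothFunctions) :
    dirDeriv v (rescaleFun κ ν f) = rescaleFun κ ν (dirDeriv (κ * v.1, ν * v.2) f) := by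
  ext x
  have h1 : HasFDerivAt (fun x : ℝ × ℝ => (κ * x.1, ν * x.2))
      ((κ • ContinuousLinearMap.fst ℝ ℝ ℝ).prod (ν • ContinuousLinearMap.snd ℝ ℝ ℝ)) x :=
    (hasFDerivAt_fst.const_mul κ).prodMk (hasFDerivAt_snd.const_mul ν)
  have h2 := ((differentiable_coe f (κ * x.1, ν * x.2)).hasFDerivAt.comp x h1).fderiv
  change fderiv ℝ (f.1 ∘ fun x : ℝ × ℝ => (κ * x.1, ν * x.2)) x v =
    fderiv ℝ f.1 (κ * x.1, ν * x.2) (κ * v.1, ν * v.2)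
  rw [h2]
  simp

/-- The hypothesis says that `v` is an eigenvector of `diag(κ, ν)`; each derivative along `v`
produces one factor of the eigenvalue. -/
theorem dirDeriv_pow_rescaleFun {κ ν c : ℝ} {v : ℝ × ℝ} (hv : (κ * v.1, ν * v.2) = c • v)
    (f : smoothFunctions) (n : ℕ) :
    (dirDeriv v ^ n) (rescaleFun κ ν f) = c ^ n • rescaleFun κ ν ((dirDeriv v ^ n) f) := by
  have hsmul : ∀ g, dirDeriv (c • v) g = c • dirDeriv v g := fun g => by
    ext x; simp [dirDeriv_apply]
  induction n with
  | zero => simp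
  | succ n ih =>
    rw [pow_succ', Module.End.mul_apply, ih, map_smul, dirDeriv_rescaleFun, hv, hsmul, map_smul,
      smul_smul, Module.End.mul_apply, pow_succ]

theorem mixedDeriv_rescaleFun (κ ν : ℝ) (f : smoothFunctions) (p r : ℕ) :
    mixedDeriv p r (rescaleFun κ ν f) = κ ^ p * ν ^ r * mixedDeriv p r f := by
  rw [mixedDeriv_apply, mixedDeriv_apply, Module.End.mul_apply,
    dirDeriv_pow_rescaleFun (c := ν) (by simp), map_smul,
    dirDeriv_pow_rescaleFun (c := κ) (by simp)]
  simp [rescaleFun, Prod.mk_zero_zero]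
  ring

/-- The constant function, as a smooth function. -/
def constFun (d : ℝ) : smoothFunctions := ⟨fun _ => d, mem_smoothFunctions.2 contDiff_const⟩

/-- The first coordinate, as a smooth function. -/
def fstFun : smoothFunctions := ⟨Prod.fst, mem_smoothFunctions.2 contDiff_fst⟩

theorem dirDeriv_constFun (v : ℝ × ℝ) (d : ℝ) : dirDeriv v (constFun d) = 0 := by
  ext x; simp [dirDeriv_apply, constFun]

theorem dirDeriv_fstFun (v : ℝ × ℝ) : dirDeriv v fstFun = constFun v.1 := by
  ext x; simp [dirDeriv_apply, fstFun, constFun, fderiv_fst]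

theorem mixedDeriv_constFun (d : ℝ) (p r : ℕ) :
    mixedDeriv p r (constFun d) = if p = 0 ∧ r = 0 then d else 0 := by
  rw [mixedDeriv_apply, Module.End.mul_apply]
  rcases r with _ | r
  · rcases p with _ | p
    · simp [constFun]
    · simp [pow_succ, dirDeriv_constFun]
  · simp [pow_succ, dirDeriv_constFun]

theorem mixedDeriv_fstFun (p r : ℕ) :
    mixedDeriv p r fstFun = if p = 1 ∧ r = 0 then 1 else 0 := by
  have h0 : constFun 0 = 0 := rfl
  rw [mixedDeriv_apply, Module.End.mul_apply]
  rcases r with _ | r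
  · rcases p with _ | _ | p
    · simp [fstFun]
    · simp [dirDeriv_fstFun, constFun]
    · simp [pow_succ, dirDeriv_constFun, dirDeriv_fstFun]
  · simp [pow_succ, dirDeriv_fstFun, h0]

/-- The flat expression is the restriction to rays of one smooth function of two variables, so all
its mixed derivatives vanish; dividing by factorials compares coefficients. -/
theorem rescale_taylor_eq {f f' : ℝ × ℝ → ℝ} (hf : ContDiff ℝ ∞ f) (hf' : ContDiff ℝ ∞ f')
    {κ ν c d : ℝ} (h : ∀ᶠ s : ℝ in cofinite,
      RightFlat fun t : ℝ => f' (κ * t, ν * (t * s)) - ν * f (t, t * s) - c * t - d) :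
    MvPowerSeries.rescale ![κ, ν] (taylor f') =
      ν • taylor f + c • MvPowerSeries.X 0 + MvPowerSeries.C d := by
  let φ : smoothFunctions := ⟨f, mem_smoothFunctions.2 hf⟩
  let φ' : smoothFunctions := ⟨f', mem_smoothFunctions.2 hf'⟩
  ext n
  have key := mixedDeriv_eq_zero_of_rightFlat
    (rescaleFun κ ν φ' - ν • φ - c • fstFun - constFun d) h (n 0) (n 1)
  rw [map_sub, map_sub, map_sub, map_smul, map_smul, mixedDeriv_rescaleFun, mixedDeriv_fstFun,
    mixedDeriv_constFun] at key
  have h1 := coeff_taylor φ n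
  have h2 := coeff_taylor φ' n
  change MvPowerSeries.coeff n (taylor f) = _ at h1
  change MvPowerSeries.coeff n (taylor f') = _ at h2
  have hfac : ((n 0).factorial * (n 1).factorial : ℝ) ≠ 0 := by positivity
  have hX : MvPowerSeries.coeff n (MvPowerSeries.X 0 : MvPowerSeries (Fin 2) ℝ) =
      if n 0 = 1 ∧ n 1 = 0 then 1 else 0 := by
    rw [MvPowerSeries.coeff_X]
    congr 1
    simp [Finsupp.ext_iff, Fin.forall_fin_two]
  have hC : MvPowerSeries.coeff n (MvPowerSeries.C d : MvPowerSeries (Fin 2) ℝ) =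
      if n 0 = 0 ∧ n 1 = 0 then d else 0 := by
    rw [MvPowerSeries.coeff_C]
    congr 1
    simp [Finsupp.ext_iff, Fin.forall_fin_two]
  rw [MvPowerSeries.coeff_rescale, map_add, map_add, map_smul, map_smul, h1, h2, hX, hC]
  have hprod : (n.prod fun s m => (![κ, ν] : Fin 2 → ℝ) s ^ m) = κ ^ n 0 * ν ^ n 1 := by
    rw [Finsupp.prod_fintype _ _ (by simp)]
    simp
  rw [hprod]
  simp only [smul_eq_mul] at key ⊢
  rw [sub_sub, sub_sub, sub_eq_zero] at key
  rw [mul_div_assoc', key, div_eq_iff hfac]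
  -- The factorials equal `1` at the only exponent where the indicator is nonzero.
  have e1 : (if n 0 = 1 ∧ n 1 = 0 then (1 : ℝ) else 0) * ((n 0).factorial * (n 1).factorial) =
      if n 0 = 1 ∧ n 1 = 0 then 1 else 0 := by
    split_ifs with h
    · simp [h]
    · simp
  have e2 : (if n 0 = 0 ∧ n 1 = 0 then d else 0) * ((n 0).factorial * (n 1).factorial) =
      if n 0 = 0 ∧ n 1 = 0 then d else 0 := by
    split_ifs with h
    · simp [h]
    · simp
  rw [add_mul, add_mul, e2, mul_assoc c, e1]
  field_simp
  ring

/-! ### Comparison of period lattices -/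

/-- A point of the lattice spanned by `(1, 0)` and `(s₁, s₂)`. -/
theorem mem_closure_one_zero {s₁ s₂ x y : ℝ} :
    (x, y) ∈ (AddSubgroup.closure {((1 : ℝ), (0 : ℝ)), (s₁, s₂)} : Set (ℝ × ℝ)) ↔
      ∃ m n : ℤ, x = m + n * s₁ ∧ y = n * s₂ := by
  rw [SetLike.mem_coe, AddSubgroup.mem_closure_pair]
  refine exists_congr fun m => exists_congr fun n => ?_
  simp only [Prod.smul_mk, Prod.mk_add_mk, Prod.mk.injEq, zsmul_eq_mul, mul_one, mul_zero,
    zero_add]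
  exact ⟨fun h => ⟨h.1.symm, h.2.symm⟩, fun h => ⟨h.1.symm, h.2.symm⟩⟩

theorem intCast_eq_one_or_of_mul_eq_one {x : ℝ} {m n : ℤ} (hx : x = n) (h : x * m = 1) :
    x = 1 ∨ x = -1 := by
  subst hx
  have h' : n * m = 1 := by exact_mod_cast h
  rcases Int.eq_one_or_neg_one_of_mul_eq_one h' with h | h <;> simp [h]

theorem tendsto_log_add_atBot {T : ℝ → ℝ} (hT : ContinuousAt T 0) :
    Tendsto (fun t => Real.log t + T t) (𝓝[>] 0) atBot :=
  Real.tendsto_log_nhdsGT_zero.atBot_add (hT.tendsto.mono_left nhdsWithin_le_nhds)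

/-- The quotient is `1 + (V - T) / (log t + T)`, with bounded numerator and a denominator tending to
`-∞`. -/
theorem tendsto_log_add_div {T V : ℝ → ℝ} (hT : ContinuousAt T 0) (hV : ContinuousAt V 0) :
    Tendsto (fun t => (Real.log t + V t) / (Real.log t + T t)) (𝓝[>] 0) (𝓝 1) := by
  have h1 := tendsto_inv_atBot_zero.comp (tendsto_log_add_atBot hT)
  have h2 := ((hV.sub hT).tendsto.mono_left (nhdsWithin_le_nhds (s := Set.Ioi 0))).mul h1
  have h3 := h2.const_add 1
  rw [mul_zero, add_zero] at h3
  refine h3.congr' ?_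
  filter_upwards [(tendsto_log_add_atBot hT).eventually (eventually_lt_atBot 0)] with t ht
  have hne := ht.ne
  simp only [Pi.sub_apply, Function.comp_apply]
  field_simp
  ring

/-- A continuous function on an interval `(0, δ)` with integer values is constant near `0`. -/
theorem eventually_eq_const_of_int {f : ℝ → ℝ} (hf : ContinuousOn f (Set.Ioi 0))
    (hi : ∀ᶠ t in 𝓝[>] 0, ∃ m : ℤ, f t = m) : ∃ m : ℤ, ∀ᶠ t in 𝓝[>] 0, f t = m := by
  obtain ⟨δ, hδ, hball⟩ := mem_nhdsGT_iff_exists_Ioo_subset.1 hi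
  rw [Set.mem_Ioi] at hδ
  have hmid : δ / 2 ∈ Set.Ioo 0 δ := ⟨by linarith, by linarith⟩
  obtain ⟨m, hm⟩ := hball hmid
  refine ⟨m, ?_⟩
  filter_upwards [Ioo_mem_nhdsGT hδ] with t ht
  have hpre : IsPreconnected (f '' Set.Ioo 0 δ) :=
    isPreconnected_Ioo.image f (hf.mono fun x hx => hx.1)
  have hsub : f '' Set.Ioo 0 δ ⊆ Set.range ((↑) : ℤ → ℝ) := by
    rintro _ ⟨x, hx, rfl⟩
    obtain ⟨k, hk⟩ := hball hx
    exact ⟨k, hk.symm⟩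
  -- Countable sets of reals are totally disconnected, so the connected image is a single point.
  have hcount : (f '' Set.Ioo 0 δ).Countable := (Set.countable_range _).mono hsub
  have hss : (f '' Set.Ioo 0 δ).Subsingleton := 
    hcount.isTotallyDisconnected _ subset_rfl hpre
  rw [← hm]
  exact hss ⟨t, ht, rfl⟩ ⟨_, hmid, rfl⟩

/-- Comparison of the lattices spanned by `2π (1, 0)`, `(S, log t + T)` and by `2π (1, 0)`,
`(U, log t + V)` along a family of linear maps which is smooth at `t = 0`. -/
theorem lattice_comparison {a₁ b₁ a₂ b₂ S T U V : ℝ → ℝ}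
    (ha₁ : ContDiff ℝ ∞ a₁) (hb₁ : ContDiff ℝ ∞ b₁) (ha₂ : ContDiff ℝ ∞ a₂)
    (hb₂ : ContDiff ℝ ∞ b₂) (hS : ContDiff ℝ ∞ S) (hT : ContDiff ℝ ∞ T)
    (hU : ContDiff ℝ ∞ U) (hV : ContDiff ℝ ∞ V) (hdet : a₁ 0 * b₂ 0 - a₂ 0 * b₁ 0 ≠ 0)
    (hL : ∀ᶠ t in 𝓝[>] 0, ∀ x y : ℝ,
      (x * a₁ t + y * a₂ t, x * b₁ t + y * b₂ t) ∈ (AddSubgroup.closure {((1 : ℝ), (0 : ℝ)),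
        (S t / (2 * Real.pi), (Real.log t + T t) / (2 * Real.pi))} : Set (ℝ × ℝ)) ↔
      (x, y) ∈ (AddSubgroup.closure {((1 : ℝ), (0 : ℝ)),
        (U t / (2 * Real.pi), (Real.log t + V t) / (2 * Real.pi))} : Set (ℝ × ℝ))) :
    (a₁ 0 = 1 ∨ a₁ 0 = -1) ∧ (b₂ 0 = 1 ∨ b₂ 0 = -1) ∧
    (∀ᶠ t in 𝓝[>] 0, a₁ t = a₁ 0 ∧ b₁ t = 0) ∧
    RightFlat a₂ ∧ RightFlat (fun t => b₂ t - b₂ 0) ∧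
    RightFlat (fun t => b₂ 0 * T t - b₂ t * V t) ∧
    ∃ m : ℤ, RightFlat fun t => 2 * Real.pi * m + b₂ 0 * S t - a₁ 0 * U t - a₂ t * V t := by
  have hpi : (0 : ℝ) < 2 * Real.pi := by positivity
  have lim : ∀ {f : ℝ → ℝ}, ContDiff ℝ ∞ f → Tendsto f (𝓝[>] 0) (𝓝 (f 0)) := fun hf =>
    hf.continuous.continuousAt.tendsto.mono_left nhdsWithin_le_nhds
  have hTneg := (tendsto_log_add_atBot hT.continuous.continuousAt).eventually
    (eventually_lt_atBot 0)
  have hVneg := (tendsto_log_add_atBot hV.continuous.continuousAt).eventually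
    (eventually_lt_atBot 0)
  simp only [mem_closure_one_zero] at hL
  -- The generator `(1, 0)` of the second lattice is pulled back into the first.
  have hfst : ∀ᶠ t in 𝓝[>] 0, ∃ k l : ℤ, a₁ t = k + l * (S t / (2 * Real.pi)) ∧
      b₁ t = l * ((Real.log t + T t) / (2 * Real.pi)) := by
    filter_upwards [hL] with t ht
    have := (ht 1 0).2 ⟨1, 0, by simp, by simp⟩
    simpa using this
  -- The integer `l = 2π b₁ / (log t + T)` tends to `0` because `b₁` stays bounded, so it is
  -- eventually `0`.
  have hb₁0 : ∀ᶠ t in 𝓝[>] 0, b₁ t = 0 := by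
    have h1 : Tendsto (fun t => b₁ t * (2 * Real.pi) * (Real.log t + T t)⁻¹) (𝓝[>] 0) (𝓝 0) := by
      have := ((lim hb₁).mul_const (2 * Real.pi)).mul
        (tendsto_inv_atBot_zero.comp (tendsto_log_add_atBot hT.continuous.continuousAt))
      rw [mul_zero] at this
      exact this
    have h2 : ∀ᶠ t in 𝓝[>] 0, ∃ k : ℤ, b₁ t * (2 * Real.pi) * (Real.log t + T t)⁻¹ = k := by
      filter_upwards [hfst, hTneg] with t ⟨k, l, _, h⟩ hlog
      refine ⟨l, ?_⟩
      have hne := hlog.ne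
      rw [h]
      field_simp
    filter_upwards [(eventually_eq_of_tendsto_of_int h1 h2).1, hTneg] with t ht hlog
    have h3 : (Real.log t + T t)⁻¹ ≠ 0 := inv_ne_zero hlog.ne
    simpa [h3, Real.pi_ne_zero] using ht
  have hb₁z : b₁ 0 = 0 := tendsto_nhds_unique (lim hb₁)
    (tendsto_const_nhds.congr' (by filter_upwards [hb₁0] with t ht using ht.symm))
  rw [hb₁z, mul_zero, sub_zero] at hdet
  have ha₁i : ∀ᶠ t in 𝓝[>] 0, ∃ k : ℤ, a₁ t = k := by
    filter_upwards [hfst, hb₁0, hTneg] with t ⟨k, l, h1, h2⟩ h3 hlog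
    rw [h3] at h2
    have h4 : (l : ℝ) = 0 := by
      have : (Real.log t + T t) / (2 * Real.pi) ≠ 0 := div_ne_zero hlog.ne hpi.ne'
      simpa [this] using h2.symm
    exact ⟨k, by rw [h1, h4]; ring⟩
  obtain ⟨ha₁c, k₀, hk₀⟩ := eventually_eq_of_tendsto_of_int (lim ha₁) ha₁i
  -- The same for the second generator, with denominators `2π` cleared.
  have hsnd : ∀ᶠ t in 𝓝[>] 0, ∃ m n : ℤ,
      U t * a₁ 0 + (Real.log t + V t) * a₂ t = 2 * Real.pi * m + n * S t ∧
      (Real.log t + V t) * b₂ t = n * (Real.log t + T t) := by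
    filter_upwards [hL, hb₁0, ha₁c] with t ht h1 h2
    obtain ⟨m, n, h3, h4⟩ := (ht (U t / (2 * Real.pi)) ((Real.log t + V t) / (2 * Real.pi))).2
      ⟨0, 1, by simp, by simp⟩
    rw [h2] at h3
    rw [h1] at h4
    refine ⟨m, n, ?_, ?_⟩
    · field_simp at h3
      linarith
    · field_simp at h4
      linarith
  -- This quotient is the integer `n` of `hsnd`; its limit `b₂ 0` is therefore an integer, attained
  -- for small `t`.
  have hn1 : Tendsto (fun t => b₂ t * ((Real.log t + V t) / (Real.log t + T t))) (𝓝[>] 0)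
      (𝓝 (b₂ 0)) := by
    have := (lim hb₂).mul (tendsto_log_add_div hT.continuous.continuousAt
      hV.continuous.continuousAt)
    rwa [mul_one] at this
  have hn2 : ∀ᶠ t in 𝓝[>] 0, ∃ n : ℤ, b₂ t * ((Real.log t + V t) / (Real.log t + T t)) = n := by
    filter_upwards [hsnd, hTneg] with t ⟨m, n, _, h⟩ hlog
    refine ⟨n, ?_⟩
    rw [mul_div_assoc', mul_comm, h, mul_div_cancel_right₀ _ hlog.ne]
  obtain ⟨hnc, n₀, hn₀⟩ := eventually_eq_of_tendsto_of_int hn1 hn2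
  have hb₂e : ∀ᶠ t in 𝓝[>] 0, b₂ t * (Real.log t + V t) = b₂ 0 * (Real.log t + T t) := by
    filter_upwards [hnc, hTneg] with t ht hlog
    rwa [mul_div_assoc', div_eq_iff hlog.ne] at ht
  have hb₂t : ∀ᶠ t in 𝓝[>] 0, b₂ t ≠ 0 :=
    (lim hb₂).eventually_ne (right_ne_zero_of_mul hdet)
  -- The converse inclusion of lattices at a single small `t`: the generators of the first lattice
  -- must come from lattice vectors of the second, so the integers `a₁ 0` and `b₂ 0` are invertible.
  obtain ⟨hκ, hν⟩ : (a₁ 0 = 1 ∨ a₁ 0 = -1) ∧ (b₂ 0 = 1 ∨ b₂ 0 = -1) := by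
    obtain ⟨t, ht, h1, h2, h3, h4, h5, h6⟩ :=
      (hL.and (hb₁0.and (ha₁c.and (hb₂e.and (hTneg.and (hVneg.and hb₂t)))))).exists
    have hT0 := h4.ne
    have hV0 := h5.ne
    have ha0 : a₁ 0 ≠ 0 := left_ne_zero_of_mul hdet
    constructor
    · obtain ⟨m, n, h7, h8⟩ := (ht (1 / a₁ 0) 0).1 ⟨1, 0, by rw [h2]; field_simp; simp,
        by rw [h1]; simp⟩
      have h9 : (n : ℝ) = 0 := by
        have : (Real.log t + V t) / (2 * Real.pi) ≠ 0 := div_ne_zero hV0 hpi.ne'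
        simpa [this] using h8.symm
      rw [h9, zero_mul, add_zero] at h7
      refine intCast_eq_one_or_of_mul_eq_one (m := m) hk₀ ?_
      rw [← h7]
      field_simp
    -- The pair solves the triangular system (recall `b₁ t = 0`) whose right-hand side is the second
    -- generator of the first lattice.
    · obtain ⟨m, n, h7, h8⟩ := (ht
        ((S t / (2 * Real.pi) - (Real.log t + T t) / (2 * Real.pi) / b₂ t * a₂ t) / a₁ 0)
        ((Real.log t + T t) / (2 * Real.pi) / b₂ t)).1 ⟨0, 1, by rw [h2]; field_simp; ring,
        by rw [h1]; field_simp; simp⟩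
      refine intCast_eq_one_or_of_mul_eq_one (m := n) hn₀ ?_
      field_simp at h8
      have h9 : (Real.log t + T t) * (b₂ 0 * n) = (Real.log t + T t) * 1 := by
        rw [mul_one]
        calc _ = n * (b₂ 0 * (Real.log t + T t)) := by ring
          _ = b₂ t * (n * (Real.log t + V t)) := by rw [← h3]; ring
          _ = _ := by linarith
      exact mul_left_cancel₀ hT0 h9
  -- Rearranging `hb₂e` isolates the logarithm: `(b₂ - b₂ 0) log t = b₂ 0 T - b₂ V`.
  have hflatb := rightFlat_of_mul_log_eq (u := fun t => b₂ t - b₂ 0)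
    (v := fun t => b₂ 0 * T t - b₂ t * V t) (by fun_prop) (by fun_prop) (by
      filter_upwards [hb₂e] with t ht
      linarith)
  -- The multiple of `da` could a priori vary with `t`. Being continuous it is constant, so the
  -- right-hand side of the equation for `a₂ log t` is smooth at `0`.
  have hm : ∃ m : ℤ, ∀ᶠ t in 𝓝[>] 0,
      (U t * a₁ 0 + (Real.log t + V t) * a₂ t - b₂ 0 * S t) / (2 * Real.pi) = m := by
    refine eventually_eq_const_of_int ?_ ?_
    · have hlog : ContinuousOn Real.log (Set.Ioi 0) :=
        Real.continuousOn_log.mono fun x hx => ne_of_gt hx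
      have hUc := hU.continuous.continuousOn (s := Set.Ioi 0)
      have hVc := hV.continuous.continuousOn (s := Set.Ioi 0)
      have hSc := hS.continuous.continuousOn (s := Set.Ioi 0)
      have hac := ha₂.continuous.continuousOn (s := Set.Ioi 0)
      exact (((hUc.mul continuousOn_const).add ((hlog.add hVc).mul hac)).sub
        (continuousOn_const.mul hSc)).div_const _
    · filter_upwards [hsnd, hb₂e, hTneg] with t ⟨m, n, h1, h2⟩ h3 hlog
      refine ⟨m, ?_⟩
      have h4 : (n : ℝ) = b₂ 0 := mul_right_cancel₀ hlog.ne (by linarith)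
      rw [h1, h4]
      field_simp
      ring
  obtain ⟨m, hm⟩ := hm
  have hflata := rightFlat_of_mul_log_eq (u := a₂)
    (v := fun t => 2 * Real.pi * m + b₂ 0 * S t - a₁ 0 * U t - a₂ t * V t) ha₂ (by fun_prop) (by
      filter_upwards [hm] with t ht
      rw [div_eq_iff hpi.ne'] at ht
      linarith)
  refine ⟨hκ, hν, ?_, hflata.1, hflatb.1, hflatb.2, m, hflata.2⟩
  filter_upwards [ha₁c, hb₁0] with t h1 h2 using ⟨h1, h2⟩

/-! ### Comparison of regularized actions along a ray and in the plane -/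

theorem contDiff_fderiv_comp {E F : Type*} [NormedAddCommGroup E] [NormedSpace ℝ E]
    [NormedAddCommGroup F] [NormedSpace ℝ F] {f : E → F} (hf : ContDiff ℝ ∞ f) {γ : ℝ → E}
    (hγ : ContDiff ℝ ∞ γ) (v : E) : ContDiff ℝ ∞ fun t => fderiv ℝ f (γ t) v :=
  (((contDiff_infty_iff_fderiv.1 hf).2).comp hγ).clm_apply contDiff_const

theorem fderiv_prod_apply {F : Type*} [NormedAddCommGroup F] [NormedSpace ℝ F]
    (A : ℝ × ℝ →L[ℝ] F) (x y : ℝ) : A (x, y) = x • A (1, 0) + y • A (0, 1) := by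
  rw [← map_smul, ← map_smul, ← map_add]
  simp

/-- A function that is `C¹` at `p` is Lipschitz near `p`, so it preserves infinite-order contact of
two curves. -/
theorem RightFlat.comp_sub {E F : Type*} [NormedAddCommGroup E] [NormedSpace ℝ E]
    [NormedAddCommGroup F] [NormedSpace ℝ F] {x y : ℝ → E} {f : E → F} {p : E}
    (h : RightFlat fun t => x t - y t) (hf : ContDiffAt ℝ 1 f p) (hx : Tendsto x (𝓝[>] 0) (𝓝 p))
    (hy : Tendsto y (𝓝[>] 0) (𝓝 p)) : RightFlat fun t => f (x t) - f (y t) := by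
  obtain ⟨K, s, hs, hK⟩ := hf.exists_lipschitzOnWith
  refine h.trans_isBigO (IsBigO.of_bound K ?_)
  filter_upwards [hx hs, hy hs] with t h1 h2
  exact hK.norm_sub_le h1 h2

/-- The argument of `κ + i ν s` compared with that of `1 + i s`, for signs `κ` and `ν`. -/
theorem arg_sign_change {κ ν s : ℝ} (hκ : κ = 1 ∨ κ = -1) (hν : ν = 1 ∨ ν = -1) (hs : s ≠ 0) :
    ∃ r : ℤ, κ * Complex.arg ⟨κ, ν * s⟩ = ν * Complex.arg ⟨1, s⟩ + Real.pi * r ∧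
      (κ = 1 → r = 0) ∧ (κ = -1 → Odd r) := by
  have hconj : Complex.arg ⟨1, -s⟩ = -Complex.arg ⟨1, s⟩ := by
    have : (⟨1, -s⟩ : ℂ) = (starRingEnd ℂ) ⟨1, s⟩ := by apply Complex.ext <;> simp
    rw [this, Complex.arg_conj, if_neg]
    rw [Complex.arg_eq_pi_iff]
    simp
  have hneg : ∀ s : ℝ, s ≠ 0 → ∃ r : ℤ, Complex.arg ⟨-1, s⟩ = Complex.arg ⟨1, -s⟩ + Real.pi * r ∧
      Odd r := by
    intro s hs
    have : (⟨-1, s⟩ : ℂ) = -⟨1, -s⟩ := by apply Complex.ext <;> simp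
    rw [this]
    rcases lt_or_gt_of_ne hs with h | h
    · refine ⟨-1, ?_, by decide⟩
      rw [Complex.arg_neg_eq_arg_sub_pi_of_im_pos (by simpa using h)]
      push_cast; ring
    · refine ⟨1, ?_, by decide⟩
      rw [Complex.arg_neg_eq_arg_add_pi_of_im_neg (by simpa using h)]
      push_cast; ring
  rcases hκ with rfl | rfl
  · refine ⟨0, ?_, fun _ => rfl, fun h => by norm_num at h⟩
    rcases hν with rfl | rfl
    · simp
    · simp [hconj]
  · rcases hν with rfl | rfl
    · obtain ⟨r, h1, h2⟩ := hneg s hs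
      refine ⟨-r, ?_, fun h => by norm_num at h, fun _ => h2.neg⟩
      rw [one_mul, h1, hconj]
      push_cast; ring
    · obtain ⟨r, h1, h2⟩ := hneg (-s) (neg_ne_zero.2 hs)
      refine ⟨-r, ?_, fun h => by norm_num at h, fun _ => h2.neg⟩
      rw [neg_neg] at h1
      rw [neg_one_mul s, h1]
      push_cast; ring

/-- The lattice spanned by `da` and the singular period. -/
def periodLattice (h : ℝ × ℝ → ℝ) (w : ℝ × ℝ) : Set (ℝ × ℝ) :=
  (AddSubgroup.closure {(1, 0), FFNeighborhood.EliassonIsomorphism.singularPeriod h w} :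
    Set (ℝ × ℝ))

/-- The pull-back of the covector `τ₁ da + τ₂ db` by a linear map. -/
def pullCovector (A : ℝ × ℝ →L[ℝ] ℝ × ℝ) (τ : ℝ × ℝ) : ℝ × ℝ :=
  (τ.1 * (A (1, 0)).1 + τ.2 * (A (1, 0)).2, τ.1 * (A (0, 1)).1 + τ.2 * (A (0, 1)).2)

/-- If the determinant vanished, the two cofactor vectors would lie in the kernel and be zero, which
gives `A (1, 0) = 0`. -/
theorem det_ne_zero_of_injective {A : ℝ × ℝ →L[ℝ] ℝ × ℝ} (hA : Function.Injective A) :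
    (A (1, 0)).1 * (A (0, 1)).2 - (A (1, 0)).2 * (A (0, 1)).1 ≠ 0 := by
  intro h
  have hinj : ∀ x y : ℝ, A (x, y) = 0 → x = 0 ∧ y = 0 := fun x y hxy => by
    have := hA (hxy.trans (map_zero A).symm)
    exact Prod.mk_eq_zero.1 this
  have h1 := hinj (A (0, 1)).2 (-(A (1, 0)).2) (by
    rw [fderiv_prod_apply]
    apply Prod.ext <;> simp <;> linarith)
  have h2 := hinj (A (0, 1)).1 (-(A (1, 0)).1) (by
    rw [fderiv_prod_apply]
    apply Prod.ext <;> simp <;> linarith)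
  have h3 := hinj 1 0 (Prod.ext (by simpa using h2.2) (by simpa using h1.2))
  exact one_ne_zero h3.1

/-- Comparison of two regularized actions along the ray spanned by `(1, s)`. -/
theorem period_comparison_on_ray {h h' : ℝ × ℝ → ℝ} {G : ℝ × ℝ → ℝ × ℝ} (hh : ContDiff ℝ ∞ h)
    (hh' : ContDiff ℝ ∞ h') (hG : ContDiff ℝ ∞ G) (hG0 : G 0 = 0)
    (hinj : Function.Injective (fderiv ℝ G 0))
    (hL : ∀ᶠ w in 𝓝 (0 : ℝ × ℝ), w ≠ 0 → ∀ τ : ℝ × ℝ,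
      pullCovector (fderiv ℝ G w) τ ∈ periodLattice h w ↔ τ ∈ periodLattice h' (G w))
    {κ ν c s : ℝ} (hκ : κ = (fderiv ℝ G 0 (1, 0)).1) (hν : ν = (fderiv ℝ G 0 (0, 1)).2)
    (hc : c = κ * fderiv ℝ h' 0 (1, 0) - ν * fderiv ℝ h 0 (1, 0)) (hs : s ≠ 0)
    (hs' : (fderiv ℝ G 0 (1, s)).2 ≠ 0) :
    (κ = 1 ∨ κ = -1) ∧ (ν = 1 ∨ ν = -1) ∧
    (∃ m r : ℤ, c = m - r / 2 ∧ (κ = 1 → r = 0) ∧ (κ = -1 → Odd r)) ∧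
    RightFlat fun t : ℝ => h' (κ * t, ν * (t * s)) - ν * h (t, t * s) - c * t -
      (h' 0 - ν * h 0) := by
  -- the ray and its image
  have hp : ContDiff ℝ ∞ fun t : ℝ => (t, t * s) := contDiff_id.prodMk (contDiff_id.mul contDiff_const)
  have hGp : ContDiff ℝ ∞ fun t : ℝ => G (t, t * s) := hG.comp hp
  have hp0 : ((0 : ℝ), (0 : ℝ) * s) = 0 := by simp
  have hpd : ∀ t : ℝ, HasDerivAt (fun t : ℝ => (t, t * s)) (1, s) t := fun t => by
    have := (hasDerivAt_id t).prodMk ((hasDerivAt_id t).mul_const s)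
    simpa using this
  have hGd : ∀ t : ℝ, HasDerivAt (fun t : ℝ => G (t, t * s)) (fderiv ℝ G (t, t * s) (1, s)) t :=
    fun t => ((hG.differentiable (by simp) _).hasFDerivAt).comp_hasDerivAt t (hpd t)
  -- polar coordinates of the image
  obtain ⟨K, hK, hKe, hK0⟩ := exists_contDiff_eq_smul
    (f := fun t : ℝ => Complex.equivRealProdCLM.symm (G (t, t * s)))
    (Complex.equivRealProdCLM.symm.contDiff.comp hGp) (by simp [Prod.mk_zero_zero, hG0])
  have hK0' : K 0 = Complex.equivRealProdCLM.symm (fderiv ℝ G 0 (1, s)) := by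
    rw [hK0]
    have := (Complex.equivRealProdCLM.symm.hasFDerivAt (x := G (0, 0 * s))).comp_hasDerivAt 0 (hGd 0)
    have e := this.deriv
    rw [hp0] at e
    exact e
  have hKim : (K 0).im ≠ 0 := by rw [hK0']; simpa using hs'
  have hKslit : K 0 ∈ Complex.slitPlane := Or.inr hKim
  -- Since `K 0` is off the branch cut by `hs'`, the logarithm of `K` is smooth near `0`; it is
  -- replaced by a globally smooth function because `lattice_comparison` asks for one.
  obtain ⟨LK, hLK, hLKe⟩ : ∃ LK : ℝ → ℂ, ContDiff ℝ ∞ LK ∧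
      LK =ᶠ[𝓝 0] fun t => Complex.log (K t) := by
    have hU : K ⁻¹' Complex.slitPlane ∈ 𝓝 (0 : ℝ) :=
      hK.continuous.continuousAt.preimage_mem_nhds (Complex.isOpen_slitPlane.mem_nhds hKslit)
    refine exists_contDiff_eventuallyEq hU fun t ht => ContDiffAt.contDiffWithinAt ?_
    exact ((Complex.contDiffAt_log (n := ∞) ht).restrict_scalars ℝ).comp t hK.contDiffAt
  have hLKre : ContDiff ℝ ∞ fun t => (LK t).re := Complex.reCLM.contDiff.comp hLK
  have hLKim : ContDiff ℝ ∞ fun t => (LK t).im := Complex.imCLM.contDiff.comp hLK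
  have hLKe' := hLKe.filter_mono (nhdsWithin_le_nhds (s := Set.Ioi (0 : ℝ)))
  have hlog1 : ∀ t : ℝ, 0 < t → Complex.log ⟨t, t * s⟩ = Real.log t + Complex.log ⟨1, s⟩ := by
    intro t ht
    have : (⟨t, t * s⟩ : ℂ) = (t : ℂ) * ⟨1, s⟩ := by apply Complex.ext <;> simp
    rw [this, Complex.log_ofReal_mul ht]
    exact fun h => hs (congrArg Complex.im h)
  have hlog2 : ∀ᶠ t : ℝ in 𝓝[>] 0,
      Complex.log ⟨(G (t, t * s)).1, (G (t, t * s)).2⟩ = Real.log t + LK t := by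
    have hne : ∀ᶠ t in 𝓝[>] 0, K t ≠ 0 := nhdsWithin_le_nhds
      (hK.continuous.continuousAt.eventually_ne (Complex.slitPlane_ne_zero hKslit))
    filter_upwards [self_mem_nhdsWithin, hLKe', hne] with t ht hl hn
    have : (⟨(G (t, t * s)).1, (G (t, t * s)).2⟩ : ℂ) = (t : ℂ) * K t := by
      rw [← Complex.real_smul, ← hKe]
      apply Complex.ext <;> simp
    rw [this, Complex.log_ofReal_mul ht hn, hl]
  -- lattices along the ray
  have hcomp : ∀ v : ℝ × ℝ, ContDiff ℝ ∞ fun t : ℝ => fderiv ℝ G (t, t * s) v :=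
    fun v => contDiff_fderiv_comp hG hp v
  have hA := fun v : ℝ × ℝ => contDiff_fderiv_comp hh hp v
  have hA' := fun v : ℝ × ℝ => contDiff_fderiv_comp hh' hGp v
  -- The four coefficients are the entries of `dG`, arranged so that `(x a₁ + y a₂, x b₁ + y b₂)` is
  -- the pull-back of `x da + y db`. The splittings `log t + log (1 + i s)` and `log t + LK` of the
  -- complex logarithms supply `S`, `T`, `U`, `V`.
  obtain ⟨hκ1, hν1, hab, ha₂, hb₂, hvb, m, hva⟩ := lattice_comparison
    (a₁ := fun t => (fderiv ℝ G (t, t * s) (1, 0)).1)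
    (b₁ := fun t => (fderiv ℝ G (t, t * s) (0, 1)).1)
    (a₂ := fun t => (fderiv ℝ G (t, t * s) (1, 0)).2)
    (b₂ := fun t => (fderiv ℝ G (t, t * s) (0, 1)).2)
    (S := fun t => (Complex.log ⟨1, s⟩).im + 2 * Real.pi * fderiv ℝ h (t, t * s) (1, 0))
    (T := fun t => (Complex.log ⟨1, s⟩).re + 2 * Real.pi * fderiv ℝ h (t, t * s) (0, 1))
    (U := fun t => (LK t).im + 2 * Real.pi * fderiv ℝ h' (G (t, t * s)) (1, 0))
    (V := fun t => (LK t).re + 2 * Real.pi * fderiv ℝ h' (G (t, t * s)) (0, 1))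
    (hcomp _).fst (hcomp _).fst (hcomp _).snd (hcomp _).snd
    (contDiff_const.add (contDiff_const.mul (hA _))) (contDiff_const.add (contDiff_const.mul (hA _)))
    (hLKim.add (contDiff_const.mul (hA' _))) (hLKre.add (contDiff_const.mul (hA' _)))
    (by simpa only [hp0] using det_ne_zero_of_injective hinj)
    (by
      have hpt : Tendsto (fun t : ℝ => (t, t * s)) (𝓝[>] 0) (𝓝 0) := by
        have := hp.continuous.tendsto 0
        rw [hp0] at this
        exact this.mono_left nhdsWithin_le_nhds
      filter_upwards [hpt.eventually hL, self_mem_nhdsWithin, hlog2] with t ht ht0 hl x y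
      rw [Set.mem_Ioi] at ht0
      have h1 := ht (fun h => ht0.ne' (congrArg Prod.fst h)) (x, y)
      have e1 : FFNeighborhood.EliassonIsomorphism.singularPeriod h (t, t * s) =
          (((Complex.log ⟨1, s⟩).im + 2 * Real.pi * fderiv ℝ h (t, t * s) (1, 0)) / (2 * Real.pi),
          (Real.log t + ((Complex.log ⟨1, s⟩).re + 2 * Real.pi * fderiv ℝ h (t, t * s) (0, 1))) /
            (2 * Real.pi)) := by
        rw [FFNeighborhood.EliassonIsomorphism.singularPeriod, hlog1 t ht0]
        ext <;> simp only [Complex.add_im, Complex.ofReal_im, Complex.add_re, Complex.ofReal_re] <;>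
          field_simp <;> ring
      have e2 : FFNeighborhood.EliassonIsomorphism.singularPeriod h' (G (t, t * s)) =
          (((LK t).im + 2 * Real.pi * fderiv ℝ h' (G (t, t * s)) (1, 0)) / (2 * Real.pi),
          (Real.log t + ((LK t).re + 2 * Real.pi * fderiv ℝ h' (G (t, t * s)) (0, 1))) /
            (2 * Real.pi)) := by
        rw [FFNeighborhood.EliassonIsomorphism.singularPeriod, hl]
        ext <;> simp only [Complex.add_im, Complex.ofReal_im, Complex.add_re, Complex.ofReal_re] <;>
          field_simp <;> ring
      rw [periodLattice, periodLattice, e1, e2] at h1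
      exact h1)
  simp only [hp0, ← hκ, ← hν] at hκ1 hν1 hab hb₂ hvb hva
  -- the image of the ray is tangent to infinite order to the ray spanned by `(κ, ν s)`
  have hD1 : RightFlat fun t : ℝ => (G (t, t * s)).1 - κ * t := by
    refine RightFlat.of_deriv (f' := fun t => (fderiv ℝ G (t, t * s) (1, s)).1 - κ)
      (fun t => ?_) ?_ (by simp [Prod.mk_zero_zero, hG0])
    · have h1 : HasDerivAt (fun t : ℝ => (G (t, t * s)).1) _ t :=
        hasFDerivAt_fst.comp_hasDerivAt t (hGd t)
      have h2 : HasDerivAt (fun t : ℝ => κ * t) κ t := by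
        simpa using (hasDerivAt_id t).const_mul κ
      exact h1.fun_sub h2
    · intro n
      refine (isBigO_zero _ _).congr' ?_ EventuallyEq.rfl
      filter_upwards [hab] with t ht
      rw [fderiv_prod_apply]
      simp [ht.1, ht.2]
  have hD2 : RightFlat fun t : ℝ => (G (t, t * s)).2 - ν * (t * s) := by
    refine RightFlat.of_deriv (f' := fun t => (fderiv ℝ G (t, t * s) (1, s)).2 - ν * s)
      (fun t => ?_) ?_ (by simp [Prod.mk_zero_zero, hG0])
    · have h1 : HasDerivAt (fun t : ℝ => (G (t, t * s)).2) _ t :=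
        hasFDerivAt_snd.comp_hasDerivAt t (hGd t)
      have h2 : HasDerivAt (fun t : ℝ => ν * (t * s)) (ν * s) t := by
        simpa using ((hasDerivAt_id t).mul_const s).const_mul ν
      exact h1.fun_sub h2
    · refine (ha₂.add (hb₂.const_mul s)).congr' ?_
      filter_upwards with t
      rw [fderiv_prod_apply _ 1 s]
      simp
      ring
  have hD : RightFlat fun t : ℝ => G (t, t * s) - (κ * t, ν * (t * s)) := by
    intro n
    exact ((hD1 n).prod_left (hD2 n))
  -- Here `K = G / t` for `t > 0`, and flatness survives division by `t`.
  have hKflat : RightFlat fun t => K t - ⟨κ, ν * s⟩ := by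
    have h1 := (hD1.div_id)
    have h2 := (hD2.div_id)
    intro n
    have h3 : (fun t => (((G (t, t * s)).1 - κ * t) / t : ℝ) •
        (1 : ℂ) + (((G (t, t * s)).2 - ν * (t * s)) / t : ℝ) • Complex.I) =O[𝓝[>] 0]
        fun t : ℝ => t ^ n := by
      have e1 := (h1 n).smul (isBigO_refl (fun _ : ℝ => (1 : ℂ)) (𝓝[>] 0))
      have e2 := (h2 n).smul (isBigO_refl (fun _ : ℝ => Complex.I) (𝓝[>] 0))
      have e3 : (fun t : ℝ => t ^ n • (1 : ℂ)) =O[𝓝[>] 0] fun t : ℝ => t ^ n :=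
        IsBigO.of_bound 1 (by filter_upwards with t; simp)
      have e4 : (fun t : ℝ => t ^ n • Complex.I) =O[𝓝[>] 0] fun t : ℝ => t ^ n :=
        IsBigO.of_bound 1 (by filter_upwards with t; simp)
      exact (e1.trans e3).add (e2.trans e4)
    refine h3.congr' ?_ EventuallyEq.rfl
    filter_upwards [self_mem_nhdsWithin] with t ht
    have ht' : t ≠ 0 := ne_of_gt ht
    have h4 := hKe t
    have h5 : (G (t, t * s)).1 = t * (K t).re := by
      have := congrArg Complex.re h4
      simpa using this
    have h6 : (G (t, t * s)).2 = t * (K t).im := by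
      have := congrArg Complex.im h4
      simpa using this
    rw [h5, h6]
    apply Complex.ext
    · simp; field_simp
    · simp; field_simp
  have hKt : Tendsto K (𝓝[>] 0) (𝓝 (K 0)) :=
    (hK.continuous.tendsto 0).mono_left nhdsWithin_le_nhds
  have hK0w : K 0 = ⟨κ, ν * s⟩ := by
    have := hKt.sub_const (⟨κ, ν * s⟩ : ℂ)
    exact sub_eq_zero.1 (tendsto_nhds_unique this hKflat.tendsto)
  have hLKflat : RightFlat fun t => LK t - Complex.log ⟨κ, ν * s⟩ := by
    have := hKflat.comp_sub (f := Complex.log) (p := K 0)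
      ((Complex.contDiffAt_log (n := 1) hKslit).restrict_scalars ℝ) hKt
      (by rw [← hK0w]; exact tendsto_const_nhds)
    refine this.congr' ?_
    filter_upwards [hLKe'] with t ht
    rw [ht]
  have hLKimf : RightFlat fun t => (LK t).im - Complex.arg ⟨κ, ν * s⟩ := by
    refine hLKflat.trans_isBigO (IsBigO.of_bound 1 ?_)
    filter_upwards with t
    have := Complex.abs_im_le_norm (LK t - Complex.log ⟨κ, ν * s⟩)
    rw [Complex.sub_im, Complex.log_im] at this
    simpa using this
  have hnorm : (Complex.log ⟨κ, ν * s⟩).re = (Complex.log ⟨1, s⟩).re := by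
    rw [Complex.log_re, Complex.log_re]
    congr 1
    rw [Complex.norm_eq_sqrt_sq_add_sq, Complex.norm_eq_sqrt_sq_add_sq]
    congr 1
    have h1 : κ ^ 2 = 1 := by rcases hκ1 with h | h <;> simp [h]
    have h2 : ν ^ 2 = 1 := by rcases hν1 with h | h <;> simp [h]
    simp only [mul_pow, h1, h2]
    ring
  have hLKref : RightFlat fun t => (LK t).re - (Complex.log ⟨1, s⟩).re := by
    refine hLKflat.trans_isBigO (IsBigO.of_bound 1 ?_)
    filter_upwards with t
    have := Complex.abs_re_le_norm (LK t - Complex.log ⟨κ, ν * s⟩)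
    rw [Complex.sub_re, hnorm] at this
    simpa using this
  -- the constant
  obtain ⟨r, hr, hr1, hr2⟩ := arg_sign_change hκ1 hν1 hs
  have hVc : ContDiff ℝ ∞ fun t => (LK t).re + 2 * Real.pi * fderiv ℝ h' (G (t, t * s)) (0, 1) :=
    hLKre.add (contDiff_const.mul (hA' _))
  have hpi : (0 : ℝ) < 2 * Real.pi := by positivity
  -- The flat terms add up so that `V` and `LK` cancel; the two arguments leave `π r`, which becomes
  -- `r / 2` after division by `2π`.
  have hflatA : RightFlat fun t => κ * fderiv ℝ h' (G (t, t * s)) (1, 0) -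
      ν * fderiv ℝ h (t, t * s) (1, 0) - (m - r / 2) := by
    have h1 := ((hva.add (ha₂.mul_continuous hVc.continuous.continuousAt)).add
      (hLKimf.const_mul κ)).const_mul (-(1 / (2 * Real.pi)))
    refine h1.congr' ?_
    filter_upwards with t
    rw [Complex.log_im, mul_sub, hr]
    field_simp
    ring
  -- A flat function tends to `0`, whereas continuity at `t = 0` gives the limit `c - (m - r / 2)`.
  have hcm : c = m - r / 2 := by
    have h1 : Tendsto (fun t => κ * fderiv ℝ h' (G (t, t * s)) (1, 0) -
        ν * fderiv ℝ h (t, t * s) (1, 0) - (m - r / 2)) (𝓝[>] 0) (𝓝 (c - (m - r / 2))) := by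
      have hcont : Continuous fun t => κ * fderiv ℝ h' (G (t, t * s)) (1, 0) -
        ν * fderiv ℝ h (t, t * s) (1, 0) - (m - r / 2) :=
        ((continuous_const.mul (hA' _).continuous).sub
          (continuous_const.mul (hA _).continuous)).sub continuous_const
      have := hcont.tendsto 0
      simp only [hp0, hG0, ← hc] at this
      exact this.mono_left nhdsWithin_le_nhds
    exact sub_eq_zero.1 (tendsto_nhds_unique h1 hflatA.tendsto)
  refine ⟨hκ1, hν1, ⟨m, r, hcm, hr1, hr2⟩, ?_⟩
  have hflatB : RightFlat fun t => ν * fderiv ℝ h' (G (t, t * s)) (0, 1) -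
      ν * fderiv ℝ h (t, t * s) (0, 1) := by
    have h1 := ((hvb.add (hb₂.mul_continuous hVc.continuous.continuousAt)).add
      (hLKref.const_mul ν)).const_mul (-(1 / (2 * Real.pi)))
    refine h1.congr' ?_
    filter_upwards with t
    field_simp
    ring
  -- replacing the image of the ray by the ray spanned by `(κ, ν s)`
  have hGt : Tendsto (fun t : ℝ => G (t, t * s)) (𝓝[>] 0) (𝓝 0) := by
    have := hGp.continuous.tendsto 0
    simp only [hp0, hG0] at this
    exact this.mono_left nhdsWithin_le_nhds
  have hEd : ∀ t : ℝ, HasDerivAt (fun t : ℝ => (κ * t, ν * (t * s))) (κ, ν * s) t := fun t => by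
    have := ((hasDerivAt_id t).const_mul κ).prodMk (((hasDerivAt_id t).mul_const s).const_mul ν)
    simpa using this
  have hEt : Tendsto (fun t : ℝ => (κ * t, ν * (t * s))) (𝓝[>] 0) (𝓝 0) := by
    have := (hEd 0).continuousAt.tendsto
    simp only [mul_zero, zero_mul, Prod.mk_zero_zero] at this
    exact this.mono_left nhdsWithin_le_nhds
  have hrep : ∀ v : ℝ × ℝ, RightFlat fun t => fderiv ℝ h' (G (t, t * s)) v -
      fderiv ℝ h' (κ * t, ν * (t * s)) v := fun v =>
    hD.comp_sub (f := fun x => fderiv ℝ h' x v) (p := 0)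
      ((((contDiff_infty_iff_fderiv.1 hh').2.clm_apply contDiff_const).contDiffAt).of_le
        (by exact_mod_cast le_top)) hGt hEt
  -- Flatness is obtained by integration: the derivative combines `hflatA` and `s` times `hflatB`,
  -- moved to the straight ray by `hrep`, and the subtracted constant is the value at `t = 0`.
  refine RightFlat.of_deriv (f' := fun t => fderiv ℝ h' (κ * t, ν * (t * s)) (κ, ν * s) -
    ν * fderiv ℝ h (t, t * s) (1, s) - c) (fun t => ?_) ?_ (by simp [Prod.mk_zero_zero])
  · have h1 := ((hh'.differentiable (by simp) (κ * t, ν * (t * s))).hasFDerivAt).comp_hasDerivAt t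
      (hEd t)
    have h2 := ((hh.differentiable (by simp) (t, t * s)).hasFDerivAt).comp_hasDerivAt t (hpd t)
    have h3 := ((h1.sub (h2.const_mul ν)).sub ((hasDerivAt_id t).const_mul c)).sub_const
      (h' 0 - ν * h 0)
    simpa using h3
  · refine ((hflatA.sub ((hrep (1, 0)).const_mul κ)).add
      ((hflatB.sub ((hrep (0, 1)).const_mul ν)).const_mul s)).congr' ?_
    filter_upwards with t
    rw [fderiv_prod_apply _ κ, fderiv_prod_apply _ 1 s, hcm]
    simp only [smul_eq_mul]
    ring

/-! ### The action of the Klein group -/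

theorem sgn_add (i j : ZMod 2) : sgn (i + j) = sgn i * sgn j := by
  revert i j; decide

theorem sgn_mul_self (j : ZMod 2) : sgn j * sgn j = 1 := by
  revert j; decide

theorem rescale_smul_X_zero (κ ν c : ℝ) :
    MvPowerSeries.rescale ![κ, ν] (c • MvPowerSeries.X 0 : MvPowerSeries (Fin 2) ℝ) =
      (κ * c) • MvPowerSeries.X 0 := by
  ext n
  rw [MvPowerSeries.coeff_rescale, map_smul, map_smul, MvPowerSeries.coeff_X]
  by_cases hn : n = Finsupp.single 0 1
  · subst hn; simp
  · simp [hn]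

theorem smul_X_zero_mem (z : ℤ) :
    ((z : ℝ) • MvPowerSeries.X 0 : MvPowerSeries (Fin 2) ℝ) ∈ ffSubgroup :=
  AddSubgroup.mem_sup_right (AddSubgroup.mem_zmultiples_iff.2
    ⟨z, (Int.cast_smul_eq_zsmul ℝ z (MvPowerSeries.X 0 : MvPowerSeries (Fin 2) ℝ)).symm⟩)

theorem C_mem_ffSubgroup (d : ℝ) : (MvPowerSeries.C d : MvPowerSeries (Fin 2) ℝ) ∈ ffSubgroup :=
  AddSubgroup.mem_sup_left (AddMonoidHom.mem_range.2 ⟨d, rfl⟩)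

theorem kleinAct_mk (T : MvPowerSeries (Fin 2) ℝ) (j : K4) :
    kleinAct (QuotientAddGroup.mk T) j =
      QuotientAddGroup.mk (signChange j T + ((j.1.val : ℝ) / 2) • MvPowerSeries.X 0) := rfl

theorem signChange_apply (j : K4) (T : MvPowerSeries (Fin 2) ℝ) :
    signChange j T = sgn j.2 • MvPowerSeries.rescale ![(sgn j.1 : ℝ), (sgn j.2 : ℝ)] T := rfl

theorem signChange_signChange (j j' : K4) (T : MvPowerSeries (Fin 2) ℝ) :
    signChange j' (signChange j T) = signChange (j + j') T := by
  ext n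
  have hprod : ∀ a b : ℝ, (n.prod fun s m => (![a, b] : Fin 2 → ℝ) s ^ m) = a ^ n 0 * b ^ n 1 := by
    intro a b
    rw [Finsupp.prod_fintype _ _ (by simp)]
    simp
  simp only [signChange_apply, map_zsmul, MvPowerSeries.coeff_rescale, hprod, Prod.fst_add,
    Prod.snd_add, sgn_add]
  simp only [zsmul_eq_mul, Int.cast_mul, mul_pow]
  ring

/-- The linear terms agree only modulo `ℤ a`: changing the sign of `j / 2` alters it by an integer,
which is the finite check `hdvd`. -/
theorem kleinAct_kleinAct (T : FFSeries) (j j' : K4) :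
    kleinAct (kleinAct T j) j' = kleinAct T (j + j') := by
  obtain ⟨T, rfl⟩ := QuotientAddGroup.mk_surjective T
  rw [kleinAct_mk, kleinAct_mk, kleinAct_mk, map_add, signChange_signChange, QuotientAddGroup.eq]
  have hdvd : ∀ a b c : ZMod 2, (2 : ℤ) ∣ (a + b).val - (sgn c * sgn b * a.val + b.val) := by
    decide
  obtain ⟨z, hz⟩ := hdvd j.1 j'.1 j'.2
  have hz' : (((j.1 + j'.1).val : ℤ) : ℝ) - (sgn j'.2 * sgn j'.1 * (j.1.val : ℤ) + (j'.1.val : ℤ)) =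
      2 * z := by exact_mod_cast hz
  rw [signChange_apply j', rescale_smul_X_zero, ← Int.cast_smul_eq_zsmul ℝ, smul_smul]
  convert smul_X_zero_mem z using 1
  rw [show (z : ℝ) = ((j.1 + j'.1).val : ℝ) / 2 - sgn j'.2 * (sgn j'.1 * (j.1.val / 2)) -
    j'.1.val / 2 by push_cast at hz'; linarith]
  rw [sub_smul, sub_smul]
  simp only [Prod.fst_add]
  abel

theorem orbit_kleinAct (T : FFSeries) (j : K4) : orbit (kleinAct T j) = orbit T := by
  ext U
  constructor
  · rintro ⟨j', rfl⟩
    exact ⟨j + j', (kleinAct_kleinAct T j j').symm⟩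
  · rintro ⟨j', rfl⟩
    exact ⟨j' - j, by rw [kleinAct_kleinAct, add_sub_cancel]⟩

theorem exists_sgn_eq {κ : ℝ} (h : κ = 1 ∨ κ = -1) : ∃ j : ZMod 2, (sgn j : ℝ) = κ := by
  rcases h with rfl | rfl
  · exact ⟨0, by simp [sgn]⟩
  · exact ⟨1, by simp [sgn]⟩

/-- The signs `(κ, ν)` name the Klein group element. The condition on `c` says exactly that `ν c +
j₁ / 2` is an integer, so it disappears in the quotient together with the constant. -/
theorem taylorOrbit_eq_of_rescale_eq {h h' : ℝ × ℝ → ℝ} {κ ν c d : ℝ} (hκ : κ = 1 ∨ κ = -1)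
    (hν : ν = 1 ∨ ν = -1) (hc : ∃ m r : ℤ, c = m - r / 2 ∧ (κ = 1 → r = 0) ∧ (κ = -1 → Odd r))
    (e : MvPowerSeries.rescale ![κ, ν] (taylor h') =
      ν • taylor h + c • MvPowerSeries.X 0 + MvPowerSeries.C d) :
    taylorOrbit h = taylorOrbit h' := by
  obtain ⟨j₁, rfl⟩ := exists_sgn_eq hκ
  obtain ⟨j₂, rfl⟩ := exists_sgn_eq hν
  suffices hk : kleinAct (QuotientAddGroup.mk (taylor h')) (j₁, j₂) =
      QuotientAddGroup.mk (taylor h) by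
    rw [taylorOrbit, ← hk, orbit_kleinAct]
    rfl
  obtain ⟨m, r, rfl, hr1, hr2⟩ := hc
  obtain ⟨z, hz⟩ : ∃ z : ℤ, (sgn j₂ : ℝ) * (m - r / 2) + j₁.val / 2 = z := by
    have h1 : ∀ j : ZMod 2, j = 0 ∨ j = 1 := by decide
    rcases h1 j₁ with rfl | rfl
    · rw [hr1 (by simp [sgn])]
      exact ⟨sgn j₂ * m, by simp⟩
    · obtain ⟨k, rfl⟩ := hr2 (by simp [sgn])
      rcases hν with h | h
      · exact ⟨m - k, by rw [h, ZMod.val_one]; push_cast; ring⟩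
      · exact ⟨-m + k + 1, by rw [h, ZMod.val_one]; push_cast; ring⟩
  rw [kleinAct_mk, eq_comm, QuotientAddGroup.eq, signChange_apply, e,
    ← Int.cast_smul_eq_zsmul ℝ]
  have hss : (sgn j₂ : ℝ) * sgn j₂ = 1 := by exact_mod_cast sgn_mul_self j₂
  have : -taylor h + ((sgn j₂ : ℝ) • ((sgn j₂ : ℝ) • taylor h + ((m : ℝ) - r / 2) •
      MvPowerSeries.X 0 + MvPowerSeries.C d) + ((j₁.val : ℝ) / 2) • MvPowerSeries.X 0) =
      (z : ℝ) • MvPowerSeries.X 0 + MvPowerSeries.C (sgn j₂ * d) := by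
    rw [smul_add, smul_add, smul_smul, hss, one_smul, smul_smul, ← hz, add_smul, map_mul,
      MvPowerSeries.smul_eq_C_mul (MvPowerSeries.C d)]
    abel
  rw [this]
  exact add_mem (smul_X_zero_mem z) (C_mem_ffSubgroup _)

/-- Two regularized actions whose period lattices correspond under a local diffeomorphism of the
plane fixing the origin have the same Taylor series orbit. -/
theorem taylorOrbit_eq_of_periodLattice {h h' : ℝ × ℝ → ℝ} {G : ℝ × ℝ → ℝ × ℝ}
    {U U' Y : Set (ℝ × ℝ)} (hU : U ∈ 𝓝 0) (hU' : U' ∈ 𝓝 0) (hY : Y ∈ 𝓝 0)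
    (hh : ContDiffOn ℝ ∞ h U) (hh' : ContDiffOn ℝ ∞ h' U') (hG : ContDiffOn ℝ ∞ G Y)
    (hG0 : G 0 = 0) (hinj : Function.Injective (fderiv ℝ G 0))
    (hL : ∀ᶠ w in 𝓝 (0 : ℝ × ℝ), w ≠ 0 → ∀ τ : ℝ × ℝ,
      pullCovector (fderiv ℝ G w) τ ∈ periodLattice h w ↔ τ ∈ periodLattice h' (G w)) :
    taylorOrbit h = taylorOrbit h' := by
  -- Taylor series and lattices near `0` see only germs, so globally smooth representatives may be
  -- used.
  obtain ⟨k, hk, hke⟩ := exists_contDiff_eventuallyEq hU hh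
  obtain ⟨k', hk', hke'⟩ := exists_contDiff_eventuallyEq hU' hh'
  obtain ⟨H, hH, hHe⟩ := exists_contDiff_eventuallyEq hY hG
  rw [taylorOrbit, taylorOrbit, ← taylor_congr hke, ← taylor_congr hke']
  change taylorOrbit k = taylorOrbit k'
  have hH0 : H 0 = 0 := by rw [hHe.eq_of_nhds, hG0]
  have hinj' : Function.Injective (fderiv ℝ H 0) := by rwa [hHe.fderiv_eq]
  have hL' : ∀ᶠ w in 𝓝 (0 : ℝ × ℝ), w ≠ 0 → ∀ τ : ℝ × ℝ,
      pullCovector (fderiv ℝ H w) τ ∈ periodLattice k w ↔ τ ∈ periodLattice k' (H w) := by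
    have hHt : Tendsto H (𝓝 0) (𝓝 0) := by
      have := hH.continuous.tendsto 0
      rwa [hH0] at this
    filter_upwards [hL, hHe, hHe.fderiv (𝕜 := ℝ), hke.fderiv (𝕜 := ℝ),
      hHt.eventually (hke'.fderiv (𝕜 := ℝ))] with w h1 h2 h3 h4 h5 hw τ
    have e1 : periodLattice k w = periodLattice h w := by
      rw [periodLattice, periodLattice, FFNeighborhood.EliassonIsomorphism.singularPeriod,
        FFNeighborhood.EliassonIsomorphism.singularPeriod, h4]
    have e2 : periodLattice k' (H w) = periodLattice h' (G w) := by
      rw [periodLattice, periodLattice, FFNeighborhood.EliassonIsomorphism.singularPeriod,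
        FFNeighborhood.EliassonIsomorphism.singularPeriod, h5, h2]
    rw [e1, e2, h3]
    exact h1 hw τ
  set A := fderiv ℝ H 0 with hA
  -- Two slopes with `(A (1, s)).2 = 0` would make the second component of `A` vanish identically,
  -- against injectivity; so at most one slope besides `0` is excluded.
  have hgen : ∀ᶠ s : ℝ in cofinite, s ≠ 0 ∧ (A (1, s)).2 ≠ 0 := by
    refine (eventually_cofinite_ne 0).and ?_
    rw [eventually_cofinite]
    refine Set.Subsingleton.finite fun s hs s' hs' => ?_
    simp only [Set.mem_ofPred_eq, not_not] at hs hs'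
    rw [fderiv_prod_apply, one_smul, Prod.snd_add, Prod.smul_snd, smul_eq_mul] at hs hs'
    by_contra hne
    have h1 : (A (0, 1)).2 = 0 := by
      have : (s - s') * (A (0, 1)).2 = 0 := by linarith
      exact (mul_eq_zero.1 this).resolve_left (sub_ne_zero.2 hne)
    have h2 : (A (1, 0)).2 = 0 := by rw [h1] at hs; linarith
    exact det_ne_zero_of_injective hinj' (by rw [h1, h2]; ring)
  have hray := fun (s : ℝ) (hs : s ≠ 0 ∧ (A (1, s)).2 ≠ 0) =>
    period_comparison_on_ray hk hk' hH hH0 hinj' hL' rfl rfl rfl hs.1 hs.2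
  obtain ⟨s, hs⟩ := hgen.exists
  obtain ⟨h1, h2, h3, -⟩ := hray s hs
  exact taylorOrbit_eq_of_rescale_eq h1 h2 h3
    (rescale_taylor_eq hk hk' (hgen.mono fun s hs => (hray s hs).2.2.2))

/-! ### Symplectomorphisms and Hamiltonian vector fields -/

section Naturality

variable {M : Type*} [TopologicalSpace M] [ChartedSpace E4 M]
  {M₁ : Type*} [TopologicalSpace M₁] [ChartedSpace E4 M₁]
  {M₂ : Type*} [TopologicalSpace M₂] [ChartedSpace E4 M₂]

/-- A local symplectomorphism, defined on an open subset. -/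
structure IsSymplectic (Ω₁ : SymplecticForm M₁) (Ω₂ : SymplecticForm M₂)
    (Φ : OpenPartialHomeomorph M₁ M₂) : Prop where
  smooth : ContMDiffOn (𝓡 4) (𝓡 4) ∞ Φ Φ.source
  symm_smooth : ContMDiffOn (𝓡 4) (𝓡 4) ∞ Φ.symm Φ.target
  symplectic : ∀ p ∈ Φ.source, ∀ u v : TangentSpace (𝓡 4) p,
    Ω₂.form (Φ p) ![mfderiv (𝓡 4) (𝓡 4) Φ p u, mfderiv (𝓡 4) (𝓡 4) Φ p v] = Ω₁.form p ![u, v]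

namespace SymplecticForm

theorem form_swap (Ω : SymplecticForm M) (p : M) (u v : TangentSpace (𝓡 4) p) :
    Ω.form p ![u, v] = -Ω.form p ![v, u] := by
  have h := (Ω.form p).toAlternatingMap.map_swap ![v, u] (i := 0) (j := 1) (by decide)
  have e : (![v, u] ∘ ⇑(Equiv.swap (0 : Fin 2) 1) : Fin 2 → TangentSpace (𝓡 4) p) = ![u, v] := by
    funext i
    fin_cases i <;> rfl
  rw [e] at h
  exact h

theorem flat_apply (Ω : SymplecticForm M) (p : M) (u v : TangentSpace (𝓡 4) p) :
    Ω.flat p u v = Ω.form p ![u, v] := rfl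

theorem eq_of_form_eq (Ω : SymplecticForm M) {p : M} {u u' : TangentSpace (𝓡 4) p}
    (h : ∀ v, Ω.form p ![u, v] = Ω.form p ![u', v]) : u = u' :=
  (Ω.flat_bijective p).1 (LinearMap.ext h)

theorem bracket_eq (Ω : SymplecticForm M) (f g : M → ℝ) (p : M) :
    Ω.bracket f g p = -differential f p (Ω.hamVec g p) := Ω.form_hamVec f p _

theorem bracket_swap (Ω : SymplecticForm M) (f g : M → ℝ) (p : M) :
    Ω.bracket f g p = -Ω.bracket g f p := Ω.form_swap p _ _

theorem bracket_self (Ω : SymplecticForm M) (f : M → ℝ) (p : M) : Ω.bracket f f p = 0 := by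
  have := Ω.bracket_swap f f p
  linarith

end SymplecticForm

theorem differential_fst {F : M → ℝ × ℝ} {p : M}
    (hF : MDifferentiableAt (𝓡 4) 𝓘(ℝ, ℝ × ℝ) F p) (v : TangentSpace (𝓡 4) p) :
    differential (fun x => (F x).1) p v =
      (mfderiv (𝓡 4) 𝓘(ℝ, ℝ × ℝ) F p v : ℝ × ℝ).1 := by
  have h := (hasFDerivAt_fst (𝕜 := ℝ) (p := F p)).hasMFDerivAt.comp p hF.hasMFDerivAt
  exact congrArg (fun A : TangentSpace (𝓡 4) p →L[ℝ] ℝ => A v) h.mfderiv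

theorem differential_snd {F : M → ℝ × ℝ} {p : M}
    (hF : MDifferentiableAt (𝓡 4) 𝓘(ℝ, ℝ × ℝ) F p) (v : TangentSpace (𝓡 4) p) :
    differential (fun x => (F x).2) p v =
      (mfderiv (𝓡 4) 𝓘(ℝ, ℝ × ℝ) F p v : ℝ × ℝ).2 := by
  have h := (hasFDerivAt_snd (𝕜 := ℝ) (p := F p)).hasMFDerivAt.comp p hF.hasMFDerivAt
  exact congrArg (fun A : TangentSpace (𝓡 4) p →L[ℝ] ℝ => A v) h.mfderiv

theorem differential_comb {F : M → ℝ × ℝ} {p : M}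
    (hF : MDifferentiableAt (𝓡 4) 𝓘(ℝ, ℝ × ℝ) F p) (τ : ℝ × ℝ) (v : TangentSpace (𝓡 4) p) :
    differential (comb τ F) p v = τ.1 * (mfderiv (𝓡 4) 𝓘(ℝ, ℝ × ℝ) F p v : ℝ × ℝ).1 +
      τ.2 * (mfderiv (𝓡 4) 𝓘(ℝ, ℝ × ℝ) F p v : ℝ × ℝ).2 := by
  have h0 : HasFDerivAt (fun y : ℝ × ℝ => τ.1 * y.1 + τ.2 * y.2)
      (τ.1 • ContinuousLinearMap.fst ℝ ℝ ℝ + τ.2 • ContinuousLinearMap.snd ℝ ℝ ℝ) (F p) :=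
    (hasFDerivAt_fst.const_mul τ.1).add (hasFDerivAt_snd.const_mul τ.2)
  have h := h0.hasMFDerivAt.comp p hF.hasMFDerivAt
  exact congrArg (fun A : TangentSpace (𝓡 4) p →L[ℝ] ℝ => A v) h.mfderiv

theorem mfderiv_comp_apply_prod {F : M → ℝ × ℝ} {G : ℝ × ℝ → ℝ × ℝ} {p : M}
    (hF : MDifferentiableAt (𝓡 4) 𝓘(ℝ, ℝ × ℝ) F p) (hG : DifferentiableAt ℝ G (F p)) :
    MDifferentiableAt (𝓡 4) 𝓘(ℝ, ℝ × ℝ) (G ∘ F) p ∧ ∀ v : TangentSpace (𝓡 4) p,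
    (mfderiv (𝓡 4) 𝓘(ℝ, ℝ × ℝ) (G ∘ F) p v : ℝ × ℝ) =
      fderiv ℝ G (F p) (mfderiv (𝓡 4) 𝓘(ℝ, ℝ × ℝ) F p v : ℝ × ℝ) := by
  have h := hG.hasFDerivAt.hasMFDerivAt.comp p hF.hasMFDerivAt
  exact ⟨h.mdifferentiableAt, fun v =>
    congrArg (fun A : TangentSpace (𝓡 4) p →L[ℝ] ℝ × ℝ => A v) h.mfderiv⟩

/-- The chain rule, and the reason why period covectors transform by `pullCovector`: a Hamiltonian
field depends only on the differential. -/
theorem differential_comb_comp {F : M → ℝ × ℝ} {G : ℝ × ℝ → ℝ × ℝ} {p : M}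
    (hF : MDifferentiableAt (𝓡 4) 𝓘(ℝ, ℝ × ℝ) F p) (hG : DifferentiableAt ℝ G (F p))
    (τ : ℝ × ℝ) :
    differential (comb τ (G ∘ F)) p = differential (comb (pullCovector (fderiv ℝ G (F p)) τ) F) p := by
  ext v
  obtain ⟨h1, h2⟩ := mfderiv_comp_apply_prod hF hG
  rw [differential_comb h1, differential_comb hF, h2]
  generalize (mfderiv (𝓡 4) 𝓘(ℝ, ℝ × ℝ) F p v : ℝ × ℝ) = y
  obtain ⟨a, b⟩ := y
  rw [fderiv_prod_apply _ a b]
  simp only [pullCovector, Prod.fst_add, Prod.snd_add, Prod.smul_fst, Prod.smul_snd, smul_eq_mul]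
  ring

theorem differential_congr {f g : M → ℝ} {p : M} (h : f =ᶠ[𝓝 p] g) :
    differential f p = differential g p := h.mfderiv_eq

omit [ChartedSpace E4 M] in
theorem comb_congr {F G : M → ℝ × ℝ} {p : M} (h : F =ᶠ[𝓝 p] G) (τ : ℝ × ℝ) :
    comb τ F =ᶠ[𝓝 p] comb τ G := by
  filter_upwards [h] with x hx
  simp only [comb, hx]

namespace IsSymplectic

variable {Ω₁ : SymplecticForm M₁} {Ω₂ : SymplecticForm M₂} {Φ : OpenPartialHomeomorph M₁ M₂}

theorem mdifferentiable (h : IsSymplectic Ω₁ Ω₂ Φ) : Φ.MDifferentiable (𝓡 4) (𝓡 4) :=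
  ⟨h.smooth.mdifferentiableOn (by simp), h.symm_smooth.mdifferentiableOn (by simp)⟩

theorem symm (h : IsSymplectic Ω₁ Ω₂ Φ) : IsSymplectic Ω₂ Ω₁ Φ.symm where
  smooth := h.symm_smooth
  symm_smooth := h.smooth
  symplectic p hp u v := by
    have h1 := h.symplectic (Φ.symm p) (Φ.map_target hp)
      (mfderiv (𝓡 4) (𝓡 4) Φ.symm p u) (mfderiv (𝓡 4) (𝓡 4) Φ.symm p v)
    rw [← h1]
    have h2 : ∀ w : TangentSpace (𝓡 4) p, (mfderiv (𝓡 4) (𝓡 4) Φ (Φ.symm p)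
        (mfderiv (𝓡 4) (𝓡 4) Φ.symm p w) : E4) = (w : E4) := fun w =>
      congrArg (fun A : E4 →L[ℝ] E4 => A w) (h.mdifferentiable.comp_symm_deriv hp)
    -- The tangent space type depends on the point, so the equality `Φ (Φ.symm p) = p` is applied
    -- through vectors of the common model `E4`.
    have h3 : ∀ (q : M₂), q = p → ∀ u' v' : E4,
        Ω₂.form q ![(u' : TangentSpace (𝓡 4) q), v'] =
          Ω₂.form p ![(u' : TangentSpace (𝓡 4) p), v'] := by
      rintro q rfl u' v'; rfl
    refine (h3 _ (Φ.right_inv hp) _ _).trans ?_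
    exact congrArg₂ (fun a b : E4 => Ω₂.form p ![(a : TangentSpace (𝓡 4) p), b]) (h2 u) (h2 v)

theorem refl [IsManifold (𝓡 4) ∞ M] (Ω : SymplecticForm M) :
    IsSymplectic Ω Ω (OpenPartialHomeomorph.refl M) where
  smooth := contMDiffOn_id
  symm_smooth := contMDiffOn_id
  symplectic p _ u v := by
    change Ω.form p ![mfderiv (𝓡 4) (𝓡 4) id p u, mfderiv (𝓡 4) (𝓡 4) id p v] = _
    rw [mfderiv_id]
    rfl

/-- Hamiltonian vector fields are natural under symplectomorphisms. -/
theorem map_hamVec (h : IsSymplectic Ω₁ Ω₂ Φ) {p : M₁} (hp : p ∈ Φ.source) {f₁ : M₁ → ℝ}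
    {f₂ : M₂ → ℝ}
    (hf : ∀ v : TangentSpace (𝓡 4) p,
      differential f₁ p v = differential f₂ (Φ p) (mfderiv (𝓡 4) (𝓡 4) Φ p v)) :
    mfderiv (𝓡 4) (𝓡 4) Φ p (Ω₁.hamVec f₁ p) = Ω₂.hamVec f₂ (Φ p) := by
  refine Ω₂.eq_of_form_eq fun w => ?_
  obtain ⟨v, rfl⟩ := h.mdifferentiable.mfderiv_surjective hp w
  rw [h.symplectic p hp, Ω₁.form_hamVec, Ω₂.form_hamVec, hf]

/-- Poisson brackets are natural under symplectomorphisms. -/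
theorem bracket_comp (h : IsSymplectic Ω₁ Ω₂ Φ) {p : M₁} (hp : p ∈ Φ.source) {f₁ g₁ : M₁ → ℝ}
    {f₂ g₂ : M₂ → ℝ}
    (hf : ∀ v : TangentSpace (𝓡 4) p,
      differential f₁ p v = differential f₂ (Φ p) (mfderiv (𝓡 4) (𝓡 4) Φ p v))
    (hg : ∀ v : TangentSpace (𝓡 4) p,
      differential g₁ p v = differential g₂ (Φ p) (mfderiv (𝓡 4) (𝓡 4) Φ p v)) :
    Ω₁.bracket f₁ g₁ p = Ω₂.bracket f₂ g₂ (Φ p) := by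
  rw [Ω₁.bracket_eq, Ω₂.bracket_eq, hf, h.map_hamVec hp hg]

theorem differential_comp (h : IsSymplectic Ω₁ Ω₂ Φ) {p : M₁} (hp : p ∈ Φ.source) {f : M₂ → ℝ}
    (hf : MDifferentiableAt (𝓡 4) 𝓘(ℝ, ℝ) f (Φ p)) (v : TangentSpace (𝓡 4) p) :
    differential (f ∘ Φ) p v = differential f (Φ p) (mfderiv (𝓡 4) (𝓡 4) Φ p v) := by
  have h1 := hf.hasMFDerivAt.comp p (h.mdifferentiable.mdifferentiableAt hp).hasMFDerivAt
  exact congrArg (fun A : TangentSpace (𝓡 4) p →L[ℝ] ℝ => A v) h1.mfderiv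

end IsSymplectic

namespace IntegrableSystem

variable (S : IntegrableSystem M)

theorem mdifferentiableAt (p : M) : MDifferentiableAt (𝓡 4) 𝓘(ℝ, ℝ × ℝ) S.F p :=
  S.smooth.mdifferentiable (by simp) p

/-- The moment map is constant along the Hamiltonian vector fields of functions of it. -/
theorem mfderiv_hamVec_eq_zero {p : M} {f : M → ℝ} {τ : ℝ × ℝ}
    (hf : differential f p = differential (comb τ S.F) p) :
    (mfderiv (𝓡 4) 𝓘(ℝ, ℝ × ℝ) S.F p (S.Ω.hamVec f p) : ℝ × ℝ) = 0 := by
  have hF := S.mdifferentiableAt p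
  have h12 := S.involution p
  have h21 := S.Ω.bracket_swap (fun x => (S.F x).2) (fun x => (S.F x).1) p
  rw [h12, neg_zero] at h21
  have h11 := S.Ω.bracket_self (fun x => (S.F x).1) p
  have h22 := S.Ω.bracket_self (fun x => (S.F x).2) p
  rw [S.Ω.bracket_eq, neg_eq_zero] at h12 h21 h11 h22
  rw [differential_fst hF] at h12 h11
  rw [differential_snd hF] at h21 h22
  -- Antisymmetry moves the derivative onto `f`, whose differential is a combination of those of the
  -- components of `F`.
  have key : ∀ g : M → ℝ, differential g p (S.Ω.hamVec f p) = -differential f p (S.Ω.hamVec g p) := by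
    intro g
    have h1 := S.Ω.bracket_swap g f p
    rw [S.Ω.bracket_eq, S.Ω.bracket_eq] at h1
    linarith
  have h1 := key fun x => (S.F x).1
  have h2 := key fun x => (S.F x).2
  rw [hf, differential_comb hF] at h1 h2
  rw [differential_fst hF, h11, h21] at h1
  rw [differential_snd hF, h12, h22] at h2
  refine Prod.ext ?_ ?_
  · exact h1.trans (by rw [mul_zero, mul_zero, add_zero, neg_zero]; rfl)
  · exact h2.trans (by rw [mul_zero, mul_zero, add_zero, neg_zero]; rfl)

end IntegrableSystem

end Naturality

/-! ### Period lattices under symplectomorphisms -/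

namespace FFNeighborhood

namespace EliassonIsomorphism

section One

variable {M : Type*} [TopologicalSpace M] [ChartedSpace E4 M] {S : FFNeighborhood M}
  (N : S.EliassonIsomorphism)

theorem mem_domain {p : M} : p ∈ N.domain ↔ S.F p ∈ N.g.source := by
  rw [N.g_source]; rfl

theorem c₀_mem : S.c₀ ∈ N.g.source := by
  rw [N.g_source]
  exact ⟨S.p₀, N.p₀_mem, S.F_p₀⟩

theorem zero_mem_g_target : (0 : ℝ × ℝ) ∈ N.g.target := by
  rw [← N.g_c₀]
  exact N.g.map_source N.c₀_mem

theorem g_symm_zero : N.g.symm 0 = S.c₀ := by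
  rw [← N.g_c₀, N.g.left_inv N.c₀_mem]

theorem differentiableAt_g {c : ℝ × ℝ} (hc : c ∈ N.g.source) : DifferentiableAt ℝ N.g c :=
  (N.g_smooth.contDiffAt (N.g.open_source.mem_nhds hc)).differentiableAt (by simp)

theorem differentiableAt_g_symm {w : ℝ × ℝ} (hw : w ∈ N.g.target) :
    DifferentiableAt ℝ N.g.symm w :=
  (N.g_symm_smooth.contDiffAt (N.g.open_target.mem_nhds hw)).differentiableAt (by simp)

theorem mdifferentiableAt_moment {p : M} (hp : p ∈ N.domain) :
    MDifferentiableAt (𝓡 4) 𝓘(ℝ, ℝ × ℝ) N.moment p :=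
  (mfderiv_comp_apply_prod (S.mdifferentiableAt p)
    (N.differentiableAt_g (N.mem_domain.1 hp))).1

theorem differential_comb_moment {p : M} (hp : p ∈ N.domain) (τ : ℝ × ℝ) :
    differential (comb τ N.moment) p =
      differential (comb (pullCovector (fderiv ℝ N.g (S.F p)) τ) S.F) p :=
  differential_comb_comp (S.mdifferentiableAt p) (N.differentiableAt_g (N.mem_domain.1 hp)) τ

/-- The moment map is constant along the integral curves defining the periods. -/
theorem F_eq_of_isMIntegralCurve {γ : ℝ → M} {τ : ℝ × ℝ}
    (hγ : IsMIntegralCurve (I := 𝓡 4) γ (S.Ω.hamVec (comb τ N.moment)))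
    (hd : ∀ t, γ t ∈ N.domain) (t : ℝ) : S.F (γ t) = S.F (γ 0) := by
  have h1 : ∀ t, HasDerivAt (fun t => S.F (γ t)) 0 t := by
    intro t
    have h2 := (S.mdifferentiableAt (γ t)).hasMFDerivAt.comp t (hγ t)
    have h4 := S.mfderiv_hamVec_eq_zero (N.differential_comb_moment (hd t) τ)
    have h3 : HasFDerivAt (fun t => S.F (γ t)) (0 : ℝ →L[ℝ] ℝ × ℝ) t := by
      refine h2.hasFDerivAt.congr_fderiv (ContinuousLinearMap.ext fun (r : ℝ) => ?_)
      exact (map_smul (mfderiv (𝓡 4) 𝓘(ℝ, ℝ × ℝ) S.F (γ t)) r _).trans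
        ((congrArg (fun u : ℝ × ℝ => r • u) h4).trans (smul_zero r))
    simpa using h3.hasDerivAt
  exact is_const_of_deriv_eq_zero (fun t => (h1 t).differentiableAt) (fun t => (h1 t).deriv) t 0

end One

section Two

variable {M₁ : Type*} [TopologicalSpace M₁] [ChartedSpace E4 M₁] {S₁ : FFNeighborhood M₁}
  {M₂ : Type*} [TopologicalSpace M₂] [ChartedSpace E4 M₂] {S₂ : FFNeighborhood M₂}

/-- The symplectomorphism maps a closed integral curve to a closed integral curve. Data on the fiber
over `w₁` suffice, because the curve never leaves that fiber. -/
theorem mem_periods_of_isSymplectic {Φ : OpenPartialHomeomorph M₁ M₂}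
    (hΦ : IsSymplectic S₁.Ω S₂.Ω Φ) (N₁ : S₁.EliassonIsomorphism) (N₂ : S₂.EliassonIsomorphism)
    {w₁ w₂ τ₁ τ₂ : ℝ × ℝ}
    (h : ∀ p ∈ N₁.domain, N₁.moment p = w₁ → p ∈ Φ.source ∧ Φ p ∈ N₂.domain ∧
      N₂.moment (Φ p) = w₂ ∧ ∀ v : TangentSpace (𝓡 4) p, differential (comb τ₁ N₁.moment) p v =
        differential (comb τ₂ N₂.moment) (Φ p) (mfderiv (𝓡 4) (𝓡 4) Φ p v))
    (hτ : τ₁ ∈ N₁.periods w₁) : τ₂ ∈ N₂.periods w₂ := by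
  obtain ⟨γ, hγ, hd, h0, hper⟩ := hτ
  have hw : ∀ t, N₁.moment (γ t) = w₁ := fun t => by
    rw [← h0]
    exact congrArg N₁.g (N₁.F_eq_of_isMIntegralCurve hγ hd t)
  have h' := fun t => h (γ t) (hd t) (hw t)
  refine ⟨Φ ∘ γ, fun t => ?_, fun t => (h' t).2.1, (h' 0).2.2.1, congrArg Φ hper⟩
  have h1 := (hΦ.mdifferentiable.mdifferentiableAt (h' t).1).hasMFDerivAt.comp t (hγ t)
  refine h1.congr_mfderiv ?_
  have h2 := hΦ.map_hamVec (h' t).1 (h' t).2.2.2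
  refine ContinuousLinearMap.ext fun (r : ℝ) => ?_
  exact (map_smul (mfderiv (𝓡 4) (𝓡 4) Φ (γ t)) r _).trans
    (congrArg (fun u : E4 => (r • u : E4)) h2)

end Two

section Same

variable {M : Type*} [TopologicalSpace M] [ChartedSpace E4 M] [IsManifold (𝓡 4) ∞ M]
  {S : FFNeighborhood M} (N N' : S.EliassonIsomorphism)

/-- The regularized actions of two normalized neighborhoods of the same system have the same
Taylor series orbit. -/
theorem taylorOrbit_eq {h h' : ℝ × ℝ → ℝ} (hN : N.IsRegularizedAction h)
    (hN' : N'.IsRegularizedAction h') : taylorOrbit h = taylorOrbit h' := by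
  obtain ⟨⟨W, hWo, hW0, -, hh, hper⟩, -, -⟩ := hN
  obtain ⟨⟨W', hWo', hW0', -, hh', hper'⟩, -, -⟩ := hN'
  -- The change of normalized base coordinates, with `N'.moment = E ∘ N.moment` where both are
  -- defined.
  set E : OpenPartialHomeomorph (ℝ × ℝ) (ℝ × ℝ) := N.g.symm.trans N'.g with hE
  have hEs : ∀ {w}, w ∈ E.source ↔ w ∈ N.g.target ∧ N.g.symm w ∈ N'.g.source := by
    intro w
    rw [hE, OpenPartialHomeomorph.trans_source]
    rfl
  have hE0 : (0 : ℝ × ℝ) ∈ E.source := hEs.2 ⟨N.zero_mem_g_target, by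
    rw [N.g_symm_zero]; exact N'.c₀_mem⟩
  have hEv : ∀ w, E w = N'.g (N.g.symm w) := fun w => rfl
  have hEz : E 0 = 0 := by rw [hEv, N.g_symm_zero, N'.g_c₀]
  have hEc : ContDiffOn ℝ ∞ E E.source := by
    have : ContDiffOn ℝ ∞ (N'.g ∘ N.g.symm) E.source := N'.g_smooth.comp
      (N.g_symm_smooth.mono fun w hw => (hEs.1 hw).1) fun w hw => (hEs.1 hw).2
    exact this
  have hEd : ∀ w ∈ E.source, DifferentiableAt ℝ E w := fun w hw =>
    (hEc.contDiffAt (E.open_source.mem_nhds hw)).differentiableAt (by simp)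
  have hEsd : DifferentiableAt ℝ E.symm 0 := by
    have h1 : DifferentiableAt ℝ N.g (N'.g.symm 0) := by
      rw [N'.g_symm_zero]
      exact N.differentiableAt_g N.c₀_mem
    exact h1.comp 0 (N'.differentiableAt_g_symm N'.zero_mem_g_target)
  have hinj : Function.Injective (fderiv ℝ E 0) := by
    have h1 : (E.symm ∘ E) =ᶠ[𝓝 0] id := by
      filter_upwards [E.open_source.mem_nhds hE0] with w hw using E.left_inv hw
    have h2 : HasFDerivAt (E.symm ∘ E) ((fderiv ℝ E.symm 0).comp (fderiv ℝ E 0)) 0 := by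
      refine HasFDerivAt.comp 0 ?_ (hEd 0 hE0).hasFDerivAt
      rw [hEz]
      exact hEsd.hasFDerivAt
    have h3 := h2.unique ((hasFDerivAt_id 0).congr_of_eventuallyEq h1)
    refine Function.LeftInverse.injective (g := fderiv ℝ E.symm 0) fun v => ?_
    exact congrArg (fun A : ℝ × ℝ →L[ℝ] ℝ × ℝ => A v) h3
  have hEt : Tendsto E (𝓝 0) (𝓝 0) := by
    have := (E.continuousAt hE0).tendsto
    rwa [hEz] at this
  refine taylorOrbit_eq_of_periodLattice (hWo.mem_nhds hW0) (hWo'.mem_nhds hW0')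
    (E.open_source.mem_nhds hE0) hh hh' hEc hEz hinj ?_
  filter_upwards [hWo.mem_nhds hW0, hEt (hWo'.mem_nhds hW0'), E.open_source.mem_nhds hE0]
    with w hw1 hw2 hw3 hw0 τ
  have hEw0 : E w ≠ 0 := fun h => hw0 (E.injOn hw3 hE0 (h.trans hEz.symm))
  have e1 : periodLattice h w = N.periods w := (hper w hw1 hw0).symm
  have e2 : periodLattice h' (E w) = N'.periods (E w) := (hper' (E w) hw2 hEw0).symm
  rw [e1, e2]
  -- On the common fiber the Hamiltonian of `τ` for `N'` and that of the pulled-back covector for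
  -- `N` have the same differential, so the same curves serve both period sets.
  have hpt : ∀ p, S.F p = N.g.symm w → p ∈ N.domain ∧ p ∈ N'.domain ∧ N.moment p = w ∧
      N'.moment p = E w ∧ differential (comb (pullCovector (fderiv ℝ E w) τ) N.moment) p =
        differential (comb τ N'.moment) p := by
    intro p hp
    have hd : p ∈ N.domain := N.mem_domain.2 (by rw [hp]; exact N.g.map_target (hEs.1 hw3).1)
    have hmw : N.moment p = w := by
      change N.g (S.F p) = w
      rw [hp, N.g.right_inv (hEs.1 hw3).1]
    refine ⟨hd, N'.mem_domain.2 (by rw [hp]; exact (hEs.1 hw3).2), hmw, ?_, ?_⟩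
    · change N'.g (S.F p) = _
      rw [hp, hEv]
    · have hev : N'.moment =ᶠ[𝓝 p] E ∘ N.moment := by
        have hc : ContinuousAt S.F p := (S.mdifferentiableAt p).continuousAt
        filter_upwards [hc (N.g.open_source.mem_nhds (N.mem_domain.1 hd))] with y hy
        change N'.g (S.F y) = N'.g (N.g.symm (N.g (S.F y)))
        rw [N.g.left_inv hy]
      rw [differential_congr (comb_congr hev τ),
        differential_comb_comp (N.mdifferentiableAt_moment hd) (by rw [hmw]; exact hEd w hw3), hmw]
  have hid : ∀ (p : M) (v : TangentSpace (𝓡 4) p),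
      mfderiv (𝓡 4) (𝓡 4) (OpenPartialHomeomorph.refl M) p v = v := fun p v => by
    change mfderiv (𝓡 4) (𝓡 4) id p v = v
    rw [mfderiv_id]
    rfl
  constructor
  · refine mem_periods_of_isSymplectic (IsSymplectic.refl S.Ω) N N' fun p hp hpw => ?_
    have hF : S.F p = N.g.symm w := by
      rw [← hpw]
      exact (N.g.left_inv (N.mem_domain.1 hp)).symm
    obtain ⟨-, h2, -, h4, h5⟩ := hpt p hF
    refine ⟨trivial, h2, h4, fun v => ?_⟩
    rw [hid, h5]
    rfl
  · refine mem_periods_of_isSymplectic (IsSymplectic.refl S.Ω) N' N fun p hp hpw => ?_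
    have hF : S.F p = N.g.symm w := by
      have h1 : N'.g (S.F p) = N'.g (N.g.symm w) := hpw
      exact N'.g.injOn (N'.mem_domain.1 hp) (hEs.1 hw3).2 h1
    obtain ⟨h1, -, h3, -, h5⟩ := hpt p hF
    refine ⟨trivial, h1, h3, fun v => ?_⟩
    rw [hid, ← h5]
    rfl

end Same

end EliassonIsomorphism

end FFNeighborhood

/-! ### Inverse functions and submersions -/

section Calculus

variable {E F : Type*} [NormedAddCommGroup E] [NormedSpace ℝ E] [FiniteDimensional ℝ E]
  [NormedAddCommGroup F] [NormedSpace ℝ F]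

/-- The inverse function theorem, for smooth functions on a neighborhood. -/
theorem exists_openPartialHomeomorph {f : E → F} {U : Set E} (hU : IsOpen U)
    (hf : ContDiffOn ℝ ∞ f U) {x : E} (hx : x ∈ U) (hb : Function.Bijective (fderiv ℝ f x)) :
    ∃ e : OpenPartialHomeomorph E F, x ∈ e.source ∧ e.source ⊆ U ∧ (e : E → F) = f ∧
      ContDiffOn ℝ ∞ e.symm e.target := by
  have : CompleteSpace E := FiniteDimensional.complete ℝ E
  have hfx : ContDiffAt ℝ ∞ f x := hf.contDiffAt (hU.mem_nhds hx)
  let A : E ≃L[ℝ] F := (LinearEquiv.ofBijective (fderiv ℝ f x : E →ₗ[ℝ] F) hb).toContinuousLinearEquiv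
  have hA : (A : E →L[ℝ] F) = fderiv ℝ f x := by ext v; rfl
  have hfA : HasFDerivAt f (A : E →L[ℝ] F) x := by
    rw [hA]
    exact (hfx.differentiableAt (by simp)).hasFDerivAt
  have hcont : ContinuousOn (fderiv ℝ f) U :=
    hf.continuousOn_fderiv_of_isOpen hU (by exact_mod_cast le_top)
  -- Restricting to points with invertible derivative makes the inverse smooth on its whole domain,
  -- not just at one point.
  set V : Set E := U ∩ fderiv ℝ f ⁻¹' Set.range ((↑) : (E ≃L[ℝ] F) → E →L[ℝ] F) with hV
  have hVo : IsOpen V := hcont.isOpen_inter_preimage hU ContinuousLinearEquiv.isOpen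
  have hxV : x ∈ V := ⟨hx, A, hA⟩
  let e := (hfx.toOpenPartialHomeomorph f hfA (by simp)).restrOpen V hVo
  refine ⟨e, ⟨hfx.mem_toOpenPartialHomeomorph_source hfA (by simp), hxV⟩, fun y hy => hy.2.1, rfl,
    fun c hc => ContDiffAt.contDiffWithinAt ?_⟩
  obtain ⟨-, hy, B, hB⟩ := e.map_target hc
  have hd : ContDiffAt ℝ ∞ f (e.symm c) := hf.contDiffAt (hU.mem_nhds hy)
  refine e.contDiffAt_symm hc (f₀' := B) ?_ hd
  rw [hB]
  exact (hd.differentiableAt (by simp)).hasFDerivAt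

/-- If `f` is a submersion at `x` and the derivative of `k` vanishes on the kernel of the derivative
of `f`, then `k` is locally a smooth function of `f`. -/
theorem exists_factorization {G : Type*} [NormedAddCommGroup G] [NormedSpace ℝ G] {f : E → F}
    {k : E → G} {U : Set E} (hU : IsOpen U) (hf : ContDiffOn ℝ ∞ f U) (hk : ContDiffOn ℝ ∞ k U)
    {x : E} (hx : x ∈ U) (hsurj : Function.Surjective (fderiv ℝ f x))
    (hker : ∀ y ∈ U, ∀ v, fderiv ℝ f y v = 0 → fderiv ℝ k y v = 0) :
    ∃ (B : Set F) (g : F → G), IsOpen B ∧ f x ∈ B ∧ ContDiffOn ℝ ∞ g B ∧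
      ∀ᶠ y in 𝓝 x, f y ∈ B ∧ k y = g (f y) := by
  set A := fderiv ℝ f x with hAdef
  set K : Submodule ℝ E := A.toLinearMap.ker with hKdef
  -- A linear projection onto the kernel of the derivative: the map `y ↦ (f y, P y)` straightens `f`
  -- into a coordinate projection.
  obtain ⟨P₀, hP₀⟩ := K.subtype.exists_leftInverse_of_injective (Submodule.ker_subtype K)
  let P : E →L[ℝ] K := LinearMap.toContinuousLinearMap P₀
  have hP : ∀ v : K, P v = v := fun v => LinearMap.congr_fun hP₀ v
  have hfd : ∀ y ∈ U, DifferentiableAt ℝ f y := fun y hy =>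
    (hf.contDiffAt (hU.mem_nhds hy)).differentiableAt (by simp)
  have hkd : ∀ y ∈ U, DifferentiableAt ℝ k y := fun y hy =>
    (hk.contDiffAt (hU.mem_nhds hy)).differentiableAt (by simp)
  have hΨd : fderiv ℝ (fun y => (f y, P y)) x = A.prod P :=
    ((hfd x hx).hasFDerivAt.prodMk P.hasFDerivAt).fderiv
  obtain ⟨e, hxe, heU, hecoe, hesymm⟩ := exists_openPartialHomeomorph (f := fun y => (f y, P y)) hU
    (hf.prodMk P.contDiff.contDiffOn) hx (by
      rw [hΨd]
      constructor
      · rw [injective_iff_map_eq_zero]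
        intro v hv
        have h1 : A v = 0 := congrArg Prod.fst hv
        have h2 : P v = 0 := congrArg Prod.snd hv
        have h3 := hP ⟨v, h1⟩
        rw [h2] at h3
        exact congrArg Subtype.val h3.symm
      · rintro ⟨c, s⟩
        obtain ⟨v, hv⟩ := hsurj c
        refine ⟨v + ((s - P v : K) : E), Prod.ext ?_ ?_⟩
        · have : A ((s - P v : K) : E) = 0 := (s - P v).2
          change A (v + ((s - P v : K) : E)) = c
          rw [map_add, this, hv, add_zero]
        · change P (v + ((s - P v : K) : E)) = s
          rw [map_add, hP]
          abel)
  have he : ∀ y, e y = (f y, P y) := fun y => congrFun hecoe y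
  have hxt : (f x, P x) ∈ e.target := by
    rw [← he]
    exact e.map_source hxe
  -- In a product of balls the slices of fixed first coordinate are convex, hence connected.
  obtain ⟨r, hr, hball⟩ := Metric.isOpen_iff.1 e.open_target _ hxt
  rw [← ball_prod_same] at hball
  have hcomp : ∀ z ∈ Metric.ball (f x) r ×ˢ Metric.ball (P x) r, f (e.symm z) = z.1 := fun z hz => by
    have := e.right_inv (hball hz)
    rw [he] at this
    exact congrArg Prod.fst this
  have hesd : ∀ z ∈ Metric.ball (f x) r ×ˢ Metric.ball (P x) r, DifferentiableAt ℝ e.symm z :=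
    fun z hz => (hesymm.contDiffAt (e.open_target.mem_nhds (hball hz))).differentiableAt (by simp)
  -- Along a slice `f` is constant, so the slice directions lie in the kernel of its derivative and
  -- `k` has zero derivative there.
  have hconst : ∀ c ∈ Metric.ball (f x) r, ∀ s ∈ Metric.ball (P x) r,
      k (e.symm (c, s)) = k (e.symm (c, P x)) := by
    intro c hc s hs
    have hd : ∀ s ∈ Metric.ball (P x) r, HasFDerivAt (fun s => k (e.symm (c, s)))
        (0 : K →L[ℝ] G) s := by
      intro s hs
      have hz : (c, s) ∈ Metric.ball (f x) r ×ˢ Metric.ball (P x) r := ⟨hc, hs⟩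
      have hyU : e.symm (c, s) ∈ U := heU (e.map_target (hball hz))
      have h0 : HasFDerivAt (fun s : K => (c, s)) (ContinuousLinearMap.inr ℝ F K) s :=
        hasFDerivAt_prodMk_right c s
      have h1 := (hesd _ hz).hasFDerivAt.comp s h0
      have h2 := (hkd _ hyU).hasFDerivAt.comp s h1
      have h3 := (hfd _ hyU).hasFDerivAt.comp s h1
      have h4 : (f ∘ e.symm ∘ fun s : K => (c, s)) =ᶠ[𝓝 s] fun _ => c := by
        filter_upwards [Metric.isOpen_ball.mem_nhds hs] with s' hs'
        exact hcomp (c, s') ⟨hc, hs'⟩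
      have h5 := h3.unique ((hasFDerivAt_const c s).congr_of_eventuallyEq h4)
      refine h2.congr_fderiv (ContinuousLinearMap.ext fun σ => ?_)
      exact hker _ hyU _ (congrArg (fun T : K →L[ℝ] F => T σ) h5)
    refine Metric.isOpen_ball.is_const_of_fderiv_eq_zero (𝕜 := ℝ)
      (convex_ball (P x) r).isPreconnected
      (fun s hs => (hd s hs).differentiableAt.differentiableWithinAt) (fun s hs => (hd s hs).fderiv)
      hs (Metric.mem_ball_self hr)
  refine ⟨Metric.ball (f x) r, fun c => k (e.symm (c, P x)), Metric.isOpen_ball,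
    Metric.mem_ball_self hr, ?_, ?_⟩
  · refine hk.comp (t := U) (hesymm.comp (t := e.target) (contDiff_id.prodMk contDiff_const).contDiffOn
      fun c hc => hball ⟨hc, Metric.mem_ball_self hr⟩) fun c hc => ?_
    exact heU (e.map_target (hball ⟨hc, Metric.mem_ball_self hr⟩))
  · have hc : ContinuousAt (fun y => (f y, P y)) x :=
      (hfd x hx).continuousAt.prodMk P.continuous.continuousAt
    filter_upwards [hc (prod_mem_nhds (Metric.ball_mem_nhds _ hr) (Metric.ball_mem_nhds _ hr)),
      e.open_source.mem_nhds hxe] with y hy hye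
    refine ⟨hy.1, ?_⟩
    have h1 := hconst _ hy.1 _ hy.2
    have h2 := e.left_inv hye
    rw [he] at h2
    rw [h2] at h1
    exact h1

omit [FiniteDimensional ℝ E] in
/-- The second derivative of a composition. -/
theorem fderiv_fderiv_comp {g : F → ℝ} {f : E → F} {x : E} (hf : ContDiffAt ℝ ∞ f x)
    (hg : ContDiffAt ℝ ∞ g (f x)) (u v : E) :
    fderiv ℝ (fderiv ℝ (g ∘ f)) x u v =
      fderiv ℝ (fderiv ℝ g) (f x) (fderiv ℝ f x u) (fderiv ℝ f x v) +
        fderiv ℝ g (f x) (fderiv ℝ (fderiv ℝ f) x u v) := by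
  have hf1 : ∀ᶠ y in 𝓝 x, DifferentiableAt ℝ f y := by
    filter_upwards [(hf.of_le (by exact_mod_cast le_top : ((1 : ℕ) : WithTop ℕ∞) ≤ ∞)).eventually
      (by simp)] with y hy
    exact hy.differentiableAt (by simp)
  have hg1 : ∀ᶠ y in 𝓝 (f x), DifferentiableAt ℝ g y := by
    filter_upwards [(hg.of_le (by exact_mod_cast le_top : ((1 : ℕ) : WithTop ℕ∞) ≤ ∞)).eventually
      (by simp)] with y hy
    exact hy.differentiableAt (by simp)
  have hev : fderiv ℝ (g ∘ f) =ᶠ[𝓝 x] fun y => (fderiv ℝ g (f y)).comp (fderiv ℝ f y) := by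
    filter_upwards [hf1, hf.continuousAt.eventually hg1] with y h1 h2
    exact fderiv_comp y h2 h1
  have hf2 : DifferentiableAt ℝ (fderiv ℝ f) x :=
    (hf.fderiv_right (m := ∞) (by simp)).differentiableAt (by simp)
  have hg2 : DifferentiableAt ℝ (fderiv ℝ g) (f x) :=
    (hg.fderiv_right (m := ∞) (by simp)).differentiableAt (by simp)
  have h1 := hg2.hasFDerivAt.comp x (hf.differentiableAt (by simp)).hasFDerivAt
  have h2 := h1.clm_comp hf2.hasFDerivAt
  rw [hev.fderiv_eq]
  refine (congrArg (fun T : E →L[ℝ] E →L[ℝ] ℝ => T u v) h2.fderiv).trans ?_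
  simp [add_comm]

end Calculus

/-! ### Functions commuting with an integrable system -/

section Chart

variable {M : Type*} [TopologicalSpace M] [ChartedSpace E4 M] [IsManifold (𝓡 4) ∞ M]
  {G : Type*} [NormedAddCommGroup G] [NormedSpace ℝ G]

theorem mdifferentiable_chartAt (x : M) :
    (chartAt E4 x).MDifferentiable (𝓡 4) (𝓡 4) :=
  have : IsManifold (𝓡 4) 1 M := IsManifold.of_le (n := ∞) (by exact_mod_cast le_top)
  mdifferentiable_chart x

theorem fderiv_comp_chart_symm {f : M → G} {x : M} {y : E4} (hy : y ∈ (chartAt E4 x).target)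
    (hf : MDifferentiableAt (𝓡 4) 𝓘(ℝ, G) f ((chartAt E4 x).symm y)) (v : E4) :
    fderiv ℝ (f ∘ (chartAt E4 x).symm) y v = (mfderiv (𝓡 4) 𝓘(ℝ, G) f ((chartAt E4 x).symm y)
      (mfderiv (𝓡 4) (𝓡 4) (chartAt E4 x).symm y v) : G) := by
  have h1 := hf.hasMFDerivAt.comp y
    ((mdifferentiable_chartAt x).mdifferentiableAt_symm hy).hasMFDerivAt
  have h2 : HasFDerivAt (f ∘ (chartAt E4 x).symm)
    (ContinuousLinearMap.comp (M₂ := E4) (mfderiv (𝓡 4) 𝓘(ℝ, G) f ((chartAt E4 x).symm y))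
      (mfderiv (𝓡 4) (𝓡 4) (chartAt E4 x).symm y) : E4 →L[ℝ] G) y := h1.hasFDerivAt
  rw [h2.fderiv]
  rfl

theorem surjective_fderiv_comp_chart_symm_iff {f : M → G} {x : M} {y : E4}
    (hy : y ∈ (chartAt E4 x).target)
    (hf : MDifferentiableAt (𝓡 4) 𝓘(ℝ, G) f ((chartAt E4 x).symm y)) :
    Function.Surjective (fderiv ℝ (f ∘ (chartAt E4 x).symm) y) ↔
      Function.Surjective (mfderiv (𝓡 4) 𝓘(ℝ, G) f ((chartAt E4 x).symm y)) := by
  have hb := (mdifferentiable_chartAt x).symm.mfderiv_bijective hy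
  have h1 := fderiv_comp_chart_symm hy hf
  constructor
  · intro h c
    obtain ⟨v, hv⟩ := h c
    exact ⟨_, (h1 v).symm.trans hv⟩
  · intro h c
    obtain ⟨u, hu⟩ := h c
    obtain ⟨v, rfl⟩ := hb.2 u
    exact ⟨v, (h1 v).trans hu⟩

/-- With `A ∘ R = 1`, the endomorphism `B ∘ R` stays invertible for `B` near `A`, which gives `B` a
right inverse. -/
theorem isOpen_setOf_surjective {E F : Type*} [NormedAddCommGroup E] [NormedSpace ℝ E]
    [NormedAddCommGroup F] [NormedSpace ℝ F] [FiniteDimensional ℝ F] :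
    IsOpen {A : E →L[ℝ] F | Function.Surjective A} := by
  rw [isOpen_iff_mem_nhds]
  intro A hA
  obtain ⟨R, hR⟩ := ContinuousLinearMap.exists_rightInverse_of_surjective A
    (LinearMap.range_eq_top.2 hA)
  have hc : Continuous fun B : E →L[ℝ] F => B.comp R := by fun_prop
  have h1 : {C : F →L[ℝ] F | IsUnit C} ∈ 𝓝 (A.comp R) := by
    rw [hR]
    exact Units.isOpen.mem_nhds isUnit_one
  filter_upwards [hc.continuousAt h1] with B hB
  obtain ⟨u, hu⟩ := hB
  intro y
  refine ⟨R ((↑u⁻¹ : F →L[ℝ] F) y), ?_⟩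
  have h2 : (B.comp R) * (↑u⁻¹ : F →L[ℝ] F) = 1 :=
    (congrArg (· * (↑u⁻¹ : F →L[ℝ] F)) hu.symm).trans u.mul_inv
  exact congrArg (fun C : F →L[ℝ] F => C y) h2

theorem contDiffOn_comp_chart_symm {f : M → G} {O : Set M}
    (hf : ContMDiffOn (𝓡 4) 𝓘(ℝ, G) ∞ f O) (x : M) :
    ContDiffOn ℝ ∞ (f ∘ (chartAt E4 x).symm)
      ((chartAt E4 x).target ∩ (chartAt E4 x).symm ⁻¹' O) := by
  rw [← contMDiffOn_iff_contDiffOn]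
  exact hf.comp (contMDiffOn_chart_symm.mono Set.inter_subset_left) fun y hy => hy.2

end Chart

namespace IntegrableSystem

variable {M : Type*} [TopologicalSpace M] [ChartedSpace E4 M] (S : IntegrableSystem M)

/-- At a regular point the tangent space of the fiber is spanned by the Hamiltonian vector
fields. -/
theorem exists_eq_hamVec {p : M} (hp : ¬ IsSingular S.F p) {v : TangentSpace (𝓡 4) p}
    (hv : (mfderiv (𝓡 4) 𝓘(ℝ, ℝ × ℝ) S.F p v : ℝ × ℝ) = 0) :
    ∃ a b : ℝ, v = a • S.Ω.hamVec (comb (1, 0) S.F) p + b • S.Ω.hamVec (comb (0, 1) S.F) p := by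
  have hsurj : Function.Surjective (mfderiv (𝓡 4) 𝓘(ℝ, ℝ × ℝ) S.F p) := not_not.1 hp
  have : FiniteDimensional ℝ (TangentSpace (𝓡 4) p) := inferInstanceAs (FiniteDimensional ℝ E4)
  let A : TangentSpace (𝓡 4) p →ₗ[ℝ] ℝ × ℝ := (mfderiv (𝓡 4) 𝓘(ℝ, ℝ × ℝ) S.F p).toLinearMap
  have hA : Function.Surjective A := hsurj
  have hX : ∀ τ : ℝ × ℝ, S.Ω.hamVec (comb τ S.F) p ∈ LinearMap.ker A := fun τ =>
    S.mfderiv_hamVec_eq_zero rfl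
  have hrank : Module.finrank ℝ (LinearMap.ker A) = 2 := by
    have h1 := A.finrank_range_add_finrank_ker
    rw [LinearMap.range_eq_top.2 hA, finrank_top] at h1
    have h2 : Module.finrank ℝ (TangentSpace (𝓡 4) p) = 4 := finrank_euclideanSpace_fin
    have h3 : Module.finrank ℝ (ℝ × ℝ) = 2 := by simp
    omega
  let b : Fin 2 → LinearMap.ker A := ![⟨_, hX (1, 0)⟩, ⟨_, hX (0, 1)⟩]
  have hb : LinearIndependent ℝ b := by
    rw [LinearIndependent.pair_iff]
    intro s t hst
    have h1 : s • S.Ω.hamVec (comb (1, 0) S.F) p + t • S.Ω.hamVec (comb (0, 1) S.F) p = 0 :=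
      congrArg Subtype.val hst
    -- Pairing the relation with `u` under the symplectic form turns it into a relation between the
    -- differentials, which are independent as `A` is onto.
    have h2 : ∀ u : TangentSpace (𝓡 4) p, s * (A u).1 + t * (A u).2 = 0 := by
      intro u
      have h3 := congrArg (fun w => S.Ω.flat p w u) h1
      simp only [map_add, map_smul, map_zero, LinearMap.add_apply, LinearMap.smul_apply,
        LinearMap.zero_apply, SymplecticForm.flat_apply, S.Ω.form_hamVec,
        differential_comb (S.mdifferentiableAt p)] at h3
      simp only [smul_eq_mul, one_mul, zero_mul, add_zero, zero_add, mul_neg] at h3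
      change -(s * (A u).1) + -(t * (A u).2) = 0 at h3
      linarith
    obtain ⟨u, hu⟩ := hA (1, 0)
    obtain ⟨u', hu'⟩ := hA (0, 1)
    have h4 := h2 u
    have h5 := h2 u'
    rw [hu] at h4
    rw [hu'] at h5
    exact ⟨by simpa using h4, by simpa using h5⟩
  have hspan := hb.span_eq_top_of_card_eq_finrank (by rw [hrank]; rfl)
  have hvm : (⟨v, hv⟩ : LinearMap.ker A) ∈ Submodule.span ℝ (Set.range b) := by
    rw [hspan]; trivial
  rw [Matrix.range_cons, Matrix.range_cons, Matrix.range_empty, Set.union_empty,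
    Set.singleton_union, Submodule.mem_span_pair] at hvm
  obtain ⟨s, t, hst⟩ := hvm
  exact ⟨s, t, (congrArg Subtype.val hst).symm⟩

variable [IsManifold (𝓡 4) ∞ M]

/-- The factorization through a submersion, read in a chart. The last conclusion, openness of the
moment map at `p`, is what later lets nearby fibers be reached from a neighborhood of `p`. -/
theorem exists_local_factorization {p : M} (hp : ¬ IsSingular S.F p) {k : M → ℝ × ℝ} {O : Set M}
    (hO : IsOpen O) (hpO : p ∈ O) (hk : ContMDiffOn (𝓡 4) 𝓘(ℝ, ℝ × ℝ) ∞ k O)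
    (hker : ∀ y ∈ O, ¬ IsSingular S.F y → ∀ v : TangentSpace (𝓡 4) y,
      (mfderiv (𝓡 4) 𝓘(ℝ, ℝ × ℝ) S.F y v : ℝ × ℝ) = 0 →
      (mfderiv (𝓡 4) 𝓘(ℝ, ℝ × ℝ) k y v : ℝ × ℝ) = 0) :
    ∃ (B : Set (ℝ × ℝ)) (g : ℝ × ℝ → ℝ × ℝ), IsOpen B ∧ S.F p ∈ B ∧ ContDiffOn ℝ ∞ g B ∧
      (∀ᶠ y in 𝓝 p, S.F y ∈ B ∧ k y = g (S.F y)) ∧ map S.F (𝓝 p) = 𝓝 (S.F p) := by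
  set e := chartAt E4 p with he
  have hpe : p ∈ e.source := mem_chart_source E4 p
  set U : Set E4 := e.target ∩ e.symm ⁻¹' O with hU
  have hUo : IsOpen U := e.isOpen_inter_preimage_symm hO
  have hf : ContDiffOn ℝ ∞ (S.F ∘ e.symm) U :=
    (contDiffOn_comp_chart_symm (O := Set.univ) S.smooth.contMDiffOn p).mono fun y hy =>
      ⟨hy.1, trivial⟩
  have hk' : ContDiffOn ℝ ∞ (k ∘ e.symm) U := contDiffOn_comp_chart_symm hk p
  have hpU : e p ∈ U := ⟨e.map_source hpe, by
    rw [Set.mem_preimage, e.left_inv hpe]; exact hpO⟩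
  have hreg : ∀ y ∈ e.target, Function.Surjective (fderiv ℝ (S.F ∘ e.symm) y) ↔
      ¬ IsSingular S.F (e.symm y) := fun y hy => by
    rw [IsSingular, not_not]
    exact surjective_fderiv_comp_chart_symm_iff hy (S.mdifferentiableAt _)
  have hsurj := (hreg _ hpU.1).2 (by rwa [e.left_inv hpe])
  have hstrict : HasStrictFDerivAt (S.F ∘ e.symm) (fderiv ℝ (S.F ∘ e.symm) (e p)) (e p) :=
    (hf.contDiffAt (hUo.mem_nhds hpU)).hasStrictFDerivAt (by simp)
  have hmap := hstrict.map_nhds_eq_of_surj (LinearMap.range_eq_top.2 hsurj)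
  have hFp : (S.F ∘ e.symm) (e p) = S.F p := congrArg S.F (e.left_inv hpe)
  have hopen : ∀ᶠ y in 𝓝 (e p), Function.Surjective (fderiv ℝ (S.F ∘ e.symm) y) := by
    have hc : ContinuousAt (fderiv ℝ (S.F ∘ e.symm)) (e p) :=
      (hf.continuousOn_fderiv_of_isOpen hUo (by exact_mod_cast le_top)).continuousAt
        (hUo.mem_nhds hpU)
    have hset : {A : E4 →L[ℝ] ℝ × ℝ | Function.Surjective A} ∈
        𝓝 (fderiv ℝ (S.F ∘ e.symm) (e p)) :=
      isOpen_setOf_surjective.mem_nhds hsurj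
    exact hc hset
  -- The kernel condition is available only at regular points, so the chart domain is shrunk to
  -- where the differential stays onto.
  obtain ⟨U', hU'sub, hU'o, hpU'⟩ := mem_nhds_iff.1 (inter_mem (hUo.mem_nhds hpU) hopen)
  obtain ⟨B, g, hB, hpB, hg, hev⟩ := exists_factorization (k := k ∘ e.symm) hU'o
    (hf.mono fun y hy => (hU'sub hy).1) (hk'.mono fun y hy => (hU'sub hy).1) hpU' hsurj (by
      intro y hy v hv
      obtain ⟨⟨hyt, hyO⟩, hys⟩ := hU'sub hy
      have hkd : MDifferentiableAt (𝓡 4) 𝓘(ℝ, ℝ × ℝ) k (e.symm y) :=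
        (hk.contMDiffAt (hO.mem_nhds hyO)).mdifferentiableAt (by simp)
      rw [Set.mem_ofPred_eq, hreg y hyt] at hys
      rw [fderiv_comp_chart_symm hyt hkd]
      rw [fderiv_comp_chart_symm hyt (S.mdifferentiableAt _)] at hv
      exact hker _ hyO hys _ hv)
  have hcont : ContinuousAt e p := e.continuousAt hpe
  refine ⟨B, g, hB, by rwa [hFp] at hpB, hg, ?_, ?_⟩
  · filter_upwards [hcont.eventually hev, e.open_source.mem_nhds hpe] with y hy hye
    simpa only [Function.comp_apply, e.left_inv hye] using hy
  · rw [hFp] at hmap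
    have h1 := e.symm.map_nhds_eq (e.map_source hpe)
    rw [e.left_inv hpe] at h1
    rw [← hmap, ← Filter.map_map, h1]

omit [IsManifold (𝓡 4) ∞ M] in
/-- The fibers of an integrable system have empty interior. -/
theorem frequently_ne (x : M) (c : ℝ × ℝ) : ∃ᶠ y in 𝓝 x, S.F y ≠ c := by
  intro hnot
  simp only [not_not] at hnot
  set e := chartAt E4 x with he
  have hxe : x ∈ e.source := mem_chart_source E4 x
  obtain ⟨O, hO, hOo, hxO⟩ := eventually_nhds_iff.1 hnot
  have hsing : ∀ y ∈ O, IsSingular S.F y := by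
    intro y hy
    have hev : S.F =ᶠ[𝓝 y] fun _ => c := by
      filter_upwards [hOo.mem_nhds hy] with z hz using hO z hz
    have h0 : mfderiv (𝓡 4) 𝓘(ℝ, ℝ × ℝ) S.F y = 0 := by
      rw [hev.mfderiv_eq]
      exact mfderiv_const
    intro hs
    obtain ⟨v, hv⟩ := hs ((1 : ℝ), (0 : ℝ))
    rw [h0] at hv
    have : (0 : ℝ × ℝ) = (1, 0) := hv
    simp [Prod.ext_iff] at this
  -- A moment map constant on an open set would have a singular set of positive measure.
  have hopen : IsOpen (e '' (e.source ∩ O)) :=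
    e.isOpen_image_of_subset_source (e.open_source.inter hOo) Set.inter_subset_left
  have hpos := hopen.measure_pos MeasureTheory.volume ⟨e x, x, ⟨hxe, hxO⟩, rfl⟩
  refine hpos.ne' (MeasureTheory.measure_mono_null (Set.image_mono ?_) (S.independent x))
  exact fun y hy => ⟨hy.1, hsing y hy.2⟩

end IntegrableSystem

/-! ### Symplectomorphisms mapping fibers to fibers -/

section Comb

variable {M : Type*} [TopologicalSpace M] [ChartedSpace E4 M]

theorem contMDiffOn_comb {F : M → ℝ × ℝ} {O : Set M} (hF : ContMDiffOn (𝓡 4) 𝓘(ℝ, ℝ × ℝ) ∞ F O)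
    (τ : ℝ × ℝ) : ContMDiffOn (𝓡 4) 𝓘(ℝ, ℝ) ∞ (comb τ F) O := by
  have h : ContDiff ℝ ∞ fun c : ℝ × ℝ => τ.1 * c.1 + τ.2 * c.2 := by fun_prop
  exact h.contMDiff.comp_contMDiffOn hF

omit [TopologicalSpace M] [ChartedSpace E4 M] in
theorem comb_one_zero (F : M → ℝ × ℝ) : comb (1, 0) F = fun x => (F x).1 := by
  funext x; simp [comb]

omit [TopologicalSpace M] [ChartedSpace E4 M] in
theorem comb_zero_one (F : M → ℝ × ℝ) : comb (0, 1) F = fun x => (F x).2 := by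
  funext x; simp [comb]

theorem SymplecticForm.bracket_comb (Ω : SymplecticForm M) {F : M → ℝ × ℝ} {p : M}
    (hF : MDifferentiableAt (𝓡 4) 𝓘(ℝ, ℝ × ℝ) F p) (τ : ℝ × ℝ) (f : M → ℝ) :
    Ω.bracket (comb τ F) f p =
      τ.1 * Ω.bracket (fun x => (F x).1) f p + τ.2 * Ω.bracket (fun x => (F x).2) f p := by
  simp only [Ω.bracket_eq, differential_comb hF, differential_fst hF, differential_snd hF]
  ring

theorem IntegrableSystem.bracket_comb_comb (S : IntegrableSystem M) (p : M) (τ τ' : ℝ × ℝ) :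
    S.Ω.bracket (comb τ S.F) (comb τ' S.F) p = 0 := by
  rw [S.Ω.bracket_eq, differential_comb (S.mdifferentiableAt p), S.mfderiv_hamVec_eq_zero rfl]
  change -(τ.1 * (0 : ℝ) + τ.2 * (0 : ℝ)) = 0
  ring

end Comb

/-- A symplectomorphism between saturated neighborhoods of the focus-focus fibers, such that the
components of `F_1` and `F_2 ∘ Φ` are in involution. -/
structure FiberIsomorphism {M₁ M₂ : Type*} [TopologicalSpace M₁] [ChartedSpace E4 M₁]
    [TopologicalSpace M₂] [ChartedSpace E4 M₂]
    (S₁ : FFNeighborhood M₁) (S₂ : FFNeighborhood M₂) where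
  W₁ : Set (ℝ × ℝ)
  W₂ : Set (ℝ × ℝ)
  Φ : OpenPartialHomeomorph M₁ M₂
  isOpen_left : IsOpen W₁
  isOpen_right : IsOpen W₂
  c₀_mem_left : S₁.c₀ ∈ W₁
  c₀_mem_right : S₂.c₀ ∈ W₂
  source_eq : Φ.source = S₁.F ⁻¹' W₁
  target_eq : Φ.target = S₂.F ⁻¹' W₂
  isSymplectic : IsSymplectic S₁.Ω S₂.Ω Φ
  involution : ∀ p ∈ Φ.source, ∀ τ τ' : ℝ × ℝ,
    S₁.Ω.bracket (comb τ S₁.F) (comb τ' S₂.F ∘ Φ) p = 0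

namespace FiberIsomorphism

variable {M₁ M₂ : Type*} [TopologicalSpace M₁] [ChartedSpace E4 M₁]
  [TopologicalSpace M₂] [ChartedSpace E4 M₂] {S₁ : FFNeighborhood M₁} {S₂ : FFNeighborhood M₂}

/-- The inverse of a fiber isomorphism. -/
def symm (I : FiberIsomorphism S₁ S₂) : FiberIsomorphism S₂ S₁ where
  W₁ := I.W₂
  W₂ := I.W₁
  Φ := I.Φ.symm
  isOpen_left := I.isOpen_right
  isOpen_right := I.isOpen_left
  c₀_mem_left := I.c₀_mem_right
  c₀_mem_right := I.c₀_mem_left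
  source_eq := I.target_eq
  target_eq := I.source_eq
  isSymplectic := I.isSymplectic.symm
  involution p hp τ τ' := by
    have hs : I.Φ.symm p ∈ I.Φ.source := I.Φ.map_target hp
    have hd : ∀ f : M₂ → ℝ, MDifferentiableAt (𝓡 4) 𝓘(ℝ, ℝ) f (I.Φ (I.Φ.symm p)) →
        MDifferentiableAt (𝓡 4) 𝓘(ℝ, ℝ) (f ∘ I.Φ) (I.Φ.symm p) := fun f hf =>
      hf.comp _ (I.isSymplectic.mdifferentiable.mdifferentiableAt hs)
    have h1 : comb τ S₂.F =ᶠ[𝓝 p] (comb τ S₂.F ∘ I.Φ) ∘ I.Φ.symm := by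
      filter_upwards [I.Φ.open_target.mem_nhds hp] with y hy
      simp only [Function.comp_apply, I.Φ.right_inv hy]
    have h2 := I.isSymplectic.symm.bracket_comp (f₁ := comb τ S₂.F) (g₁ := comb τ' S₁.F ∘ I.Φ.symm)
      (f₂ := comb τ S₂.F ∘ I.Φ) (g₂ := comb τ' S₁.F) hp
      (fun v => by
        rw [differential_congr h1]
        refine I.isSymplectic.symm.differential_comp hp (hd _ ?_) v
        exact ((contMDiffOn_comb S₂.smooth.contMDiffOn τ).contMDiffAt
          univ_mem).mdifferentiableAt (by simp))
      (fun v => I.isSymplectic.symm.differential_comp hp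
        (((contMDiffOn_comb S₁.smooth.contMDiffOn τ').contMDiffAt
          univ_mem).mdifferentiableAt (by simp)) v)
    rw [h2, SymplecticForm.bracket_swap, I.involution _ hs, neg_zero]

/-- The components of `F₂ ∘ Φ` commute with each other, so they belong to the commutant of `F₂ ∘ Φ`,
which is the commutant of `F₁`. -/
theorem nonempty_of_isomorphic (h : S₁.Isomorphic S₂) : Nonempty (FiberIsomorphism S₁ S₂) := by
  obtain ⟨W₁, W₂, Φ, hW₁, hc₁, hW₂, hc₂, hs, ht, hsm, hsm', hsymp, hcomm⟩ := h
  have hΦ : IsSymplectic S₁.Ω S₂.Ω Φ := ⟨hsm, hsm', hsymp⟩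
  refine ⟨⟨W₁, W₂, Φ, hW₁, hW₂, hc₁, hc₂, hs, ht, hΦ, fun p hp τ τ' => ?_⟩⟩
  have hmd : ∀ (τ : ℝ × ℝ) (p : M₂), MDifferentiableAt (𝓡 4) 𝓘(ℝ, ℝ) (comb τ S₂.F) p :=
    fun τ p => ((contMDiffOn_comb S₂.smooth.contMDiffOn τ).contMDiffAt
      univ_mem).mdifferentiableAt (by simp)
  have hz : ∀ τ, ∀ p ∈ Φ.source, S₁.Ω.bracket (comb τ S₂.F ∘ Φ) (comb τ' S₂.F ∘ Φ) p = 0 := by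
    intro τ p hp
    rw [hΦ.bracket_comp hp (hΦ.differential_comp hp (hmd τ _))
      (hΦ.differential_comp hp (hmd τ' _))]
    exact S₂.bracket_comb_comb _ _ _
  have hmem : comb τ' S₂.F ∘ Φ ∈ S₁.Ω.commutant (S₂.F ∘ Φ) Φ.source := by
    refine ⟨(contMDiffOn_comb (S₂.smooth.contMDiffOn (s := Set.univ)) τ').comp hsm
      fun _ _ => Set.mem_univ _,
      fun p hp => ⟨?_, ?_⟩⟩
    · have := hz (1, 0) p hp
      rwa [comb_one_zero] at this
    · have := hz (0, 1) p hp
      rwa [comb_zero_one] at this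
  rw [← hcomm] at hmem
  obtain ⟨h1, h2⟩ := hmem.2 p hp
  rw [S₁.Ω.bracket_comb (S₁.mdifferentiableAt p), h1, h2]
  simp

variable (I : FiberIsomorphism S₁ S₂)

theorem mem_source {p : M₁} : p ∈ I.Φ.source ↔ S₁.F p ∈ I.W₁ := by
  rw [I.source_eq]; rfl

theorem contMDiffOn_comp : ContMDiffOn (𝓡 4) 𝓘(ℝ, ℝ × ℝ) ∞ (S₂.F ∘ I.Φ) I.Φ.source :=
  S₂.smooth.comp_contMDiffOn I.isSymplectic.smooth

theorem mdifferentiableAt_comp {p : M₁} (hp : p ∈ I.Φ.source) :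
    MDifferentiableAt (𝓡 4) 𝓘(ℝ, ℝ × ℝ) (S₂.F ∘ I.Φ) p :=
  (I.contMDiffOn_comp.contMDiffAt (I.Φ.open_source.mem_nhds hp)).mdifferentiableAt (by simp)

/-- Involution kills the derivative along the Hamiltonian fields of `F₁`, and these span the kernel
of its differential at a regular point. -/
theorem mfderiv_comp_eq_zero {p : M₁} (hp : p ∈ I.Φ.source) (hreg : ¬ IsSingular S₁.F p)
    {v : TangentSpace (𝓡 4) p} (hv : (mfderiv (𝓡 4) 𝓘(ℝ, ℝ × ℝ) S₁.F p v : ℝ × ℝ) = 0) :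
    (mfderiv (𝓡 4) 𝓘(ℝ, ℝ × ℝ) (S₂.F ∘ I.Φ) p v : ℝ × ℝ) = 0 := by
  have h1 : ∀ τ τ' : ℝ × ℝ,
      differential (comb τ' (S₂.F ∘ I.Φ)) p (S₁.Ω.hamVec (comb τ S₁.F) p) = 0 := by
    intro τ τ'
    have h2 := I.involution p hp τ τ'
    rw [SymplecticForm.bracket_swap, SymplecticForm.bracket_eq, neg_neg] at h2
    exact h2
  have h2 : ∀ τ' : ℝ × ℝ, differential (comb τ' (S₂.F ∘ I.Φ)) p v = 0 := by
    intro τ'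
    obtain ⟨a, b, rfl⟩ := S₁.exists_eq_hamVec hreg hv
    rw [map_add, map_smul, map_smul, h1, h1]
    simp
  have hd := I.mdifferentiableAt_comp hp
  have h3 := h2 (1, 0)
  have h4 := h2 (0, 1)
  rw [differential_comb hd] at h3 h4
  simp only [one_mul, zero_mul, zero_add, add_zero] at h3 h4
  exact Prod.ext h3 h4

section Base

variable [IsManifold (𝓡 4) ∞ M₁]

theorem exists_local_factorization {p : M₁} (hp : p ∈ I.Φ.source) (hreg : ¬ IsSingular S₁.F p) :
    ∃ (B : Set (ℝ × ℝ)) (g : ℝ × ℝ → ℝ × ℝ), IsOpen B ∧ S₁.F p ∈ B ∧ ContDiffOn ℝ ∞ g B ∧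
      (∀ᶠ y in 𝓝 p, S₁.F y ∈ B ∧ S₂.F (I.Φ y) = g (S₁.F y)) ∧
      map S₁.F (𝓝 p) = 𝓝 (S₁.F p) :=
  S₁.toIntegrableSystem.exists_local_factorization hreg I.Φ.open_source hp I.contMDiffOn_comp
    fun _ hy hyreg _ hv => I.mfderiv_comp_eq_zero hy hyreg hv

/-- Off the value `c₀` every point of the fiber is regular, so `F₂ ∘ Φ` is locally constant on it,
and the fiber is connected. -/
theorem comp_eq_of_ne {x y : M₁} (hx : x ∈ I.Φ.source) (hne : S₁.F x ≠ S₁.c₀)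
    (hxy : S₁.F y = S₁.F x) : S₂.F (I.Φ x) = S₂.F (I.Φ y) := by
  refine (S₁.connected_fibers (S₁.F x)).induction₂ (fun a b => S₂.F (I.Φ a) = S₂.F (I.Φ b))
    ?_ (fun _ _ _ _ _ _ h h' => h.trans h') (fun _ _ _ _ h => h.symm) rfl hxy
  intro a ha
  have ha' : S₁.F a = S₁.F x := ha
  have has : a ∈ I.Φ.source := by rw [I.mem_source, ha', ← I.mem_source]; exact hx
  obtain ⟨B, g, -, -, -, hg, -⟩ := I.exists_local_factorization has
    (fun h => hne (by rw [← ha', S₁.singular_fiber a h]))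
  filter_upwards [hg.filter_mono nhdsWithin_le_nhds, self_mem_nhdsWithin] with b hb hbx
  have hbx' : S₁.F b = S₁.F x := hbx
  rw [hb.2, (hg.self_of_nhds).2, ha', hbx']

/-- `F_2 ∘ Φ` is a smooth function of `F_1` near every regular point, on the whole fibers. -/
theorem exists_factorization {p : M₁} (hp : p ∈ I.Φ.source) (hreg : ¬ IsSingular S₁.F p) :
    ∃ (B : Set (ℝ × ℝ)) (G : ℝ × ℝ → ℝ × ℝ), IsOpen B ∧ S₁.F p ∈ B ∧ B ⊆ I.W₁ ∧
      ContDiffOn ℝ ∞ G B ∧ ∀ x, S₁.F x ∈ B → S₂.F (I.Φ x) = G (S₁.F x) := by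
  obtain ⟨B₀, g, hB₀, hpB₀, hg, hev, hmap⟩ := I.exists_local_factorization hp hreg
  have hO := inter_mem hev (I.Φ.open_source.mem_nhds hp)
  have hB₁ := image_mem_map (m := S₁.F) hO
  rw [hmap] at hB₁
  -- Openness of the moment map at `p` puts `B` inside the image of the neighborhood where the local
  -- factorization holds, so every fiber over `B` meets it.
  obtain ⟨B, hBsub, hB, hpB⟩ := mem_nhds_iff.1
    (inter_mem hB₁ (hB₀.mem_nhds hpB₀))
  have hBW : B ⊆ I.W₁ := by
    intro c hc
    obtain ⟨⟨y, hy, rfl⟩, -⟩ := hBsub hc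
    exact I.mem_source.1 hy.2
  have hmain : ∀ x, S₁.F x ∈ B → S₁.F x ≠ S₁.c₀ → S₂.F (I.Φ x) = g (S₁.F x) := by
    intro x hx hne
    obtain ⟨⟨y, hy, hyx⟩, -⟩ := hBsub hx
    rw [I.comp_eq_of_ne (I.mem_source.2 (hBW hx)) hne hyx, ← hyx]
    exact hy.1.2
  refine ⟨B, g, hB, hpB, hBW, hg.mono fun c hc => (hBsub hc).2, fun x hx => ?_⟩
  have hFc : ContinuousAt S₁.F x := S₁.smooth.continuous.continuousAt
  have hxs : x ∈ I.Φ.source := I.mem_source.2 (hBW hx)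
  -- The fiber over `c₀` may contain singular points; there the identity follows by continuity,
  -- since the complement of that fiber is dense.
  refine tendsto_nhds_unique_of_frequently_eq
    (f := S₂.F ∘ I.Φ) (g := g ∘ S₁.F) (l := 𝓝 x) ?_ ?_ ?_
  · exact (I.contMDiffOn_comp.contMDiffAt (I.Φ.open_source.mem_nhds hxs)).continuousAt
  · exact ContinuousAt.comp
      (hg.continuousOn.continuousAt (hB₀.mem_nhds (hBsub hx).2)) hFc
  · refine ((S₁.frequently_ne x S₁.c₀).and_eventually (hFc.eventually (hB.mem_nhds hx))).mono ?_
    exact fun y hy => hmain y hy.2 hy.1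

end Base

end FiberIsomorphism

/-! ### Hessians -/

section Hessian

variable {M : Type*} [TopologicalSpace M] [ChartedSpace E4 M]
  {G : Type*} [NormedAddCommGroup G] [NormedSpace ℝ G]

theorem mfderiv_eq_fderiv_comp_chart_symm {f : M → G} {p : M} (hf : MDifferentiableAt (𝓡 4) 𝓘(ℝ, G) f p) :
    (mfderiv (𝓡 4) 𝓘(ℝ, G) f p : E4 →L[ℝ] G) =
      fderiv ℝ (f ∘ (chartAt E4 p).symm) (chartAt E4 p p) := by
  have h : fderivWithin ℝ (writtenInExtChartAt (𝓡 4) 𝓘(ℝ, G) p f) (Set.range (𝓡 4))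
      (extChartAt (𝓡 4) p p) = fderiv ℝ (f ∘ (chartAt E4 p).symm) (chartAt E4 p p) := by
    simp only [writtenInExtChartAt, mfld_simps, fderivWithin_univ]
    rfl
  exact hf.mfderiv.trans h

theorem contDiffAt_comp_chart_symm [IsManifold (𝓡 4) ∞ M] {f : M → G} {p : M}
    (hf : ContMDiffAt (𝓡 4) 𝓘(ℝ, G) ∞ f p) :
    ContDiffAt ℝ ∞ (f ∘ (chartAt E4 p).symm) (chartAt E4 p p) := by
  rw [← contMDiffAt_iff_contDiffAt]
  have hp := mem_chart_source E4 p
  refine ContMDiffAt.comp (I' := 𝓡 4) (chartAt E4 p p) ?_ ?_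
  · rwa [(chartAt E4 p).left_inv hp]
  · exact contMDiffOn_chart_symm.contMDiffAt
      ((chartAt E4 p).open_target.mem_nhds ((chartAt E4 p).map_source hp))

/-- The Hessian of a vector-valued function, read in the preferred chart. -/
def vecHessian (f : M → G) (p : M) (u v : TangentSpace (𝓡 4) p) : G :=
  fderiv ℝ (fderiv ℝ (f ∘ (chartAt E4 p).symm)) (chartAt E4 p p) (u : E4) (v : E4)

variable [IsManifold (𝓡 4) ∞ M]

/-- Used with `u` in the kernel of the differential of `f`: the first term then drops and only the
derivative of `g` acts on the Hessian. -/
theorem hessian_comp_left {f : M → G} {g : G → ℝ} {p : M}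
    (hf : ContMDiffAt (𝓡 4) 𝓘(ℝ, G) ∞ f p) (hg : ContDiffAt ℝ ∞ g (f p))
    (u v : TangentSpace (𝓡 4) p) :
    hessian (g ∘ f) p u v =
      fderiv ℝ (fderiv ℝ g) (f p) (mfderiv (𝓡 4) 𝓘(ℝ, G) f p u : G)
        (mfderiv (𝓡 4) 𝓘(ℝ, G) f p v : G) + fderiv ℝ g (f p) (vecHessian f p u v) := by
  have hp : (f ∘ (chartAt E4 p).symm) (chartAt E4 p p) = f p :=
    congrArg f ((chartAt E4 p).left_inv (mem_chart_source E4 p))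
  have h := fderiv_fderiv_comp (contDiffAt_comp_chart_symm hf) (g := g) (by rwa [hp])
    (u : E4) (v : E4)
  rw [hp, ← mfderiv_eq_fderiv_comp_chart_symm (hf.mdifferentiableAt (by simp))] at h
  exact h

theorem hessian_comb {F : M → ℝ × ℝ} {p : M} (hF : ContMDiffAt (𝓡 4) 𝓘(ℝ, ℝ × ℝ) ∞ F p)
    (τ : ℝ × ℝ) (u v : TangentSpace (𝓡 4) p) :
    hessian (comb τ F) p u v = τ.1 * (vecHessian F p u v).1 + τ.2 * (vecHessian F p u v).2 := by
  let g : ℝ × ℝ →L[ℝ] ℝ := τ.1 • ContinuousLinearMap.fst ℝ ℝ ℝ + τ.2 • ContinuousLinearMap.snd ℝ ℝ ℝ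
  have h := hessian_comp_left hF (g := g) g.contDiff.contDiffAt u v
  have h1 : fderiv ℝ (g : ℝ × ℝ → ℝ) = fun _ => g := by funext x; exact g.fderiv
  rw [h1] at h
  simp only [fderiv_fun_const] at h
  refine h.trans (Eq.trans (zero_add _) ?_)
  simp [g]

variable {M₂ : Type*} [TopologicalSpace M₂] [ChartedSpace E4 M₂] [IsManifold (𝓡 4) ∞ M₂]

/-- At a critical point the term with the second derivative of `Φ` is multiplied by the vanishing
differential of `f`, so the Hessian is a tensor there. -/
theorem hessian_comp_right {Φ : M → M₂} {f : M₂ → ℝ} {p : M}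
    (hΦ : ContMDiffAt (𝓡 4) (𝓡 4) ∞ Φ p) (hf : ContMDiffAt (𝓡 4) 𝓘(ℝ, ℝ) ∞ f (Φ p))
    (h0 : differential f (Φ p) = 0) (u v : TangentSpace (𝓡 4) p) :
    hessian (f ∘ Φ) p u v =
      hessian f (Φ p) (mfderiv (𝓡 4) (𝓡 4) Φ p u) (mfderiv (𝓡 4) (𝓡 4) Φ p v) := by
  set e := chartAt E4 (Φ p)
  have hΦp : Φ p ∈ e.source := mem_chart_source E4 (Φ p)
  have hpe := mem_chart_source E4 p
  have hev : f ∘ Φ =ᶠ[𝓝 p] (f ∘ e.symm) ∘ (e ∘ Φ) := by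
    filter_upwards [hΦ.continuousAt (e.open_source.mem_nhds hΦp)] with y hy
    simp only [Function.comp_apply]
    rw [e.left_inv hy]
  have hev' : (f ∘ Φ) ∘ (chartAt E4 p).symm =ᶠ[𝓝 (chartAt E4 p p)]
      ((f ∘ e.symm) ∘ (e ∘ Φ)) ∘ (chartAt E4 p).symm := by
    have hc := (chartAt E4 p).symm.continuousAt ((chartAt E4 p).map_source hpe)
    refine Filter.EventuallyEq.comp_tendsto (g := (chartAt E4 p).symm) hev ?_
    have := hc.tendsto
    rwa [(chartAt E4 p).left_inv hpe] at this
  have h1 : hessian (f ∘ Φ) p u v = hessian ((f ∘ e.symm) ∘ (e ∘ Φ)) p u v := by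
    unfold hessian
    rw [(hev'.fderiv).fderiv_eq]
  have heΦ : ContMDiffAt (𝓡 4) 𝓘(ℝ, E4) ∞ (e ∘ Φ) p :=
    ContMDiffAt.comp (I' := 𝓡 4) p
      (contMDiffOn_chart.contMDiffAt (e.open_source.mem_nhds hΦp)) hΦ
  have hd : ∀ w : TangentSpace (𝓡 4) p, (mfderiv (𝓡 4) 𝓘(ℝ, E4) (e ∘ Φ) p w : E4) =
      mfderiv (𝓡 4) (𝓡 4) Φ p w := by
    intro w
    have h : fderivWithin ℝ (writtenInExtChartAt (𝓡 4) (𝓡 4) p Φ) (Set.range (𝓡 4))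
        (extChartAt (𝓡 4) p p) =
          fderiv ℝ ((e ∘ Φ) ∘ (chartAt E4 p).symm) (chartAt E4 p p) := by
      simp only [writtenInExtChartAt, mfld_simps, fderivWithin_univ]
      rfl
    exact congrArg (fun A : E4 →L[ℝ] E4 => A w)
      ((mfderiv_eq_fderiv_comp_chart_symm (heΦ.mdifferentiableAt (by simp))).trans
        ((hΦ.mdifferentiableAt (by simp)).mfderiv.trans h).symm)
  have h2 := hessian_comp_left heΦ (g := f ∘ e.symm) (contDiffAt_comp_chart_symm hf) u v
  have h3 : fderiv ℝ (f ∘ e.symm) (e (Φ p)) = 0 :=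
    (mfderiv_eq_fderiv_comp_chart_symm (hf.mdifferentiableAt (by simp))).symm.trans h0
  rw [h1, h2, hd, hd]
  simp only [Function.comp_apply, h3, zero_apply, add_zero]
  rfl

end Hessian

/-! ### Non-degeneracy of the Hessians at a focus-focus point -/

section Omega

variable {m : ℕ}

theorem omegaCan_add_left (u u' v : V m) : omegaCan (u + u') v = omegaCan u v + omegaCan u' v := by
  simp only [omegaCan, ← Finset.sum_add_distrib]
  exact Finset.sum_congr rfl fun i _ => by simp; ring

theorem omegaCan_smul_left (c : ℝ) (u v : V m) : omegaCan (c • u) v = c * omegaCan u v := by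
  simp only [omegaCan, Finset.mul_sum]
  exact Finset.sum_congr rfl fun i _ => by simp; ring

theorem omegaCan_swap (u v : V m) : omegaCan u v = -omegaCan v u := by
  simp only [omegaCan, ← Finset.sum_neg_distrib]
  exact Finset.sum_congr rfl fun i _ => by ring

theorem omegaCan_add_right (u v v' : V m) : omegaCan u (v + v') = omegaCan u v + omegaCan u v' := by
  rw [omegaCan_swap, omegaCan_add_left, omegaCan_swap v, omegaCan_swap v']
  ring

theorem eq_zero_of_omegaCan {u : V m} (h : ∀ v, omegaCan u v = 0) : u = 0 := by
  funext i
  have h1 : ∀ w : ℝ × ℝ, (u i).1 * w.2 - (u i).2 * w.1 = 0 := by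
    intro w
    have := h (Pi.single i w)
    rwa [omegaCan, Finset.sum_eq_single i (fun j _ hj => by simp [Pi.single_eq_of_ne hj])
      (fun hi => absurd (Finset.mem_univ i) hi), Pi.single_eq_same] at this
  have h2 := h1 (0, 1)
  have h3 := h1 (1, 0)
  exact Prod.ext (by simpa using h2) (by simpa using h3)

theorem eq_of_omegaCan {u u' : V m} (h : ∀ v, omegaCan u v = omegaCan u' v) : u = u' := by
  refine sub_eq_zero.1 (eq_zero_of_omegaCan fun v => ?_)
  rw [sub_eq_add_neg, ← neg_one_smul ℝ u', omegaCan_add_left, omegaCan_smul_left, h]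
  ring

/-- The vector that represents a linear functional with respect to the canonical form. -/
def sharp : (V m →ₗ[ℝ] ℝ) →ₗ[ℝ] V m where
  toFun l i := (l (Pi.single i (0, 1)), -l (Pi.single i (1, 0)))
  map_add' l l' := by
    funext i
    ext
    · simp
    · simp; ring
  map_smul' c l := by
    funext i
    ext <;> simp

theorem omegaCan_sharp (l : V m →ₗ[ℝ] ℝ) (v : V m) : omegaCan (sharp l) v = l v := by
  conv_rhs => rw [← Finset.univ_sum_single v, map_sum]
  refine Finset.sum_congr rfl fun i _ => ?_
  have h : (Pi.single i (v i) : V m) =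
      (v i).1 • (Pi.single i (1, 0) : V m) + (v i).2 • (Pi.single i (0, 1) : V m) := by
    rw [← Pi.single_smul, ← Pi.single_smul, ← Pi.single_add]
    congr 1
    ext <;> simp
  rw [h, map_add, map_smul, map_smul]
  simp only [sharp, LinearMap.coe_mk, AddHom.coe_mk, smul_eq_mul]
  ring

theorem exists_end (β : V m →ₗ[ℝ] V m →ₗ[ℝ] ℝ) :
    ∃ A : Module.End ℝ (V m), ∀ u v, omegaCan (A u) v = β u v :=
  ⟨sharp ∘ₗ β, fun u v => omegaCan_sharp (β u) v⟩

theorem finrank_V (m : ℕ) : Module.finrank ℝ (V m) = 2 * m := by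
  rw [Module.finrank_pi_fintype]
  simp [mul_comm]

/-- The quadratic forms in the span of the focus-focus model are zero or non-degenerate. -/
theorem eq_zero_of_quadForm_mem_span {A : Module.End ℝ (V 2)} (hA : InSp A)
    (hq : quadForm A ∈ Submodule.span ℝ {q₁, q₂}) {z₀ : V 2} (hz₀ : z₀ ≠ 0) (h : A z₀ = 0) :
    A = 0 := by
  obtain ⟨a, b, hab⟩ := Submodule.mem_span_pair.1 hq
  have hsym : ∀ u v, omegaCan (A u) v = omegaCan (A v) u := by
    intro u v
    rw [omegaCan_swap (A v)]
    linarith [hA u v]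
  have hz : ∀ v, omegaCan (A z₀) v = 0 := fun v => by rw [h]; simp [omegaCan]
  have hquad : ∀ z, quadForm A z = a * q₁ z + b * q₂ z := fun z => by
    rw [← hab]; rfl
  -- A kernel vector is invisible to the quadratic form; evaluating at the basis vectors turns this
  -- invariance into four linear equations for `z₀`.
  have hpol : ∀ z, quadForm A (z₀ + z) = quadForm A z := by
    intro z
    change -(omegaCan (A (z₀ + z)) (z₀ + z)) / 2 = -(omegaCan (A z) z) / 2
    rw [map_add, omegaCan_add_left, omegaCan_add_right, omegaCan_add_right, hz, hz,
      hsym z z₀, hz]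
    ring
  have hz0 := hpol 0
  have e1 := hpol ![(1, 0), (0, 0)]
  have e2 := hpol ![(0, 1), (0, 0)]
  have e3 := hpol ![(0, 0), (1, 0)]
  have e4 := hpol ![(0, 0), (0, 1)]
  simp only [hquad, q₁, q₂, Pi.add_apply, Pi.zero_apply, Matrix.cons_val_zero, Matrix.cons_val_one,
    Prod.fst_add, Prod.snd_add, Prod.fst_zero, Prod.snd_zero] at hz0 e1 e2 e3 e4
  have f1 : a * (z₀ 1).2 + b * (z₀ 0).2 = 0 := by linarith
  have f2 : -a * (z₀ 1).1 + b * (z₀ 0).1 = 0 := by linarith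
  have f3 : -a * (z₀ 0).2 + b * (z₀ 1).2 = 0 := by linarith
  have f4 : a * (z₀ 0).1 + b * (z₀ 1).1 = 0 := by linarith
  -- The four equations combine to `(a² + b²) z₀ = 0`, coordinate by coordinate.
  have hab0 : a ^ 2 + b ^ 2 = 0 := by
    by_contra hne
    refine hz₀ ?_
    have g : ∀ t : ℝ, (a ^ 2 + b ^ 2) * t = 0 → t = 0 := fun t ht =>
      (mul_eq_zero.1 ht).resolve_left hne
    funext i
    fin_cases i
    · exact Prod.ext (g (z₀ 0).1 (by linear_combination a * f4 + b * f2))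
        (g (z₀ 0).2 (by linear_combination b * f1 - a * f3))
    · exact Prod.ext (g (z₀ 1).1 (by linear_combination b * f4 - a * f2))
        (g (z₀ 1).2 (by linear_combination a * f1 + b * f3))
  have ha : a = 0 := by nlinarith [sq_nonneg a, sq_nonneg b]
  have hb : b = 0 := by nlinarith [sq_nonneg a, sq_nonneg b]
  have h0 : ∀ z, omegaCan (A z) z = 0 := by
    intro z
    have h1 : -(omegaCan (A z) z) / 2 = a * q₁ z + b * q₂ z := hquad z
    rw [ha, hb] at h1
    linarith
  refine LinearMap.ext fun u => eq_zero_of_omegaCan fun v => ?_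
  have h1 := h0 (u + v)
  rw [map_add, omegaCan_add_left, omegaCan_add_right, omegaCan_add_right, h0, h0, hsym v u] at h1
  linarith

end Omega

namespace IntegrableSystem

variable {M : Type*} [TopologicalSpace M] [ChartedSpace E4 M] {S : IntegrableSystem M} {p : M}

/-- The kernel maps onto the four-dimensional `V 2`, so it is the whole tangent space and the point
has rank zero. -/
theorem ReducedCoordinates.ker_eq_top (π : S.ReducedCoordinates p 2) :
    LinearMap.ker (mfderiv (𝓡 4) 𝓘(ℝ, ℝ × ℝ) S.F p).toLinearMap = ⊤ := by
  have : FiniteDimensional ℝ (TangentSpace (𝓡 4) p) := inferInstanceAs (FiniteDimensional ℝ E4)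
  have h4 : Module.finrank ℝ (TangentSpace (𝓡 4) p) = 4 := finrank_euclideanSpace_fin
  refine Submodule.eq_top_of_finrank_eq (le_antisymm (Submodule.finrank_le _) ?_)
  have := LinearMap.finrank_le_finrank_of_surjective (f := π.toFun) π.surjective
  rw [finrank_V] at this
  omega

theorem ReducedCoordinates.mfderiv_eq_zero (π : S.ReducedCoordinates p 2) :
    mfderiv (𝓡 4) 𝓘(ℝ, ℝ × ℝ) S.F p = 0 :=
  ContinuousLinearMap.coe_injective (LinearMap.ker_eq_top.1 π.ker_eq_top)

theorem ReducedCoordinates.bijective (π : S.ReducedCoordinates p 2) :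
    Function.Bijective π.toFun := by
  have : FiniteDimensional ℝ (TangentSpace (𝓡 4) p) := inferInstanceAs (FiniteDimensional ℝ E4)
  have h4 : Module.finrank ℝ (TangentSpace (𝓡 4) p) = 4 := finrank_euclideanSpace_fin
  refine ⟨(LinearMap.injective_iff_surjective_of_finrank_eq_finrank ?_).2 π.surjective,
    π.surjective⟩
  rw [π.ker_eq_top, finrank_top, h4, finrank_V]

variable [IsManifold (𝓡 4) ∞ M]

/-- The map sending `τ` to the linearisation of the corresponding Hamiltonian field has the Cartan
subalgebra as image. By dimension it is injective, and by `eq_zero_of_quadForm_mem_span` a nonzero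
linearisation has no kernel. -/
theorem IsFocusFocus.eq_zero_of_hessian (h : S.IsFocusFocus p) {τ : ℝ × ℝ} (hτ : τ ≠ 0)
    {u : TangentSpace (𝓡 4) p} (hu : ∀ v, hessian (comb τ S.F) p u v = 0) : u = 0 := by
  obtain ⟨π, hC, hq⟩ := h
  let K := LinearMap.ker (mfderiv (𝓡 4) 𝓘(ℝ, ℝ × ℝ) S.F p).toLinearMap
  let e : K ≃ₗ[ℝ] V 2 := LinearEquiv.ofBijective π.toFun π.bijective
  let L : V 2 →ₗ[ℝ] E4 := K.subtype ∘ₗ (e.symm : V 2 →ₗ[ℝ] K)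
  have heL : ∀ z : V 2, π.toFun (e.symm z) = z := fun z => e.apply_symm_apply z
  let D : E4 →L[ℝ] E4 →L[ℝ] ℝ × ℝ :=
    fderiv ℝ (fderiv ℝ (S.F ∘ (chartAt E4 p).symm)) (chartAt E4 p p)
  have hhess : ∀ (σ : ℝ × ℝ) (u v : E4),
      hessian (comb σ S.F) p u v = σ.1 * (D u v).1 + σ.2 * (D u v).2 := fun σ u v =>
    hessian_comb (S.smooth.contMDiffAt) σ u v
  have hex : ∀ l : ℝ × ℝ →ₗ[ℝ] ℝ, ∃ A : Module.End ℝ (V 2), ∀ z z',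
      omegaCan (A z) z' = -l (D (L z) (L z')) := fun l =>
    exists_end (LinearMap.mk₂ ℝ (fun z z' => -l (D (L z) (L z')))
      (fun _ _ _ => by simp; ring) (fun _ _ _ => by simp)
      (fun _ _ _ => by simp; ring) (fun _ _ _ => by simp))
  obtain ⟨A₁, hA₁⟩ := hex (LinearMap.fst ℝ ℝ ℝ)
  obtain ⟨A₂, hA₂⟩ := hex (LinearMap.snd ℝ ℝ ℝ)
  let Θ : ℝ × ℝ →ₗ[ℝ] Module.End ℝ (V 2) :=
    (LinearMap.fst ℝ ℝ ℝ).smulRight A₁ + (LinearMap.snd ℝ ℝ ℝ).smulRight A₂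
  have hΘ : ∀ (σ : ℝ × ℝ) (z z' : V 2),
      omegaCan (Θ σ z) z' = -hessian (comb σ S.F) p (L z) (L z') := by
    intro σ z z'
    change omegaCan (σ.1 • A₁ z + σ.2 • A₂ z) z' = _
    rw [omegaCan_add_left, omegaCan_smul_left, omegaCan_smul_left, hA₁, hA₂, hhess]
    simp only [LinearMap.fst_apply, LinearMap.snd_apply]
    ring
  have hcrit : ∀ σ : ℝ × ℝ, differential (comb σ S.F) p = 0 := by
    intro σ
    ext v
    rw [differential_comb (S.mdifferentiableAt p), π.mfderiv_eq_zero]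
    change σ.1 * (0 : ℝ) + σ.2 * (0 : ℝ) = 0
    ring
  -- At rank zero the criticality condition is vacuous and the generating set is already a linear
  -- subspace.
  have hlin : S.linearised π = LinearMap.range Θ := by
    have h1 : {A : Module.End ℝ (V 2) | ∃ σ : ℝ × ℝ, differential (comb σ S.F) p = 0 ∧
        ∀ u v, omegaCan (A (π.toFun u)) (π.toFun v) = -hessian (comb σ S.F) p u v} =
          LinearMap.range Θ := by
      ext A
      constructor
      · rintro ⟨σ, -, hσ⟩
        refine ⟨σ, LinearMap.ext fun z => eq_of_omegaCan fun z' => ?_⟩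
        rw [hΘ, ← heL z, ← heL z', hσ]
        simp only [heL]
        rfl
      · rintro ⟨σ, rfl⟩
        refine ⟨σ, hcrit σ, fun u v => ?_⟩
        rw [hΘ]
        change -hessian (comb σ S.F) p (e.symm (e u) : K) (e.symm (e v) : K) = _
        rw [e.symm_apply_apply, e.symm_apply_apply]
    unfold linearised
    rw [h1, Submodule.span_eq]
  have hinj : Function.Injective Θ := by
    have h1 := Θ.finrank_range_add_finrank_ker
    rw [← hlin, hC.finrank_eq] at h1
    have h2 : Module.finrank ℝ (ℝ × ℝ) = 2 := by simp
    rw [← LinearMap.ker_eq_bot, ← Submodule.finrank_eq_zero (R := ℝ)]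
    omega
  by_contra hne
  have huK : u ∈ K := by rw [show K = ⊤ from π.ker_eq_top]; trivial
  have hmem : Θ τ ∈ S.linearised π := by rw [hlin]; exact ⟨τ, rfl⟩
  refine hτ (hinj ?_)
  rw [map_zero]
  refine eq_zero_of_quadForm_mem_span (hC.inSp _ hmem)
    (hq ▸ Submodule.mem_map_of_mem hmem) (z₀ := e ⟨u, huK⟩) ?_ ?_
  · intro h0
    exact hne (congrArg Subtype.val (e.map_eq_zero_iff.1 h0))
  · refine eq_zero_of_omegaCan fun z => ?_
    rw [hΘ]
    change -hessian (comb τ S.F) p (e.symm (e ⟨u, huK⟩) : K) (e.symm z : K) = 0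
    rw [e.symm_apply_apply, hu, neg_zero]

end IntegrableSystem

/-! ### Transport of focus-focus points -/

theorem pullCovector_surjective {A : ℝ × ℝ →L[ℝ] ℝ × ℝ} (hA : Function.Injective A) :
    Function.Surjective (pullCovector A) := by
  intro σ
  have hdet := det_ne_zero_of_injective hA
  set d := (A (1, 0)).1 * (A (0, 1)).2 - (A (1, 0)).2 * (A (0, 1)).1 with hd
  -- Cramer's rule for the transposed matrix.
  refine ⟨((σ.1 * (A (0, 1)).2 - σ.2 * (A (1, 0)).2) / d,
    ((A (1, 0)).1 * σ.2 - (A (0, 1)).1 * σ.1) / d), ?_⟩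
  refine Prod.ext ?_ ?_
  · simp only [pullCovector]
    field_simp
    rw [hd]
    ring
  · simp only [pullCovector]
    field_simp
    rw [hd]
    ring

section Transport

variable {M₁ : Type*} [TopologicalSpace M₁] [ChartedSpace E4 M₁] [IsManifold (𝓡 4) ∞ M₁]
  {M₂ : Type*} [TopologicalSpace M₂] [ChartedSpace E4 M₂] [IsManifold (𝓡 4) ∞ M₂]
  {S₁ : IntegrableSystem M₁} {S₂ : IntegrableSystem M₂} {Φ : OpenPartialHomeomorph M₁ M₂}
  {p : M₁} {G : ℝ × ℝ → ℝ × ℝ}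

omit [IsManifold (𝓡 4) ∞ M₁] in
theorem hessian_congr {f g : M₁ → ℝ} (h : f =ᶠ[𝓝 p] g) (u v : TangentSpace (𝓡 4) p) :
    hessian f p u v = hessian g p u v := by
  have hpe := mem_chart_source E4 p
  have hc := ((chartAt E4 p).symm.continuousAt ((chartAt E4 p).map_source hpe)).tendsto
  rw [(chartAt E4 p).left_inv hpe] at hc
  have h' : f ∘ (chartAt E4 p).symm =ᶠ[𝓝 (chartAt E4 p p)] g ∘ (chartAt E4 p).symm :=
    h.comp_tendsto hc
  unfold hessian
  rw [(h'.fderiv).fderiv_eq]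

theorem fderiv_comb {c : ℝ × ℝ} (hG : DifferentiableAt ℝ G c) (τ w : ℝ × ℝ) :
    fderiv ℝ (comb τ G) c w = τ.1 * (fderiv ℝ G c w).1 + τ.2 * (fderiv ℝ G c w).2 := by
  let l : ℝ × ℝ →L[ℝ] ℝ := τ.1 • ContinuousLinearMap.fst ℝ ℝ ℝ + τ.2 • ContinuousLinearMap.snd ℝ ℝ ℝ
  have h := (l.hasFDerivAt.comp c hG.hasFDerivAt).fderiv
  have h1 : (l ∘ G : ℝ × ℝ → ℝ) = comb τ G := by
    funext x; simp [l, comb]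
  rw [← h1, h]
  simp [l]

/-- One Hessian at `p` computed in two ways: through `Φ`, where criticality makes it tensorial, and
through `G ∘ F₁`, where `u` in the kernel removes the second derivative of `G`. -/
theorem hessian_comb_of_factorization (hΦ : IsSymplectic S₁.Ω S₂.Ω Φ) (hp : p ∈ Φ.source)
    (hG : ContDiffAt ℝ ∞ G (S₁.F p)) (hfac : ∀ᶠ x in 𝓝 p, S₂.F (Φ x) = G (S₁.F x))
    (h0 : mfderiv (𝓡 4) 𝓘(ℝ, ℝ × ℝ) S₂.F (Φ p) = 0) (τ : ℝ × ℝ)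
    {u : TangentSpace (𝓡 4) p} (hu : (mfderiv (𝓡 4) 𝓘(ℝ, ℝ × ℝ) S₁.F p u : ℝ × ℝ) = 0)
    (v : TangentSpace (𝓡 4) p) :
    hessian (comb τ S₂.F) (Φ p) (mfderiv (𝓡 4) (𝓡 4) Φ p u) (mfderiv (𝓡 4) (𝓡 4) Φ p v) =
      τ.1 * (fderiv ℝ G (S₁.F p) (vecHessian S₁.F p u v)).1 +
        τ.2 * (fderiv ℝ G (S₁.F p) (vecHessian S₁.F p u v)).2 := by
  have hd : differential (comb τ S₂.F) (Φ p) = 0 := by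
    ext v
    rw [differential_comb (S₂.mdifferentiableAt _), h0]
    change τ.1 * (0 : ℝ) + τ.2 * (0 : ℝ) = 0
    ring
  have hev : comb τ S₂.F ∘ Φ =ᶠ[𝓝 p] comb τ G ∘ S₁.F := by
    filter_upwards [hfac] with x hx
    simp only [comb, Function.comp_apply, hx]
  have hl : ContDiff ℝ ∞ fun c : ℝ × ℝ => τ.1 * c.1 + τ.2 * c.2 := by fun_prop
  rw [← hessian_comp_right (hΦ.smooth.contMDiffAt (Φ.open_source.mem_nhds hp))
    ((contMDiffOn_comb S₂.smooth.contMDiffOn τ).contMDiffAt univ_mem) hd, hessian_congr hev]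
  have h3 := hessian_comp_left S₁.smooth.contMDiffAt (g := comb τ G) (hl.contDiffAt.comp _ hG) u v
  rw [fderiv_comb (hG.differentiableAt (by simp))] at h3
  refine h3.trans ?_
  have h4 : ∀ B : ℝ × ℝ →L[ℝ] ℝ × ℝ →L[ℝ] ℝ, ∀ w : ℝ × ℝ,
      B (mfderiv (𝓡 4) 𝓘(ℝ, ℝ × ℝ) S₁.F p u : ℝ × ℝ) w = 0 := by
    intro B w
    have h5 : B (mfderiv (𝓡 4) 𝓘(ℝ, ℝ × ℝ) S₁.F p u : ℝ × ℝ) = 0 :=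
      (congrArg B hu).trans (map_zero B)
    exact congrArg (fun l : ℝ × ℝ →L[ℝ] ℝ => l w) h5
  exact (congrArg (· + _) (h4 _ _)).trans (zero_add _)

/-- The differential of `F₁` at `p` has a nonzero kernel vector `u`, as it maps four dimensions to
two. A covector `τ` annihilating the image of `dG` makes the Hessian of the `τ`-combination vanish
on the image of `u`, which non-degeneracy forbids unless `τ = 0`. -/
theorem bijective_fderiv_of_factorization (hΦ : IsSymplectic S₁.Ω S₂.Ω Φ) (hp : p ∈ Φ.source)
    (hG : ContDiffAt ℝ ∞ G (S₁.F p)) (hfac : ∀ᶠ x in 𝓝 p, S₂.F (Φ x) = G (S₁.F x))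
    (hff : S₂.IsFocusFocus (Φ p)) : Function.Bijective (fderiv ℝ G (S₁.F p)) := by
  have h0 : mfderiv (𝓡 4) 𝓘(ℝ, ℝ × ℝ) S₂.F (Φ p) = 0 := hff.choose.mfderiv_eq_zero
  obtain ⟨u, hu0, hu⟩ : ∃ u : TangentSpace (𝓡 4) p, u ≠ 0 ∧
      (mfderiv (𝓡 4) 𝓘(ℝ, ℝ × ℝ) S₁.F p u : ℝ × ℝ) = 0 := by
    let A : E4 →ₗ[ℝ] ℝ × ℝ := (mfderiv (𝓡 4) 𝓘(ℝ, ℝ × ℝ) S₁.F p).toLinearMap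
    have h1 : LinearMap.ker A ≠ ⊥ := by
      refine LinearMap.ker_ne_bot_of_finrank_lt ?_
      rw [finrank_euclideanSpace_fin]
      simp
    obtain ⟨u, hu, hu0⟩ := Submodule.exists_mem_ne_zero_of_ne_bot h1
    exact ⟨u, hu0, hu⟩
  have hinj : ∀ τ : ℝ × ℝ, (∀ w, τ.1 * (fderiv ℝ G (S₁.F p) w).1 +
      τ.2 * (fderiv ℝ G (S₁.F p) w).2 = 0) → τ = 0 := by
    intro τ hτ
    by_contra hne
    refine hu0 (hΦ.mdifferentiable.mfderiv_injective hp ?_)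
    rw [map_zero]
    refine hff.eq_zero_of_hessian hne fun w => ?_
    obtain ⟨v, rfl⟩ := hΦ.mdifferentiable.mfderiv_surjective hp w
    rw [hessian_comb_of_factorization hΦ hp hG hfac h0 τ hu, hτ]
  have hsurj : Function.Surjective (fderiv ℝ G (S₁.F p)).toLinearMap := by
    rw [← LinearMap.dualMap_injective_iff, injective_iff_map_eq_zero]
    intro l hl
    have hl' : ∀ c : ℝ × ℝ, l c = l (1, 0) * c.1 + l (0, 1) * c.2 := by
      intro c
      have : c = c.1 • ((1 : ℝ), (0 : ℝ)) + c.2 • ((0 : ℝ), (1 : ℝ)) := by ext <;> simp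
      conv_lhs => rw [this, map_add, map_smul, map_smul]
      simp only [smul_eq_mul]
      ring
    have h1 := hinj (l (1, 0), l (0, 1)) fun w => by
      rw [← hl']
      exact LinearMap.congr_fun hl w
    rw [Prod.mk_eq_zero] at h1
    ext <;> simp [h1.1, h1.2]
  exact ⟨LinearMap.injective_iff_surjective.2 hsurj, hsurj⟩

/-- Focus-focus points are preserved. -/
theorem isFocusFocus_of_factorization (hΦ : IsSymplectic S₁.Ω S₂.Ω Φ) (hp : p ∈ Φ.source)
    (hG : ContDiffAt ℝ ∞ G (S₁.F p)) (hfac : ∀ᶠ x in 𝓝 p, S₂.F (Φ x) = G (S₁.F x))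
    (hff : S₂.IsFocusFocus (Φ p)) :
    mfderiv (𝓡 4) 𝓘(ℝ, ℝ × ℝ) S₁.F p = 0 ∧ S₁.IsFocusFocus p := by
  have hb := bijective_fderiv_of_factorization hΦ hp hG hfac hff
  obtain ⟨π, hC, hq⟩ := hff
  have h0 := π.mfderiv_eq_zero
  have hker := π.ker_eq_top
  -- The composite of `dG` with the differential of `F₁` vanishes since `Φ p` has rank zero, and
  -- `dG` is injective.
  have h01 : mfderiv (𝓡 4) 𝓘(ℝ, ℝ × ℝ) S₁.F p = 0 := by
    refine ContinuousLinearMap.ext fun v => hb.1 ?_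
    have hGd := hG.differentiableAt (n := ∞) (by simp)
    have h1 := (mfderiv_comp_apply_prod (S₁.mdifferentiableAt p) hGd).2 v
    have h2 := (S₂.mdifferentiableAt (Φ p)).hasMFDerivAt.comp p
      (hΦ.mdifferentiable.mdifferentiableAt hp).hasMFDerivAt
    have hev : S₂.F ∘ Φ =ᶠ[𝓝 p] G ∘ S₁.F := hfac
    rw [← hev.mfderiv_eq, h2.mfderiv, h0] at h1
    exact h1.symm.trans (map_zero _).symm
  have hhess : ∀ (τ : ℝ × ℝ) (u v : TangentSpace (𝓡 4) p),
      hessian (comb τ S₂.F) (Φ p) (mfderiv (𝓡 4) (𝓡 4) Φ p u) (mfderiv (𝓡 4) (𝓡 4) Φ p v) =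
        τ.1 * (fderiv ℝ G (S₁.F p) (vecHessian S₁.F p u v)).1 +
          τ.2 * (fderiv ℝ G (S₁.F p) (vecHessian S₁.F p u v)).2 := by
    intro τ u v
    refine hessian_comb_of_factorization hΦ hp hG hfac h0 τ ?_ v
    rw [h01]
    rfl
  have hhess₁ : ∀ (τ : ℝ × ℝ) (u v : TangentSpace (𝓡 4) p), hessian (comb τ S₁.F) p u v =
      τ.1 * (vecHessian S₁.F p u v).1 + τ.2 * (vecHessian S₁.F p u v).2 := fun τ =>
    hessian_comb S₁.smooth.contMDiffAt τ
  have hpull : ∀ (τ : ℝ × ℝ) (u v : TangentSpace (𝓡 4) p),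
      hessian (comb (pullCovector (fderiv ℝ G (S₁.F p)) τ) S₁.F) p u v =
        τ.1 * (fderiv ℝ G (S₁.F p) (vecHessian S₁.F p u v)).1 +
          τ.2 * (fderiv ℝ G (S₁.F p) (vecHessian S₁.F p u v)).2 := by
    intro τ u v
    have h5 : vecHessian S₁.F p u v =
      ((vecHessian S₁.F p u v).1, (vecHessian S₁.F p u v).2) := rfl
    rw [hhess₁, h5, fderiv_prod_apply]
    simp only [pullCovector, Prod.fst_add, Prod.snd_add, Prod.smul_fst, Prod.smul_snd,
      smul_eq_mul]
    ring
  have hmem₂ : ∀ v : TangentSpace (𝓡 4) (Φ p),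
      v ∈ LinearMap.ker (mfderiv (𝓡 4) 𝓘(ℝ, ℝ × ℝ) S₂.F (Φ p)).toLinearMap := fun v => by
    rw [hker]; trivial
  let ρ : LinearMap.ker (mfderiv (𝓡 4) 𝓘(ℝ, ℝ × ℝ) S₁.F p).toLinearMap →ₗ[ℝ]
      LinearMap.ker (mfderiv (𝓡 4) 𝓘(ℝ, ℝ × ℝ) S₂.F (Φ p)).toLinearMap :=
    LinearMap.codRestrict _ ((mfderiv (𝓡 4) (𝓡 4) Φ p).toLinearMap ∘ₗ Submodule.subtype _)
      fun v => hmem₂ _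
  have hρ : Function.Surjective ρ := by
    intro v
    obtain ⟨u, hu⟩ := hΦ.mdifferentiable.mfderiv_surjective hp (v : TangentSpace (𝓡 4) (Φ p))
    refine ⟨⟨u, ?_⟩, Subtype.ext hu⟩
    rw [h01]
    rfl
  have hcrit : ∀ τ : ℝ × ℝ, differential (comb τ S₁.F) p = 0 ∧
      differential (comb τ S₂.F) (Φ p) = 0 := by
    intro τ
    constructor
    · ext v
      rw [differential_comb (S₁.mdifferentiableAt _), h01]
      change τ.1 * (0 : ℝ) + τ.2 * (0 : ℝ) = 0
      ring
    · ext v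
      rw [differential_comb (S₂.mdifferentiableAt _), h0]
      change τ.1 * (0 : ℝ) + τ.2 * (0 : ℝ) = 0
      ring
  let π₁ : S₁.ReducedCoordinates p 2 :=
    { toFun := π.toFun ∘ₗ ρ
      surjective := π.surjective.comp hρ
      symplectic := fun u v => (π.symplectic (ρ u) (ρ v)).trans (hΦ.symplectic p hp u v) }
  -- The combinations of the two systems are matched by `pullCovector` of `dG`, which is onto;
  -- matched combinations have the same Hessian, hence the same linearisation.
  have hlin : S₁.linearised π₁ = S₂.linearised π := by
    unfold IntegrableSystem.linearised
    congr 1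
    ext A
    constructor
    · rintro ⟨τ, -, hA⟩
      obtain ⟨τ, rfl⟩ := pullCovector_surjective hb.1 τ
      refine ⟨τ, (hcrit τ).2, fun u v => ?_⟩
      obtain ⟨u, rfl⟩ := hρ u
      obtain ⟨v, rfl⟩ := hρ v
      exact (hA u v).trans (neg_inj.2 ((hpull τ u v).trans (hhess τ u v).symm))
    · rintro ⟨τ, -, hA⟩
      refine ⟨pullCovector (fderiv ℝ G (S₁.F p)) τ, (hcrit _).1, fun u v => ?_⟩
      exact (hA (ρ u) (ρ v)).trans (neg_inj.2 ((hhess τ u v).trans (hpull τ u v).symm))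
  exact ⟨h01, π₁, hlin ▸ hC, hlin ▸ hq⟩

end Transport

/-! ### The diffeomorphism of the bases -/

theorem contDiff_q : ContDiff ℝ ∞ q := by
  unfold q q₁ q₂
  fun_prop

/-- The focus-focus model is a submersion at the points `(δ, 0, 0, 0)` with `δ ≠ 0`. -/
theorem surjective_fderiv_q {δ : ℝ} (hδ : δ ≠ 0) :
    Function.Surjective (fderiv ℝ q ![(δ, 0), (0, 0)]) := by
  intro c
  set z : V 2 := ![(δ, 0), (0, 0)] with hz
  -- The quadratic map `q` is linear along `z + t v`, where it equals `t c`.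
  let v : V 2 := ![(0, c.2 / δ), (0, c.1 / δ)]
  refine ⟨v, ?_⟩
  have h1 : HasDerivAt (fun t : ℝ => z + t • v) v 0 := by
    simpa using ((hasDerivAt_id (0 : ℝ)).smul_const v).const_add z
  have h2 : HasFDerivAt q (fderiv ℝ q z) (z + (0 : ℝ) • v) := by
    rw [zero_smul, add_zero]
    exact ((contDiff_q.differentiable (by simp)) z).hasFDerivAt
  have h3 := h2.comp_hasDerivAt (0 : ℝ) h1
  have h4 : (q ∘ fun t : ℝ => z + t • v) = fun t : ℝ => t • c := by
    funext t
    ext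
    · simp [q, q₁, z, v]
      field_simp
    · simp [q, q₂, z, v]
      field_simp
  have h5 : HasDerivAt (fun t : ℝ => t • c) c 0 := by
    simpa using (hasDerivAt_id (0 : ℝ)).smul_const c
  rw [h4] at h3
  exact h3.unique h5

namespace FFNeighborhood.EliassonIsomorphism

variable {M : Type*} [TopologicalSpace M] [ChartedSpace E4 M] {S : FFNeighborhood M}

theorem F_eq_c₀_iff (N : S.EliassonIsomorphism) {x : M} (hx : x ∈ N.φ.source) :
    S.F x = S.c₀ ↔ q (N.φ x) = 0 := by
  have h1 : S.F x ∈ N.g.source := by rw [N.g_source]; exact ⟨x, hx, rfl⟩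
  rw [← N.commutes x hx, ← N.g_c₀]
  exact ⟨fun h => congrArg N.g h, fun h => N.g.injOn h1 N.c₀_mem h⟩

/-- The model points `(δ, 0, 0, 0)` lie on the zero fiber of `q` and `q` is a submersion there, so
the singular fiber has regular points close to `p₀`. -/
theorem exists_regular (N : S.EliassonIsomorphism) : ∃ x, S.F x = S.c₀ ∧ ¬ IsSingular S.F x := by
  have hcont : Tendsto (fun δ : ℝ => (![(δ, 0), (0, 0)] : V 2)) (𝓝[≠] 0) (𝓝 0) := by
    have h1 : Continuous fun δ : ℝ => (![(δ, 0), (0, 0)] : V 2) := by fun_prop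
    have h2 := h1.tendsto 0
    have h3 : (![((0 : ℝ), (0 : ℝ)), (0, 0)] : V 2) = 0 := by
      funext i; fin_cases i <;> rfl
    rw [h3] at h2
    exact h2.mono_left nhdsWithin_le_nhds
  obtain ⟨δ, hδt, hδ⟩ := ((hcont.eventually (N.φ.open_target.mem_nhds N.zero_mem)).and
    self_mem_nhdsWithin).exists
  have hδ0 : δ ≠ 0 := hδ
  set z : V 2 := ![(δ, 0), (0, 0)] with hz
  set x := N.φ.symm z with hx
  have hxs : x ∈ N.φ.source := N.φ.map_target hδt
  have hφx : N.φ x = z := N.φ.right_inv hδt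
  have hFx : S.F x = S.c₀ := by
    rw [N.F_eq_c₀_iff hxs, hφx]
    simp [q, q₁, q₂, z]
  refine ⟨x, hFx, not_not.2 ?_⟩
  have hgs : S.F x ∈ N.g.source := by rw [hFx]; exact N.c₀_mem
  have hφd : MDifferentiableAt (𝓡 4) 𝓘(ℝ, V 2) N.φ x :=
    (N.φ_smooth.contMDiffAt (N.φ.open_source.mem_nhds hxs)).mdifferentiableAt (by simp)
  have hqd : MDifferentiableAt 𝓘(ℝ, V 2) 𝓘(ℝ, ℝ × ℝ) q (N.φ x) :=
    ((contDiff_q.differentiable (by simp)) _).mdifferentiableAt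
  have hev : q ∘ N.φ =ᶠ[𝓝 x] N.g ∘ S.F := by
    filter_upwards [N.φ.open_source.mem_nhds hxs] with y hy
    exact (N.commutes y hy).symm
  have h1 : ∀ v : TangentSpace (𝓡 4) x, fderiv ℝ q z (mfderiv (𝓡 4) 𝓘(ℝ, V 2) N.φ x v : V 2) =
      fderiv ℝ N.g (S.F x) (mfderiv (𝓡 4) 𝓘(ℝ, ℝ × ℝ) S.F x v : ℝ × ℝ) := by
    intro v
    refine Eq.trans ?_ ((mfderiv_comp_apply_prod (S.mdifferentiableAt x)
      (N.differentiableAt_g hgs)).2 v)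
    rw [← hev.mfderiv_eq, (hqd.hasMFDerivAt.comp x hφd.hasMFDerivAt).mfderiv,
      mfderiv_eq_fderiv, hφx]
    rfl
  have hφm : N.φ.MDifferentiable (𝓡 4) 𝓘(ℝ, V 2) :=
    ⟨N.φ_smooth.mdifferentiableOn (by simp), N.φ_symm_smooth.mdifferentiableOn (by simp)⟩
  -- Surjectivity of the composite makes the derivative of `g` onto, hence bijective, and then the
  -- differential of `F` is onto as well.
  have hsurj : Function.Surjective (fderiv ℝ N.g (S.F x)).toLinearMap := by
    intro c
    obtain ⟨w, hw⟩ := surjective_fderiv_q hδ0 c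
    obtain ⟨v, hv⟩ := hφm.mfderiv_surjective hxs w
    exact ⟨_, (h1 v).symm.trans ((congrArg (fderiv ℝ q z) hv).trans hw)⟩
  have hinj := LinearMap.injective_iff_surjective.2 hsurj
  intro c
  obtain ⟨w, hw⟩ := surjective_fderiv_q hδ0 (fderiv ℝ N.g (S.F x) c)
  obtain ⟨v, hv⟩ := hφm.mfderiv_surjective hxs w
  exact ⟨v, hinj ((h1 v).symm.trans ((congrArg (fderiv ℝ q z) hv).trans hw))⟩

end FFNeighborhood.EliassonIsomorphism

namespace FiberIsomorphism

variable {M₁ M₂ : Type*} [TopologicalSpace M₁] [ChartedSpace E4 M₁]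
  [TopologicalSpace M₂] [ChartedSpace E4 M₂] {S₁ : FFNeighborhood M₁} {S₂ : FFNeighborhood M₂}

/-- A diffeomorphism `E` between neighborhoods of the focus-focus values with
`F_2 ∘ Φ = E ∘ F_1`. -/
structure BaseMap (I : FiberIsomorphism S₁ S₂) where
  E : OpenPartialHomeomorph (ℝ × ℝ) (ℝ × ℝ)
  c₀_mem : S₁.c₀ ∈ E.source
  source_subset : E.source ⊆ I.W₁
  smooth : ContDiffOn ℝ ∞ E E.source
  symm_smooth : ContDiffOn ℝ ∞ E.symm E.target
  comp_eq : ∀ x, S₁.F x ∈ E.source → S₂.F (I.Φ x) = E (S₁.F x)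
  map_p₀ : I.Φ S₁.p₀ = S₂.p₀

/-- The factorization is examined at the preimage of the second focus-focus point, where
non-degeneracy makes the factor a local diffeomorphism; this preimage is then focus-focus, hence
equal to the first focus-focus point. -/
theorem nonempty_baseMap [IsManifold (𝓡 4) ∞ M₁] [IsManifold (𝓡 4) ∞ M₂]
    (I : FiberIsomorphism S₁ S₂) (N : S₁.EliassonIsomorphism) : Nonempty I.BaseMap := by
  have hp₂ : S₂.p₀ ∈ I.Φ.target := by
    rw [I.target_eq, Set.mem_preimage, S₂.F_p₀]
    exact I.c₀_mem_right
  set p := I.Φ.symm S₂.p₀ with hpdef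
  have hp : p ∈ I.Φ.source := I.Φ.map_target hp₂
  have hΦp : I.Φ p = S₂.p₀ := I.Φ.right_inv hp₂
  -- Smooth factorization starts only from a regular point, and `p` may be singular; another point
  -- of its fiber is used, provided by the Eliasson isomorphism when the fiber is the singular one.
  obtain ⟨x, hxF, hx⟩ : ∃ x, S₁.F x = S₁.F p ∧ ¬ IsSingular S₁.F x := by
    by_cases h : S₁.F p = S₁.c₀
    · rw [h]
      exact N.exists_regular
    · exact ⟨p, rfl, fun hs => h (S₁.singular_fiber p hs)⟩
  have hxs : x ∈ I.Φ.source := by rw [I.mem_source, hxF, ← I.mem_source]; exact hp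
  obtain ⟨B, G, hB, hxB, hBW, hG, hfac⟩ := I.exists_factorization hxs hx
  have hpB : S₁.F p ∈ B := hxF ▸ hxB
  have hGp : ContDiffAt ℝ ∞ G (S₁.F p) := hG.contDiffAt (hB.mem_nhds hpB)
  have hev : ∀ᶠ y in 𝓝 p, S₂.F (I.Φ y) = G (S₁.F y) := by
    filter_upwards [S₁.smooth.continuous.continuousAt (hB.mem_nhds hpB)] with y hy
    exact hfac y hy
  have hff : S₂.IsFocusFocus (I.Φ p) := by rw [hΦp]; exact S₂.focusFocus
  have hb := bijective_fderiv_of_factorization I.isSymplectic hp hGp hev hff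
  obtain ⟨h0, hff₁⟩ := isFocusFocus_of_factorization I.isSymplectic hp hGp hev hff
  have hsing : IsSingular S₁.F p := by
    intro hs
    obtain ⟨v, hv⟩ := hs ((1 : ℝ), (0 : ℝ))
    rw [h0] at hv
    have : (0 : ℝ × ℝ) = (1, 0) := hv
    simp [Prod.ext_iff] at this
  have hpc := S₁.singular_fiber p hsing
  have hpp := S₁.multiplicity_one p hpc hff₁
  obtain ⟨E, hcE, hEB, hEG, hEs⟩ := exists_openPartialHomeomorph hB hG hpB hb
  refine ⟨⟨E, hpc ▸ hcE, hEB.trans hBW, ?_, hEs, fun y hy => ?_, hpp ▸ hΦp⟩⟩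
  · rw [hEG]
    exact hG.mono hEB
  · rw [hEG]
    exact hfac y (hEB hy)

namespace BaseMap

variable {I : FiberIsomorphism S₁ S₂} (b : I.BaseMap)

theorem mem_source {x : M₁} (hx : S₁.F x ∈ b.E.source) : x ∈ I.Φ.source :=
  I.mem_source.2 (b.source_subset hx)

theorem E_c₀ : b.E S₁.c₀ = S₂.c₀ := by
  have h := b.comp_eq S₁.p₀ (by rw [S₁.F_p₀]; exact b.c₀_mem)
  rw [b.map_p₀, S₂.F_p₀, S₁.F_p₀] at h
  exact h.symm

/-- The inverse of `Φ` maps whole fibers to fibers. -/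
theorem F_symm_eq {x : M₁} (hx : S₁.F x ∈ b.E.source) {y : M₂}
    (hy : S₂.F y = b.E (S₁.F x)) : y ∈ I.Φ.target ∧ S₁.F (I.Φ.symm y) = S₁.F x := by
  have hxs := b.mem_source hx
  have hsub : S₂.F ⁻¹' {b.E (S₁.F x)} ⊆ I.Φ.target := by
    intro y hy
    have hy' : S₂.F y = b.E (S₁.F x) := hy
    have h1 := I.Φ.map_source hxs
    rw [I.target_eq, Set.mem_preimage, b.comp_eq x hx] at h1
    rw [I.target_eq, Set.mem_preimage, hy']
    exact h1
  refine ⟨hsub hy, ?_⟩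
  have hpre : IsPreconnected ((S₁.F ∘ I.Φ.symm) '' (S₂.F ⁻¹' {b.E (S₁.F x)})) :=
    (S₂.connected_fibers _).image _
      (S₁.smooth.continuous.comp_continuousOn (I.Φ.continuousOn_symm.mono hsub))
  -- Injectivity of `E` isolates `F₁ x` in this image; being connected, the image is that single
  -- point.
  have hiso : ∀ c ∈ (S₁.F ∘ I.Φ.symm) '' (S₂.F ⁻¹' {b.E (S₁.F x)}), c ∈ b.E.source →
      c = S₁.F x := by
    rintro _ ⟨z, hz, rfl⟩ hzE
    have hz' : S₂.F z = b.E (S₁.F x) := hz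
    have h1 := b.comp_eq _ hzE
    rw [I.Φ.right_inv (hsub hz), hz'] at h1
    exact b.E.injOn hzE hx h1.symm
  have hmem : S₁.F x ∈ (S₁.F ∘ I.Φ.symm) '' (S₂.F ⁻¹' {b.E (S₁.F x)}) :=
    ⟨I.Φ x, b.comp_eq x hx, congrArg S₁.F (I.Φ.left_inv hxs)⟩
  rcases isPreconnected_iff_subset_of_disjoint.1 hpre b.E.source {S₁.F x}ᶜ b.E.open_source
    isOpen_compl_singleton (fun c _ => by
      by_cases h : c = S₁.F x
      · exact Or.inl (h ▸ hx)
      · exact Or.inr h)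
    (Set.eq_empty_iff_forall_notMem.2 fun c hc => hc.2.2 (hiso c hc.1 hc.2.1)) with h | h
  · exact hiso _ ⟨y, hy, rfl⟩ (h ⟨y, hy, rfl⟩)
  · exact absurd rfl (h hmem)

end BaseMap

end FiberIsomorphism

/-! ### Transport of Eliasson isomorphisms -/

namespace FFNeighborhood.EliassonIsomorphism

variable {M₁ M₂ : Type*} [TopologicalSpace M₁] [ChartedSpace E4 M₁]
  [TopologicalSpace M₂] [ChartedSpace E4 M₂] {S₁ : FFNeighborhood M₁} {S₂ : FFNeighborhood M₂}
  {I : FiberIsomorphism S₁ S₂}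

theorem moment_image_domain (N : S₁.EliassonIsomorphism) :
    N.moment '' N.domain = N.g.target := by
  unfold moment domain
  rw [Set.image_comp, Set.image_preimage_eq_of_subset (Set.image_subset_range _ _), ← N.g_source,
    N.g.image_source_eq_target]

/-- The first component of the Eliasson isomorphism transported by a fiber isomorphism. -/
def transportφ (N : S₁.EliassonIsomorphism) (b : I.BaseMap) : OpenPartialHomeomorph M₂ (V 2) :=
  I.Φ.symm.trans (N.φ.restrOpen (S₁.F ⁻¹' b.E.source)
    (b.E.open_source.preimage S₁.smooth.continuous))

variable (N : S₁.EliassonIsomorphism) (b : I.BaseMap)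

theorem mem_transportφ_source {y : M₂} : y ∈ (N.transportφ b).source ↔
    y ∈ I.Φ.target ∧ I.Φ.symm y ∈ N.φ.source ∧ S₁.F (I.Φ.symm y) ∈ b.E.source := by
  unfold transportφ
  rw [OpenPartialHomeomorph.trans_source, OpenPartialHomeomorph.restrOpen_source]
  rfl

theorem mem_transportφ_source_of_mem {x : M₁} (hx : x ∈ N.φ.source) (hxE : S₁.F x ∈ b.E.source) :
    I.Φ x ∈ (N.transportφ b).source := by
  rw [N.mem_transportφ_source b, I.Φ.left_inv (b.mem_source hxE)]
  exact ⟨I.Φ.map_source (b.mem_source hxE), hx, hxE⟩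

theorem transportφ_apply (y : M₂) : N.transportφ b y = N.φ (I.Φ.symm y) := rfl

theorem F_eq_of_mem_transportφ_source {y : M₂} (hy : y ∈ (N.transportφ b).source) :
    S₂.F y = b.E (S₁.F (I.Φ.symm y)) := by
  obtain ⟨h1, -, h3⟩ := (N.mem_transportφ_source b).1 hy
  rw [← b.comp_eq _ h3, I.Φ.right_inv h1]

theorem transport_source_eq : (b.E.symm.trans N.g).source = S₂.F '' (N.transportφ b).source := by
  ext c
  rw [OpenPartialHomeomorph.trans_source]
  constructor
  · rintro ⟨hc, hcg⟩
    have hc' : b.E.symm c ∈ b.E.source := b.E.map_target hc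
    rw [Set.mem_preimage, N.g_source] at hcg
    obtain ⟨x, hx, hxc⟩ := hcg
    rw [← hxc] at hc'
    refine ⟨I.Φ x, N.mem_transportφ_source_of_mem b hx hc', ?_⟩
    rw [b.comp_eq x hc', hxc]
    exact b.E.right_inv hc
  · rintro ⟨y, hy, rfl⟩
    obtain ⟨h1, h2, h3⟩ := (N.mem_transportφ_source b).1 hy
    rw [N.F_eq_of_mem_transportφ_source b hy]
    refine ⟨b.E.map_source h3, ?_⟩
    rw [Set.mem_preimage, b.E.left_inv h3, N.g_source]
    exact ⟨_, h2, rfl⟩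

theorem transport_commutes {y : M₂} (hy : y ∈ (N.transportφ b).source) :
    (b.E.symm.trans N.g) (S₂.F y) = q (N.transportφ b y) := by
  obtain ⟨h1, h2, h3⟩ := (N.mem_transportφ_source b).1 hy
  rw [N.F_eq_of_mem_transportφ_source b hy, transportφ_apply, ← N.commutes _ h2,
    OpenPartialHomeomorph.coe_trans, Function.comp_apply, b.E.left_inv h3]

/-- The Eliasson isomorphism transported by a fiber isomorphism. -/
def transport : S₂.EliassonIsomorphism where
  φ := N.transportφ b
  g := b.E.symm.trans N.g
  p₀_mem := by
    rw [← b.map_p₀]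
    exact N.mem_transportφ_source_of_mem b N.p₀_mem (by rw [S₁.F_p₀]; exact b.c₀_mem)
  -- That `φ.symm 0` lies over `c₀` is enough to place it in the domain of the transported map.
  zero_mem := by
    have h1 := N.φ.map_target N.zero_mem
    have h2 : S₁.F (N.φ.symm 0) = S₁.c₀ := by
      rw [N.F_eq_c₀_iff h1, N.φ.right_inv N.zero_mem]
      simp [q, q₁, q₂]
    have h3 : S₁.F (N.φ.symm 0) ∈ b.E.source := h2 ▸ b.c₀_mem
    have h4 := (N.transportφ b).map_source (N.mem_transportφ_source_of_mem b h1 h3)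
    rwa [transportφ_apply, I.Φ.left_inv (b.mem_source h3), N.φ.right_inv N.zero_mem] at h4
  φ_smooth := N.φ_smooth.comp
    (I.isSymplectic.symm_smooth.mono fun _ hy => ((N.mem_transportφ_source b).1 hy).1)
    fun _ hy => ((N.mem_transportφ_source b).1 hy).2.1
  φ_symm_smooth := by
    have h : ∀ z ∈ (N.transportφ b).target, z ∈ N.φ.target ∧ N.φ.symm z ∈ I.Φ.source := by
      intro z hz
      rw [transportφ, OpenPartialHomeomorph.trans_target] at hz
      exact ⟨hz.1.1, hz.2⟩
    exact I.isSymplectic.smooth.comp (N.φ_symm_smooth.mono fun z hz => (h z hz).1)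
      fun z hz => (h z hz).2
  φ_symplectic y hy u v := by
    obtain ⟨h1, h2, -⟩ := (N.mem_transportφ_source b).1 hy
    have hd1 : MDifferentiableAt (𝓡 4) 𝓘(ℝ, V 2) N.φ (I.Φ.symm y) :=
      (N.φ_smooth.contMDiffAt (N.φ.open_source.mem_nhds h2)).mdifferentiableAt (by simp)
    have hd2 := (hd1.hasMFDerivAt.comp y
      (I.isSymplectic.symm.mdifferentiable.mdifferentiableAt h1).hasMFDerivAt).mfderiv
    have hd3 : ∀ w : TangentSpace (𝓡 4) y,
        (mfderiv (𝓡 4) 𝓘(ℝ, V 2) (N.transportφ b) y w : V 2) =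
          mfderiv (𝓡 4) 𝓘(ℝ, V 2) N.φ (I.Φ.symm y) (mfderiv (𝓡 4) (𝓡 4) I.Φ.symm y w) :=
      fun w => congrArg (fun A : E4 →L[ℝ] V 2 => A w) hd2
    rw [hd3, hd3]
    exact (N.φ_symplectic _ h2 _ _).trans (I.isSymplectic.symm.symplectic y h1 u v)
  g_source := N.transport_source_eq b
  g_target := by
    rw [← (b.E.symm.trans N.g).image_source_eq_target, N.transport_source_eq b,
      ← (N.transportφ b).image_source_eq_target, ← Set.image_comp, ← Set.image_comp]
    exact Set.image_congr fun y hy => N.transport_commutes b hy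
  g_smooth := N.g_smooth.comp (b.symm_smooth.mono fun _ hc => hc.1) fun _ hc => hc.2
  g_symm_smooth := by
    rw [OpenPartialHomeomorph.trans_symm_eq_symm_trans_symm, OpenPartialHomeomorph.symm_symm]
    exact b.smooth.comp (N.g_symm_smooth.mono fun _ hc => hc.1) fun _ hc => hc.2
  g_c₀ := by
    rw [← b.E_c₀, OpenPartialHomeomorph.coe_trans, Function.comp_apply, b.E.left_inv b.c₀_mem,
      N.g_c₀]
  commutes _ hy := N.transport_commutes b hy

theorem transport_moment {x : M₁} (hx : S₁.F x ∈ b.E.source) :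
    (N.transport b).moment (I.Φ x) = N.moment x := by
  change N.g (b.E.symm (S₂.F (I.Φ x))) = N.g (S₁.F x)
  rw [b.comp_eq x hx, b.E.left_inv hx]

theorem differential_transport_moment {x : M₁} (hx : S₁.F x ∈ b.E.source)
    (hxg : S₁.F x ∈ N.g.source) (τ : ℝ × ℝ) (v : TangentSpace (𝓡 4) x) :
    differential (comb τ N.moment) x v =
      differential (comb τ (N.transport b).moment) (I.Φ x) (mfderiv (𝓡 4) (𝓡 4) I.Φ x v) := by
  have hd : I.Φ x ∈ (N.transport b).domain := by
    rw [mem_domain]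
    refine ⟨?_, ?_⟩
    · rw [b.comp_eq x hx]
      exact b.E.map_source hx
    · rw [b.comp_eq x hx, Set.mem_preimage]
      change b.E.symm (b.E (S₁.F x)) ∈ N.g.source
      rwa [b.E.left_inv hx]
  have hev : comb τ N.moment =ᶠ[𝓝 x] comb τ (N.transport b).moment ∘ I.Φ := by
    filter_upwards [S₁.smooth.continuous.continuousAt (b.E.open_source.mem_nhds hx)] with y hy
    simp only [comb, Function.comp_apply]
    rw [N.transport_moment b hy]
  rw [differential_congr hev]
  refine I.isSymplectic.differential_comp (b.mem_source hx) ?_ v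
  have hl : Differentiable ℝ fun c : ℝ × ℝ => τ.1 * c.1 + τ.2 * c.2 := by fun_prop
  exact (hl _).mdifferentiableAt.comp _ ((N.transport b).mdifferentiableAt_moment hd)

/-- The transported moment map composed with `Φ` is the old one, so integral curves correspond and
the period sets are equal, with no change of `h`. The converse direction needs `F_symm_eq`, as the
inverse of `Φ` must carry the entire fiber into one fiber. -/
theorem isRegularizedAction_transport {h : ℝ × ℝ → ℝ} (hN : N.IsRegularizedAction h) :
    (N.transport b).IsRegularizedAction h := by
  obtain ⟨⟨W, hW, h0W, -, hsm, hper⟩, h0, hI⟩ := hN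
  refine ⟨⟨W ∩ (N.transport b).g.target, hW.inter (N.transport b).g.open_target,
    ⟨h0W, (N.transport b).zero_mem_g_target⟩, ?_, hsm.mono Set.inter_subset_left, ?_⟩, h0, hI⟩
  · rw [moment_image_domain]
    exact Set.inter_subset_right
  · rintro w ⟨hwW, hwt⟩ hw0
    rw [← hper w hwW hw0]
    set c := (N.transport b).g.symm w with hc
    have hcs : c ∈ (N.transport b).g.source := (N.transport b).g.map_target hwt
    have hcw : N.g (b.E.symm c) = w := (N.transport b).g.right_inv hwt
    have hcs' : c ∈ b.E.target ∧ b.E.symm c ∈ N.g.source := hcs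
    obtain ⟨hcE, hcg⟩ := hcs'
    have hcE' := b.E.map_target hcE
    ext τ
    constructor
    · refine mem_periods_of_isSymplectic I.isSymplectic.symm (N.transport b) N fun y hy hyw => ?_
      have hyc : S₂.F y = c := (N.transport b).g.injOn ((N.transport b).mem_domain.1 hy) hcs
        (hyw.trans ((N.transport b).g.right_inv hwt).symm)
      obtain ⟨x, hx, hxc⟩ : ∃ x ∈ N.φ.source, S₁.F x = b.E.symm c := by
        rw [N.g_source] at hcg
        exact hcg
      have hxE : S₁.F x ∈ b.E.source := hxc ▸ hcE'
      obtain ⟨hyt, hyx⟩ := b.F_symm_eq hxE (y := y) (by rw [hyc, hxc, b.E.right_inv hcE])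
      have hyE : S₁.F (I.Φ.symm y) ∈ b.E.source := hyx ▸ hxE
      have hyg : S₁.F (I.Φ.symm y) ∈ N.g.source := by rw [hyx, hxc]; exact hcg
      refine ⟨hyt, N.mem_domain.2 hyg, ?_, fun v => ?_⟩
      · rw [moment, Function.comp_apply, hyx, hxc, hcw]
      · have h1 := N.differential_transport_moment b hyE hyg τ
          (mfderiv (𝓡 4) (𝓡 4) I.Φ.symm y v)
        rw [h1]
        have h2 : (mfderiv (𝓡 4) (𝓡 4) I.Φ (I.Φ.symm y)
            (mfderiv (𝓡 4) (𝓡 4) I.Φ.symm y v) : E4) = (v : E4) :=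
          congrArg (fun A : E4 →L[ℝ] E4 => A v) (I.isSymplectic.mdifferentiable.comp_symm_deriv hyt)
        have h3 : ∀ y' : M₂, y' = y → ∀ u : E4,
            differential (comb τ (N.transport b).moment) y' u =
              differential (comb τ (N.transport b).moment) y u := by
          rintro y' rfl u; rfl
        refine Eq.trans ?_ (h3 _ (I.Φ.right_inv hyt) _).symm
        exact (congrArg (differential (comb τ (N.transport b).moment) y) h2).symm
    · refine mem_periods_of_isSymplectic I.isSymplectic N (N.transport b) fun x hx hxw => ?_
      have hxg : S₁.F x ∈ N.g.source := N.mem_domain.1 hx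
      have hxc : S₁.F x = b.E.symm c := N.g.injOn hxg hcg (hxw.trans hcw.symm)
      have hxE : S₁.F x ∈ b.E.source := hxc ▸ hcE'
      refine ⟨b.mem_source hxE, (N.transport b).mem_domain.2 ?_, ?_, N.differential_transport_moment b hxE hxg τ⟩
      · rw [b.comp_eq x hxE, hxc, b.E.right_inv hcE]
        exact hcs
      · rw [N.transport_moment b hxE, hxw]

end FFNeighborhood.EliassonIsomorphism

/-! ### Invariance of the Taylor series orbit -/

namespace FFNeighborhood

theorem taylorSeriesOrbit_eq {M : Type*} [TopologicalSpace M] [ChartedSpace E4 M]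
    [IsManifold (𝓡 4) ∞ M] {S : FFNeighborhood M} (N : S.EliassonIsomorphism) {h : ℝ × ℝ → ℝ}
    (hN : N.IsRegularizedAction h) : S.taylorSeriesOrbit = taylorOrbit h := by
  ext T
  constructor
  · rintro ⟨N', h', hN', hT⟩
    rwa [N.taylorOrbit_eq N' hN hN']
  · exact fun hT => ⟨N, h, hN, hT⟩

variable {M₁ M₂ : Type*} [TopologicalSpace M₁] [ChartedSpace E4 M₁] [IsManifold (𝓡 4) ∞ M₁]
  [TopologicalSpace M₂] [ChartedSpace E4 M₂] [IsManifold (𝓡 4) ∞ M₂]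
  {S₁ : FFNeighborhood M₁} {S₂ : FFNeighborhood M₂}

/-- The Eliasson isomorphism that witnesses membership also serves to build the base map along which
it is transported. -/
theorem taylorSeriesOrbit_subset (I : FiberIsomorphism S₁ S₂) :
    S₁.taylorSeriesOrbit ⊆ S₂.taylorSeriesOrbit := by
  rintro T ⟨N, h, hN, hT⟩
  obtain ⟨b⟩ := I.nonempty_baseMap N
  exact ⟨N.transport b, h, N.isRegularizedAction_transport b hN, hT⟩

theorem taylorSeriesOrbit_eq_of_isomorphic (h : S₁.Isomorphic S₂) :
    S₁.taylorSeriesOrbit = S₂.taylorSeriesOrbit := by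
  obtain ⟨I⟩ := FiberIsomorphism.nonempty_of_isomorphic h
  exact (taylorSeriesOrbit_subset I).antisymm (taylorSeriesOrbit_subset I.symm)

end FFNeighborhood

end FocusFocus

end

theorem mainTheorem3
    {M M₁ M₂ : Type*}
    [TopologicalSpace M] [T2Space M] [SecondCountableTopology M]
    [ChartedSpace E4 M] [IsManifold (𝓡 4) ∞ M]
    [TopologicalSpace M₁] [T2Space M₁] [SecondCountableTopology M₁]
    [ChartedSpace E4 M₁] [IsManifold (𝓡 4) ∞ M₁]
    [TopologicalSpace M₂] [T2Space M₂] [SecondCountableTopology M₂]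
    [ChartedSpace E4 M₂] [IsManifold (𝓡 4) ∞ M₂]
    (S : FFNeighborhood M) (S₁ : FFNeighborhood M₁) (S₂ : FFNeighborhood M₂)
    (h₁ : S.Isomorphic S₁) (h₂ : S.Isomorphic S₂) :
    S₁.taylorSeriesOrbit = S₂.taylorSeriesOrbit ∧
    (∀ (N : S₁.EliassonIsomorphism) (h : ℝ × ℝ → ℝ), N.IsRegularizedAction h →
      S₁.taylorSeriesOrbit = taylorOrbit h) ∧
    (∀ (N : S₂.EliassonIsomorphism) (h : ℝ × ℝ → ℝ), N.IsRegularizedAction h →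
      S₂.taylorSeriesOrbit = taylorOrbit h) := by
  exact ⟨(FFNeighborhood.taylorSeriesOrbit_eq_of_isomorphic h₁).symm.trans
      (FFNeighborhood.taylorSeriesOrbit_eq_of_isomorphic h₂),
    fun N _ hN => FFNeighborhood.taylorSeriesOrbit_eq N hN,
    fun N _ hN => FFNeighborhood.taylorSeriesOrbit_eq N hN⟩
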